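/- **Model.** For $\lambda>0$, $\rho\in(0,1)$ let $\mathbb P_{\lambda,\rho,n}$ be the law of $Y=\lambda\theta\theta^{\top}+W$, where $\theta\in\{0,1\}^n$ has i.i.d. $\mathrm{Ber}(\rho)$ entries and $W$, independent of $\theta$, is a symmetric $n\times n$ matrix with independent entries $(W_{ij})_{i\le j}$, $W_{ij}\sim\mathcal N(0,1)$ for $i<j$ and $W_{ii}\sim\mathcal N(0,2)$; let $\mathbb Q_n$ be the law of $W$. An *algorithm* is a sequence of programs (one for each problem size, with arbitrary real constants) for a randomized real random access machine: unit-cost real arithmetic $+,-,\times,/,\sqrt{\cdot}$ and comparisons, indirect addressing through natural-number index registers, and access to a tape of i.i.d. standard Gaussians. It has running time at most $t$ if the program has at most $t$ instructions and halts within $t$ steps on every input and every tape. An algorithm with output $\mathcal X=\mathcal X(Y)\in\mathbb R^{n\times n}$ achieves *weak recovery* if for some constant $c>0$ and all large $n$, with $\Theta=\lambda\theta\theta^\top$, $$\mathbb E\left[\frac{\langle \mathcal X,\Theta\rangle}{\|\mathcal X\|_F\,\|\Theta\|_F}\right]\ge c ,$$ the quotient being read as $0$ when its denominator vanishes. **Regime.**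 Say that $(n_k,\lambda_k,\rho_k)$ is in the hard regime if $n_k\to\infty$ and, as $k\to\infty$, $$\frac{(\log n_k)^2}{\sqrt{n_k}}\ll\rho_k\ll\frac1{\log n_k},\qquad \lambda_k^2\rho_k^2n_k\ll\frac1{(\log n_k)^2}.\tag{1}$$ **Low-degree heuristic.** For laws $\mathbb P,\mathbb Q$ on $\mathbb R^d$ put $\mathsf{Adv}_{\le D}(\mathbb P;\mathbb Q)=\sup_{\deg f\le D}\mathbb E_{\mathbb P}[f]/\sqrt{\mathbb E_{\mathbb Q}[f^2]}$. The heuristic holds for a sequence of testing problems $(\mathbb P_k,\mathbb Q_k)$ on $\mathbb R^{d_k}$ if for every sequence $D_k\in\mathbb N$ with $\mathsf{Adv}_{\le D_k}(\mathbb P_k;\mathbb Q_k)=1+o(1)$ there is a constant $C>0$ such that no algorithm with running time at most $d_k^{D_k/(C\log d_k)}$ (for large $k$) achieves weak detection, i.e. satisfies $\mathbb Q_k(\mathcal A=1)+\mathbb P_k(\mathcal A=0)\le1-\varepsilon$ for some fixed $\varepsilon>0$ and all large $k$. The *hidden-sample problem* with $M$ samples built from $(\mathbb P,\mathbb Q)$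 is to test $\overline{\mathbb Q}$: $\mathsf Y_1,\dots,\mathsf Y_M$ i.i.d. from $\mathbb Q$, against $\overline{\mathbb P}$: for a uniformly random $\kappa\in\{1,\dots,M\}$, $\mathsf Y_\kappa\sim\mathbb P$ and the other $\mathsf Y_j\sim\mathbb Q$, all independent given $\kappa$. **Theorem.** Assume that the low-degree heuristic holds for the hidden-sample problems with $M_k\ge1$ samples built from $(\mathbb P_{\lambda_k,\rho_k,n_k},\mathbb Q_{n_k})$, for all sequences $(n_k,\lambda_k,\rho_k)$ in the hard regime and all sequences $(M_k)$. 1. Let $\lambda=\lambda_n$, $\rho=\rho_n$ satisfy (1) with $n_k=k$. Then any algorithm that achieves weak recovery has running time at least $\exp\big(\Omega(\lambda^{-2}(\log n)^{-4})\big)$: if its running time is at most $t_n$ for every $n$, then there is $c>0$ with $t_n\ge\exp(c\,\lambda_n^{-2}(\log n)^{-4})$ for all large $n$. 2. In particular, let $\lambda=n^{-a}$, $\rho=n^{-b}$ with constants $a>0$, $0<b<\tfrac12$ and $2a+2b>1$. Then any algorithm that achieves weak recovery has running time at least $\exp(n^{2a-o(1)})$. -/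

import Mathlib

open MeasureTheory ProbabilityTheory Filter Topology Asymptotics
open scoped ENNReal

noncomputable section

/-! ### Algorithms: a real random access machine with a step count -/

/-- Instructions of a randomized real random access machine.  The machine has index registers
(natural numbers), an unbounded memory of real cells which is addressed only through index
registers, and a random tape of independent standard Gaussians, also addressed through index
registers.  Below `[i]` is the content of index register `i`. -/
inductive RInstr : Type
  /-- `[i] := k` -/
  | idxConst (i k : ℕ)
  /-- `[i] := [j] + [k]` -/
  | idxAdd (i j k : ℕ)
  /-- `[i] := [j] - [k]` (truncated at zero) -/
  | idxSub (i j k : ℕ)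
  /-- if `[i] ≤ [j]`, jump to line `l` -/
  | idxJumpLe (i j l : ℕ)
  /-- `mem [i] := c` -/
  | const (i : ℕ) (c : ℝ)
  /-- `mem [i] := mem [j]` -/
  | copy (i j : ℕ)
  /-- `mem [i] := mem [j] + mem [k]` -/
  | add (i j k : ℕ)
  /-- `mem [i] := mem [j] - mem [k]` -/
  | sub (i j k : ℕ)
  /-- `mem [i] := mem [j] * mem [k]` -/
  | mul (i j k : ℕ)
  /-- `mem [i] := mem [j] / mem [k]` (division by zero returns zero) -/
  | div (i j k : ℕ)
  /-- `mem [i] := √(mem [j])` (zero for a negative argument) -/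
  | sqrt (i j : ℕ)
  /-- `mem [i] :=` the Gaussian at position `[j]` of the random tape -/
  | gauss (i j : ℕ)
  /-- if `mem [i] ≤ mem [j]`, jump to line `l` -/
  | jumpLe (i j l : ℕ)

/-- A program is a finite list of instructions. -/
abbrev RProgram : Type := List RInstr

/-- Configuration of the machine: program counter, index registers, real memory. -/
structure RState : Type where
  pc : ℕ
  idx : ℕ → ℕ
  mem : ℕ → ℝ

/-- The effect of a single instruction; `ω` is the random tape. -/
def RInstr.exec (ω : ℕ → ℝ) (s : RState) : RInstr → RState
  | .idxConst i k => ⟨s.pc + 1, Function.update s.idx i k, s.mem⟩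
  | .idxAdd i j k => ⟨s.pc + 1, Function.update s.idx i (s.idx j + s.idx k), s.mem⟩
  | .idxSub i j k => ⟨s.pc + 1, Function.update s.idx i (s.idx j - s.idx k), s.mem⟩
  | .idxJumpLe i j l => ⟨if s.idx i ≤ s.idx j then l else s.pc + 1, s.idx, s.mem⟩
  | .const i c => ⟨s.pc + 1, s.idx, Function.update s.mem (s.idx i) c⟩
  | .copy i j => ⟨s.pc + 1, s.idx, Function.update s.mem (s.idx i) (s.mem (s.idx j))⟩
  | .add i j k =>
      ⟨s.pc + 1, s.idx, Function.update s.mem (s.idx i) (s.mem (s.idx j) + s.mem (s.idx k))⟩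
  | .sub i j k =>
      ⟨s.pc + 1, s.idx, Function.update s.mem (s.idx i) (s.mem (s.idx j) - s.mem (s.idx k))⟩
  | .mul i j k =>
      ⟨s.pc + 1, s.idx, Function.update s.mem (s.idx i) (s.mem (s.idx j) * s.mem (s.idx k))⟩
  | .div i j k =>
      ⟨s.pc + 1, s.idx, Function.update s.mem (s.idx i) (s.mem (s.idx j) / s.mem (s.idx k))⟩
  | .sqrt i j => ⟨s.pc + 1, s.idx, Function.update s.mem (s.idx i) (Real.sqrt (s.mem (s.idx j)))⟩
  | .gauss i j => ⟨s.pc + 1, s.idx, Function.update s.mem (s.idx i) (ω (s.idx j))⟩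
  | .jumpLe i j l =>
      ⟨if s.mem (s.idx i) ≤ s.mem (s.idx j) then l else s.pc + 1, s.idx, s.mem⟩

namespace RProgram

/-- One step of the machine; it stays put once the program counter has left the program. -/
def step (p : RProgram) (ω : ℕ → ℝ) (s : RState) : RState :=
  match p[s.pc]? with
  | some c => c.exec ω s
  | none => s

/-- Initial configuration: the input occupies the first `d` memory cells, everything else is 0. -/
def start {d : ℕ} (x : Fin d → ℝ) : RState :=
  ⟨0, fun _ => 0, fun a => if h : a < d then x ⟨a, h⟩ else 0⟩

/-- The configuration after `t` steps. -/
def after (p : RProgram) (ω : ℕ → ℝ) {d : ℕ} (x : Fin d → ℝ) (t : ℕ) : RState :=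
  (p.step ω)^[t] (start x)

/-- The program has halted after `t` steps. -/
def HaltsAt (p : RProgram) (ω : ℕ → ℝ) {d : ℕ} (x : Fin d → ℝ) (t : ℕ) : Prop :=
  p.length ≤ (p.after ω x t).pc

/-- The memory when the program halts. -/
def finalMem (p : RProgram) (ω : ℕ → ℝ) {d : ℕ} (x : Fin d → ℝ) : ℕ → ℝ :=
  (p.after ω x (sInf {t | p.HaltsAt ω x t})).mem

/-- `p` has running time at most `b` on inputs of dimension `d`: on every input and every random
tape it halts after at most `b` steps.  As programs may change with the problem size, the program
text is charged as well. -/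
def RunsWithin (p : RProgram) (d : ℕ) (b : ℝ) : Prop :=
  (p.length : ℝ) ≤ b ∧ ∀ (x : Fin d → ℝ) (ω : ℕ → ℝ), ∃ t : ℕ, (t : ℝ) ≤ b ∧ p.HaltsAt ω x t

/-- Use of a program as a test: it answers `1` if cell `0` is positive at the end,
and `0` otherwise. -/
def Accepts (p : RProgram) (ω : ℕ → ℝ) {d : ℕ} (x : Fin d → ℝ) : Prop :=
  0 < p.finalMem ω x 0

/-- Use of a program as an estimator: the `n * n` input matrix is read row by row, and the first
`n * n` cells at the end are the output matrix, row by row. -/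
def estimate (p : RProgram) (ω : ℕ → ℝ) {n : ℕ} (Y : Fin n × Fin n → ℝ) : Fin n × Fin n → ℝ :=
  fun e => p.finalMem ω (fun a : Fin (n * n) => Y (finProdFinEquiv.symm a))
    (finProdFinEquiv e : Fin (n * n))

end RProgram

/-- Law of the random tape: independent standard Gaussians. -/
def tapeLaw : Measure (ℕ → ℝ) := Measure.infinitePi fun _ : ℕ => gaussianReal 0 1

/-! ### The planted submatrix model -/

/-- The Bernoulli law with parameter `ρ`, as a law on `{0, 1} ⊆ ℝ`. -/
def berLaw (ρ : ℝ) : Measure ℝ :=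
  ENNReal.ofReal ρ • Measure.dirac 1 + ENNReal.ofReal (1 - ρ) • Measure.dirac 0

/-- Law of the signal `θ` with i.i.d. Bernoulli entries. -/
def signalLaw (n : ℕ) (ρ : ℝ) : Measure (Fin n → ℝ) := Measure.pi fun _ => berLaw ρ

/-- Law `ℚ_n` of the symmetric Gaussian matrix `W`: the entries on and above the diagonal are
independent, with variance `2` on the diagonal and variance `1` above it. -/
def noiseLaw (n : ℕ) : Measure (Fin n × Fin n → ℝ) :=
  (Measure.pi fun e : Fin n × Fin n => gaussianReal 0 (if e.1 = e.2 then 2 else 1)).map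
    fun g e => g (min e.1 e.2, max e.1 e.2)

/-- The matrix `lam θ θᵀ`. -/
def spike {n : ℕ} (lam : ℝ) (θ : Fin n → ℝ) : Fin n × Fin n → ℝ :=
  fun e => lam * (θ e.1 * θ e.2)

/-- Law `ℙ_{lam,ρ,n}` of `Y = lam θ θᵀ + W`, with `θ` and `W` independent. -/
def plantedLaw (n : ℕ) (lam ρ : ℝ) : Measure (Fin n × Fin n → ℝ) :=
  ((signalLaw n ρ).prod (noiseLaw n)).map fun z => spike lam z.1 + z.2

/-- `⟨X, T⟩ / (‖X‖ ‖T‖)` for the Frobenius inner product and norm (zero if `X` or `T` is zero). -/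
def corr {n : ℕ} (X T : Fin n × Fin n → ℝ) : ℝ :=
  (∑ e, X e * T e) / (Real.sqrt (∑ e, X e ^ 2) * Real.sqrt (∑ e, T e ^ 2))

/-- Expected correlation of the estimator `p` with `lam θ θᵀ`, over the signal, the noise and the
internal randomness of `p`. -/
def expectedCorr (p : RProgram) (n : ℕ) (lam ρ : ℝ) : ℝ :=
  ∫ z, corr (p.estimate z.2 (spike lam z.1.1 + z.1.2)) (spike lam z.1.1)
    ∂(((signalLaw n ρ).prod (noiseLaw n)).prod tapeLaw)

/-- The algorithm `A` (one program for each `n`) achieves weak recovery. -/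
def WeakRecovery (A : ℕ → RProgram) (lam ρ : ℕ → ℝ) : Prop :=
  ∃ c : ℝ, 0 < c ∧ ∀ᶠ n in atTop, c ≤ expectedCorr (A n) n (lam n) (ρ n)

/-- The parameter regime, along a sequence of dimensions `n k → ∞`:
`(log n)² / √n ≪ ρ ≪ 1 / log n` and `lam² ρ² n ≪ (log n)⁻²`. -/
structure HardRegime (n : ℕ → ℕ) (lam ρ : ℕ → ℝ) : Prop where
  dim : Tendsto n atTop atTop
  lam_pos : ∀ᶠ k in atTop, 0 < lam k
  rho_mem : ∀ᶠ k in atTop, 0 < ρ k ∧ ρ k < 1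
  rho_lower : (fun k => Real.log (n k) ^ 2 / Real.sqrt (n k)) =o[atTop] ρ
  rho_upper : ρ =o[atTop] fun k => 1 / Real.log (n k)
  snr : (fun k => lam k ^ 2 * ρ k ^ 2 * (n k : ℝ)) =o[atTop] fun k => 1 / Real.log (n k) ^ 2

/-! ### Low-degree advantage, detection and the low-degree heuristic -/

/-- `Adv_{≤ D}(P; Q)`: the supremum of `E_P[f] / √(E_Q[f²])` over polynomials `f` of degree at
most `D`. -/
def lowDegAdv {d : ℕ} (D : ℕ) (P Q : Measure (Fin d → ℝ)) : ℝ≥0∞ :=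
  ⨆ (f : MvPolynomial (Fin d) ℝ) (_ : f.totalDegree ≤ D),
    ENNReal.ofReal (∫ x, MvPolynomial.eval x f ∂P) /
      ENNReal.ofReal (Real.sqrt (∫ x, MvPolynomial.eval x f ^ 2 ∂Q))

/-- The sum of the type-I and type-II errors `Q(p = 1) + P(p = 0)`. -/
def testError {d : ℕ} (p : RProgram) (P Q : Measure (Fin d → ℝ)) : ℝ :=
  (Q.prod tapeLaw).real {z | p.Accepts z.2 z.1} + (P.prod tapeLaw).real {z | ¬ p.Accepts z.2 z.1}

/-- Weak detection: the sum of the errors is at most `1 - ε` for some fixed `ε > 0`. -/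
def WeakDetection {d : ℕ → ℕ} (A : ℕ → RProgram) (P Q : ∀ k, Measure (Fin (d k) → ℝ)) : Prop :=
  ∃ ε : ℝ, 0 < ε ∧ ∀ᶠ k in atTop, testError (A k) (P k) (Q k) ≤ 1 - ε

/-- The low-degree heuristic (for weak detection) for the sequence of testing problems `P k`
against `Q k` in dimension `d k`: if `Adv_{≤ D}(P; Q) = 1 + o(1)`, then there is a constant `C`
such that no algorithm with running time `d ^ (D / (C log d))` achieves weak detection. -/
def LowDegreeHeuristic (d : ℕ → ℕ) (P Q : ∀ k, Measure (Fin (d k) → ℝ)) : Prop :=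
  ∀ D : ℕ → ℕ, Tendsto (fun k => lowDegAdv (D k) (P k) (Q k)) atTop (𝓝 1) →
    ∃ C : ℝ, 0 < C ∧ ∀ A : ℕ → RProgram,
      (∀ᶠ k in atTop, (A k).RunsWithin (d k) ((d k : ℝ) ^ ((D k : ℝ) / (C * Real.log (d k))))) →
        ¬ WeakDetection A P Q

/-! ### The hidden informative sample problem -/

/-- `M` samples of `n * n` matrices, written as one vector. -/
def flatten {M n : ℕ} (y : Fin M → Fin n × Fin n → ℝ) : Fin (M * (n * n)) → ℝ :=
  fun a => y (finProdFinEquiv.symm a).1 (finProdFinEquiv.symm (finProdFinEquiv.symm a).2)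

/-- Null law: `M` independent samples from `Q`. -/
def hiddenNull {n : ℕ} (M : ℕ) (Q : Measure (Fin n × Fin n → ℝ)) :
    Measure (Fin (M * (n * n)) → ℝ) :=
  (Measure.pi fun _ : Fin M => Q).map flatten

/-- Planted law: a uniformly random one of the `M` independent samples is drawn from `P`, the
others from `Q`. -/
def hiddenPlanted {n : ℕ} (M : ℕ) (P Q : Measure (Fin n × Fin n → ℝ)) :
    Measure (Fin (M * (n * n)) → ℝ) :=
  (∑ κ : Fin M, (M : ℝ≥0∞)⁻¹ • Measure.pi fun j : Fin M => if j = κ then P else Q).map flatten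

/-- The low-degree heuristic for the hidden informative sample problems built from the planted
submatrix model, for all parameter sequences in the regime considered. -/
def HiddenSampleHeuristic : Prop :=
  ∀ (n M : ℕ → ℕ) (lam ρ : ℕ → ℝ), HardRegime n lam ρ → (∀ k, 0 < M k) →
    LowDegreeHeuristic (fun k => M k * (n k * n k))
      (fun k => hiddenPlanted (M k) (plantedLaw (n k) (lam k) (ρ k)) (noiseLaw (n k)))
      (fun k => hiddenNull (M k) (noiseLaw (n k)))

end

/-! Weak recovery at signal strength `lam` is turned into weak detection for a hidden-sample problem
at a slightly larger strength `L`, whose low-degree advantage is nevertheless `1 + o(1)`. The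
heuristic then bounds the running time from below.

Cloning. Given a sample `Y` of strength `L` and fresh noise `Z` with the law of `W`, put `a = lam /
L`, `b = √(1 - a²)`. By rotation invariance of the Gaussian law, `aY + bZ` and `bY - aZ` carry the
same `θ` with independent noises and strengths `lam` and `bL` (`map_clone_plantedLaw`). Run the
estimator on the first clone to get `X`, and let the sample pass if `⟨X, second clone⟩ > τ‖X‖`.
Without signal, `X` is independent of the second clone, so a pass has probability at most
`exp(-τ²/8)` (`null_pass_le`). With signal, correlation `c` in expectation means correlation at
least `c/2` with probability at least `c/2`; then the inner product is about `bLc‖X‖ρn`, up to a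
constant, and beats `τ‖X‖` (`planted_not_pass_le`). The test accepts if some sample passes. The
union bound over `M` samples needs `τ² ≍ log M + log n`.

Low-degree bound. Projecting the likelihood ratio on Hermite polynomials (`sq_mixture_integral_le`)
gives `Adv² - 1 ≤ M⁻¹ ∑_{1 ≤ m ≤ D} (L²/2)^m E[overlap^(2m)] / m!`, where `1/M` is the chance that
two planted positions agree. The overlap is binomial with mean `nρ²`, and for `D ≤ lam⁻² (log n)⁻⁴`
the sum is at most `exp(4L²(nρ²)²) + 2`. So `M ≈ n exp(4L²(nρ²)²)` samples make the advantage tend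
to one.

Balance. For this `M`, `log M ≈ 4ρ² · (Lρn)² + log n`, while the squared signal in the test is of
order `(Lρn)²`. Since `ρ → 0`, and `L` is chosen with `(Lρn)² ≥ (log n)²`, the threshold is
negligible (`testThreshold_lt`). The test costs about `M(n² + t)` steps, which is below `exp(D/C)`
as soon as `t ≤ exp(δD)` with `δ = 1/(3C)`.

The reduction must be an actual program of the machine model. It is compiled without branches; the
estimator's copies run in separate residue classes of registers, memory and tape, so that each
starts from a clean machine (`triple_simFrag`, `triple_block`). -/

/-! ### Running code fragments -/

namespace RProgram

/-- The machine with program `p` gets from `s` to `s'` in at most `T` steps. -/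
def Reaches (p : RProgram) (ω : ℕ → ℝ) (T : ℕ) (s s' : RState) : Prop :=
  ∃ t ≤ T, (p.step ω)^[t] s = s'

lemma Reaches.trans {p : RProgram} {ω : ℕ → ℝ} {T₁ T₂ : ℕ} {s₁ s₂ s₃ : RState}
    (h₁ : p.Reaches ω T₁ s₁ s₂) (h₂ : p.Reaches ω T₂ s₂ s₃) : p.Reaches ω (T₁ + T₂) s₁ s₃ := by
  obtain ⟨t₁, ht₁, e₁⟩ := h₁
  obtain ⟨t₂, ht₂, e₂⟩ := h₂
  refine ⟨t₂ + t₁, by omega, ?_⟩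
  rw [Function.iterate_add_apply, e₁, e₂]

lemma Reaches.refl (p : RProgram) (ω : ℕ → ℝ) (s : RState) : p.Reaches ω 0 s s := ⟨0, le_rfl, rfl⟩

lemma Reaches.mono {p : RProgram} {ω : ℕ → ℝ} {T₁ T₂ : ℕ} {s₁ s₂ : RState}
    (h₁ : p.Reaches ω T₁ s₁ s₂) (h : T₁ ≤ T₂) : p.Reaches ω T₂ s₁ s₂ := by
  obtain ⟨t₁, ht₁, e₁⟩ := h₁
  exact ⟨t₁, ht₁.trans h, e₁⟩

lemma step_of_get {p : RProgram} {ω : ℕ → ℝ} {s : RState} {c : RInstr} (h : p[s.pc]? = some c) :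
    p.step ω s = c.exec ω s := by
  simp [step, h]

lemma Reaches.single {p : RProgram} {ω : ℕ → ℝ} {s : RState} {c : RInstr}
    (h : p[s.pc]? = some c) : p.Reaches ω 1 s (c.exec ω s) :=
  ⟨1, le_rfl, by simp [step_of_get h]⟩

end RProgram

/-- A piece of code, as a function of the line at which it is placed. -/
abbrev Fragment : Type := ℕ → RProgram

namespace Fragment

/-- Placed anywhere in a program, `c` transforms registers and memory satisfying `pre` into
registers and memory satisfying `post`, within `T` steps, and falls through to the line after
its end. -/
def Triple (ω : ℕ → ℝ) (c : Fragment) (T : ℕ) (pre post : (ℕ → ℕ) → (ℕ → ℝ) → Prop) : Prop :=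
  ∀ (l r : RProgram) idx mem, pre idx mem → ∃ idx' mem', post idx' mem' ∧
    (l ++ c l.length ++ r : RProgram).Reaches ω T ⟨l.length, idx, mem⟩
      ⟨l.length + (c l.length).length, idx', mem'⟩

/-- Sequential composition. -/
def seq (c₁ c₂ : Fragment) : Fragment := fun b => c₁ b ++ c₂ (b + (c₁ b).length)

/-- The fragments `c 0, …, c (m - 1)`, one after the other. -/
def rep (c : ℕ → Fragment) : ℕ → Fragment
  | 0 => fun _ => []
  | m + 1 => seq (rep c m) (c m)

variable {ω : ℕ → ℝ}

lemma Triple.seq {c₁ c₂ : Fragment} {T₁ T₂ : ℕ} {P Q R : (ℕ → ℕ) → (ℕ → ℝ) → Prop}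
    (h₁ : Triple ω c₁ T₁ P Q) (h₂ : Triple ω c₂ T₂ Q R) :
    Triple ω (seq c₁ c₂) (T₁ + T₂) P R := by
  intro l r idx mem hP
  obtain ⟨idx₁, mem₁, hQ, e₁⟩ := h₁ l (c₂ (l.length + (c₁ l.length).length) ++ r) idx mem hP
  obtain ⟨idx₂, mem₂, hR, e₂⟩ := h₂ (l ++ c₁ l.length) r idx₁ mem₁ hQ
  refine ⟨idx₂, mem₂, hR, ?_⟩
  simp only [Fragment.seq, List.length_append, List.append_assoc, ← Nat.add_assoc] at *
  exact e₁.trans e₂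

lemma Triple.rep {c : ℕ → Fragment} {T : ℕ} (I : ℕ → (ℕ → ℕ) → (ℕ → ℝ) → Prop) (m : ℕ)
    (h : ∀ j < m, Triple ω (c j) T (I j) (I (j + 1))) :
    Triple ω (rep c m) (m * T) (I 0) (I m) := by
  induction m with
  | zero =>
    intro l r idx mem hP
    exact ⟨idx, mem, hP, by simpa [Fragment.rep] using RProgram.Reaches.refl _ _ _⟩
  | succ m ih =>
    rw [Nat.succ_mul]
    exact (ih fun j hj => h j (by omega)).seq (h m (by omega))

lemma length_rep_le {c : ℕ → Fragment} {L : ℕ} {m : ℕ} (h : ∀ j b, (c j b).length ≤ L) (b : ℕ) :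
    (rep c m b).length ≤ m * L := by
  induction m with
  | zero => simp [rep]
  | succ m ih =>
    simp only [rep, seq, List.length_append, Nat.succ_mul]
    exact Nat.add_le_add ih (h _ _)

end Fragment

/-! ### Straight-line code with absolute addresses -/

/-- Operations on memory cells given by absolute addresses. -/
inductive MemOp : Type
  | const (x : ℕ) (c : ℝ)
  | add (x y z : ℕ)
  | sub (x y z : ℕ)
  | mul (x y z : ℕ)
  | sqrt (x y : ℕ)
  | gauss (x q : ℕ)

namespace MemOp

/-- The effect on the memory. -/
noncomputable def eval (ω : ℕ → ℝ) (m : ℕ → ℝ) : MemOp → ℕ → ℝ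
  | const x c => Function.update m x c
  | add x y z => Function.update m x (m y + m z)
  | sub x y z => Function.update m x (m y - m z)
  | mul x y z => Function.update m x (m y * m z)
  | sqrt x y => Function.update m x (Real.sqrt (m y))
  | gauss x q => Function.update m x (ω q)

/-- Implementation with the index registers `0`, `1` and `2`. -/
def code : MemOp → RProgram
  | const x c => [.idxConst 0 x, .const 0 c]
  | add x y z => [.idxConst 0 x, .idxConst 1 y, .idxConst 2 z, .add 0 1 2]
  | sub x y z => [.idxConst 0 x, .idxConst 1 y, .idxConst 2 z, .sub 0 1 2]
  | mul x y z => [.idxConst 0 x, .idxConst 1 y, .idxConst 2 z, .mul 0 1 2]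
  | sqrt x y => [.idxConst 0 x, .idxConst 1 y, .sqrt 0 1]
  | gauss x q => [.idxConst 0 x, .idxConst 1 q, .gauss 0 1]

/-- A list of operations, as a code fragment. -/
def frag (L : List MemOp) : Fragment := fun _ => L.flatMap code

lemma length_code_le (o : MemOp) : o.code.length ≤ 4 := by cases o <;> simp [code]

lemma length_frag_le (L : List MemOp) (b : ℕ) : (frag L b).length ≤ 4 * L.length := by
  induction L with
  | nil => simp [frag]
  | cons o L ih =>
    simp only [frag, List.flatMap_cons, List.length_append, List.length_cons] at *
    have := o.length_code_le
    omega

lemma reaches_code (ω : ℕ → ℝ) (o : MemOp) (l r : RProgram) (idx : ℕ → ℕ) (mem : ℕ → ℝ) :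
    ∃ idx', (∀ i, 3 ≤ i → idx' i = idx i) ∧
      (l ++ o.code ++ r : RProgram).Reaches ω 4 ⟨l.length, idx, mem⟩
        ⟨l.length + o.code.length, idx', o.eval ω mem⟩ := by
  have hget : ∀ u < o.code.length, (l ++ o.code ++ r : RProgram)[l.length + u]? = o.code[u]? := by
    intro u hu
    rw [List.append_assoc, List.getElem?_append_right (by omega),
      List.getElem?_append_left (by omega), Nat.add_sub_cancel_left]
  generalize (l ++ o.code ++ r : RProgram) = P at hget
  cases o with
  | const x c =>
    refine ⟨Function.update idx 0 x, fun i hi => by simp only [Function.update_apply]; split_ifs <;> omega,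
      2, by simp, ?_⟩
    have g0 := hget 0 (by simp [code])
    have g1 := hget 1 (by simp [code])
    simp only [code, Nat.add_zero, List.getElem?_cons_zero, List.getElem?_cons_succ] at g0 g1
    simp [Function.iterate_succ, RProgram.step, g0, g1, RInstr.exec, code, eval]
  | add x y z | sub x y z | mul x y z =>
    refine ⟨Function.update (Function.update (Function.update idx 0 x) 1 y) 2 z,
      fun i hi => by simp only [Function.update_apply]; split_ifs <;> omega, 4, by simp, ?_⟩
    have g0 := hget 0 (by simp [code])
    have g1 := hget 1 (by simp [code])
    have g2 := hget (1 + 1) (by simp [code])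
    have g3 := hget (1 + 1 + 1) (by simp [code])
    simp only [code, Nat.add_zero, List.getElem?_cons_zero, List.getElem?_cons_succ,
      ← Nat.add_assoc] at g0 g1 g2 g3
    simp [Function.iterate_succ, RProgram.step, g0, g1, g2, g3, RInstr.exec, code, eval]
  | sqrt x y | gauss x y =>
    refine ⟨Function.update (Function.update idx 0 x) 1 y,
      fun i hi => by simp only [Function.update_apply]; split_ifs <;> omega, 3, by simp, ?_⟩
    have g0 := hget 0 (by simp [code])
    have g1 := hget 1 (by simp [code])
    have g2 := hget (1 + 1) (by simp [code])
    simp only [code, Nat.add_zero, List.getElem?_cons_zero, List.getElem?_cons_succ,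
      ← Nat.add_assoc] at g0 g1 g2
    simp [Function.iterate_succ, RProgram.step, g0, g1, g2, RInstr.exec, code, eval]

/-- The effect of a list of operations. -/
noncomputable def run (ω : ℕ → ℝ) (L : List MemOp) (m : ℕ → ℝ) : ℕ → ℝ := L.foldl (eval ω) m

lemma run_append (ω : ℕ → ℝ) (L L' : List MemOp) (m : ℕ → ℝ) :
    run ω (L ++ L') m = run ω L' (run ω L m) := by simp [run]

/-- Registers from `3` on survive straight-line code. This protects the registers reserved for the
simulated copies, all numbered `4` or more. -/
lemma reaches_frag (ω : ℕ → ℝ) (L : List MemOp) (l r : RProgram) (idx : ℕ → ℕ) (mem : ℕ → ℝ) :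
    ∃ idx', (∀ i, 3 ≤ i → idx' i = idx i) ∧
      (l ++ frag L l.length ++ r : RProgram).Reaches ω (4 * L.length) ⟨l.length, idx, mem⟩
        ⟨l.length + (frag L l.length).length, idx', run ω L mem⟩ := by
  induction L generalizing l idx mem with
  | nil => exact ⟨idx, fun _ _ => rfl, by simpa [frag, run] using RProgram.Reaches.refl _ _ _⟩
  | cons o L ih =>
    obtain ⟨idx₁, h₁, e₁⟩ := reaches_code ω o l (frag L (l ++ o.code).length ++ r) idx mem
    obtain ⟨idx₂, h₂, e₂⟩ := ih (l ++ o.code) idx₁ (o.eval ω mem)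
    refine ⟨idx₂, fun i hi => (h₂ i hi).trans (h₁ i hi), ?_⟩
    simp only [frag, run, List.length_append, List.append_assoc, ← Nat.add_assoc,
      List.flatMap_cons, List.foldl_cons, List.length_cons] at *
    exact (e₁.trans e₂).mono (by omega)

lemma triple_frag (ω : ℕ → ℝ) (L : List MemOp) {P Q : (ℕ → ℕ) → (ℕ → ℝ) → Prop}
    (h : ∀ idx idx' mem, P idx mem → (∀ i, 3 ≤ i → idx' i = idx i) → Q idx' (run ω L mem)) :
    (frag L).Triple ω (4 * L.length) P Q := by
  intro l r idx mem hP
  obtain ⟨idx', h', e⟩ := reaches_frag ω L l r idx mem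
  exact ⟨idx', _, h _ _ _ hP h', e⟩

end MemOp

/-! ### Simulation of a program in a residue class of the memory -/

namespace RInstr

/-- The index registers used as addresses. -/
def args : RInstr → ℕ × ℕ × ℕ
  | .const i _ => (i, i, i)
  | .copy i j => (i, j, j)
  | .add i j k => (i, j, k)
  | .sub i j k => (i, j, k)
  | .mul i j k => (i, j, k)
  | .div i j k => (i, j, k)
  | .sqrt i j => (i, j, j)
  | .gauss i j => (i, j, j)
  | .jumpLe i j _ => (i, j, j)
  | _ => (0, 0, 0)

/-- The instruction with its addresses taken from the index registers `0`, `1`, `2`, with the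
index registers `i` renamed to `N * i + s`, index values multiplied by `N`, and line numbers
changed by `f`. -/
def core (N s : ℕ) (f : ℕ → ℕ) : RInstr → RInstr
  | .idxConst i k => .idxConst (N * i + s) (N * k)
  | .idxAdd i j k => .idxAdd (N * i + s) (N * j + s) (N * k + s)
  | .idxSub i j k => .idxSub (N * i + s) (N * j + s) (N * k + s)
  | .idxJumpLe i j l => .idxJumpLe (N * i + s) (N * j + s) (f l)
  | .const _ c => .const 0 c
  | .copy _ _ => .copy 0 1
  | .add _ _ _ => .add 0 1 2
  | .sub _ _ _ => .sub 0 1 2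
  | .mul _ _ _ => .mul 0 1 2
  | .div _ _ _ => .div 0 1 2
  | .sqrt _ _ => .sqrt 0 1
  | .gauss _ _ => .gauss 0 1
  | .jumpLe _ _ l => .jumpLe 0 1 (f l)

/-- Four instructions which simulate one; register `3` holds the offset of the memory. -/
def simCode (N s : ℕ) (f : ℕ → ℕ) (c : RInstr) : RProgram :=
  [.idxAdd 0 (N * c.args.1 + s) 3, .idxAdd 1 (N * c.args.2.1 + s) 3,
    .idxAdd 2 (N * c.args.2.2 + s) 3, c.core N s f]

lemma length_simCode (N s : ℕ) (f : ℕ → ℕ) (c : RInstr) : (c.simCode N s f).length = 4 := rfl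

end RInstr

lemma List.getElem?_flatMap_const {α β : Type*} (f : α → List β) {q : ℕ}
    (hf : ∀ a, (f a).length = q) (L : List α) (m u : ℕ) (hu : u < q) :
    (L.flatMap f)[q * m + u]? = L[m]?.bind fun a => (f a)[u]? := by
  induction L generalizing m with
  | nil => simp
  | cons a L ih =>
    rw [List.flatMap_cons]
    cases m with
    | zero => rw [List.getElem?_append_left (by rw [hf]; omega)]; simp
    | succ m =>
      rw [List.getElem?_append_right (by rw [hf, Nat.mul_succ]; omega), hf]
      have : q * (m + 1) + u - q = q * m + u := by rw [Nat.mul_succ]; omega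
      rw [this, ih]; simp

namespace RProgram

/-- The program `A`, acting on the residue class of `off` modulo `N` of memory and tape. -/
def simFrag (A : RProgram) (N s : ℕ) : Fragment :=
  fun b => A.flatMap (RInstr.simCode N s fun l => b + 4 * min l A.length)

lemma length_simFrag (A : RProgram) (N s b : ℕ) : (A.simFrag N s b).length = 4 * A.length := by
  simp [simFrag, List.length_flatMap, RInstr.length_simCode, mul_comm]

/-- The state `σ` represents the state `s` of the simulated program; `idx₀` and `mem₀` are the
registers and the memory outside the part reserved for the simulation. -/
structure Simulates (N r off b len : ℕ) (idx₀ : ℕ → ℕ) (mem₀ : ℕ → ℝ) (s σ : RState) : Prop where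
  pc : σ.pc = b + 4 * min s.pc len
  offset : σ.idx 3 = off
  idx : ∀ i, σ.idx (N * i + r) = N * s.idx i
  mem : ∀ v, σ.mem (N * v + off) = s.mem v
  idx_frame : ∀ i, 4 ≤ i → (∀ v, i ≠ N * v + r) → σ.idx i = idx₀ i
  mem_frame : ∀ x, (∀ v, x ≠ N * v + off) → σ.mem x = mem₀ x

/-- Index values are stored multiplied by `N`. Multiplication by `N > 0` is injective, preserves
order and commutes with addition and truncated subtraction, so index arithmetic and index jumps
carry over literally. Adding the offset in register `3` turns a scaled value into the cell `N * v +
off`, and distinct `v` never collide. The registers of the copy start at `4` or later, hence never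
clash with the scratch registers. -/
lemma Simulates.step {A l post : RProgram} {ω : ℕ → ℝ} {N r off : ℕ} {idx₀ : ℕ → ℕ}
    {mem₀ : ℕ → ℝ} {s σ : RState} (hN : 0 < N) (hr : 4 ≤ r)
    (h : Simulates N r off l.length A.length idx₀ mem₀ s σ) (hs : s.pc < A.length) :
    Simulates N r off l.length A.length idx₀ mem₀ (A.step (fun v => ω (N * v + off)) s)
      (((l ++ A.simFrag N r l.length ++ post : RProgram).step ω)^[4] σ) := by
  obtain ⟨c, hc⟩ : ∃ c, A[s.pc]? = some c := ⟨A[s.pc], by simp [hs]⟩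
  have hget : ∀ u < 4, (l ++ A.simFrag N r l.length ++ post : RProgram)[σ.pc + u]? =
      (c.simCode N r fun k => l.length + 4 * min k A.length)[u]? := by
    intro u hu
    have hpc : σ.pc = l.length + 4 * s.pc := by rw [h.pc, min_eq_left hs.le]
    rw [hpc, List.append_assoc, List.getElem?_append_right (by omega),
      List.getElem?_append_left (by rw [length_simFrag]; omega)]
    have : l.length + 4 * s.pc + u - l.length = 4 * s.pc + u := by omega
    rw [this, simFrag, List.getElem?_flatMap_const _ (fun a => RInstr.length_simCode _ _ _ a) _ _ _ hu,
      hc]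
    rfl
  generalize (l ++ A.simFrag N r l.length ++ post : RProgram) = P at hget
  have hp1 : min (s.pc + 1) A.length = s.pc + 1 := min_eq_left hs
  have hp0 : min s.pc A.length = s.pc := min_eq_left hs.le
  have hinj : ∀ i j, N * i + r = N * j + r ↔ i = j := fun i j => by
    rw [Nat.add_right_cancel_iff]; exact Nat.mul_right_inj hN.ne'
  have hinj' : ∀ i j, N * i + off = N * j + off ↔ i = j := fun i j => by
    rw [Nat.add_right_cancel_iff]; exact Nat.mul_right_inj hN.ne'
  have hle : ∀ i j, N * i ≤ N * j ↔ i ≤ j := fun i j => Nat.mul_le_mul_left_iff hN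
  have hr0 : r ≠ 0 := by omega
  have hn1 : ∀ i, N * i + r ≠ 1 := fun i => by omega
  have hn2 : ∀ i, N * i + r ≠ 2 := fun i => by omega
  have hn3 : ∀ i, (3 : ℕ) ≠ N * i + r := fun i => by omega
  obtain ⟨hpc, hoff, hidx, hmem, hif, hmf⟩ := h
  obtain ⟨σpc, σidx, σmem⟩ := σ
  obtain ⟨spc, sidx, smem⟩ := s
  simp only at *
  have g0 := hget 0 (by norm_num)
  have g1 := hget 1 (by norm_num)
  have g2 := hget 2 (by norm_num)
  have g3 := hget 3 (by norm_num)
  simp only [RInstr.simCode, List.getElem?_cons_zero, List.getElem?_cons_succ, Nat.add_zero] at g0 g1 g2 g3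
  rw [step_of_get (s := ⟨spc, sidx, smem⟩) hc]
  have e : (P.step ω)^[4] ⟨σpc, σidx, σmem⟩ =
      (c.core N r fun k => l.length + 4 * min k A.length).exec ω ⟨σpc + 3,
        Function.update (Function.update (Function.update σidx 0 (N * sidx c.args.1 + off))
          1 (N * sidx c.args.2.1 + off)) 2 (N * sidx c.args.2.2 + off), σmem⟩ := by
    have s0 : P.step ω ⟨σpc, σidx, σmem⟩ =
        ⟨σpc + 1, Function.update σidx 0 (N * sidx c.args.1 + off), σmem⟩ := by
      rw [step_of_get (s := ⟨σpc, _, _⟩) g0, ← hidx, ← hoff]; rfl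
    have s1 : ∀ τ : ℕ → ℕ, P.step ω ⟨σpc + 1, τ, σmem⟩ =
        ⟨σpc + 2, Function.update τ 1 (τ (N * c.args.2.1 + r) + τ 3), σmem⟩ := fun τ => by
      rw [step_of_get (s := ⟨σpc + 1, _, _⟩) g1]; rfl
    have s2 : ∀ τ : ℕ → ℕ, P.step ω ⟨σpc + 2, τ, σmem⟩ =
        ⟨σpc + 3, Function.update τ 2 (τ (N * c.args.2.2 + r) + τ 3), σmem⟩ := fun τ => by
      rw [step_of_get (s := ⟨σpc + 2, _, _⟩) g2]; rfl
    simp only [Function.iterate_succ, Function.iterate_zero, Function.comp_apply, id]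
    rw [s0, s1, s2, step_of_get (s := ⟨σpc + 3, _, _⟩) g3]
    simp [hr0, hn1, hoff, hidx]
  rw [e]
  have hI : ∀ i, (Function.update (Function.update (Function.update σidx 0 (N * sidx c.args.1 + off))
      1 (N * sidx c.args.2.1 + off)) 2 (N * sidx c.args.2.2 + off)) (N * i + r) = N * sidx i := by
    intro i
    simp [hr0, hn1, hn2, hidx]
  have hF : ∀ i, 4 ≤ i → (∀ v, i ≠ N * v + r) →
      (Function.update (Function.update (Function.update σidx 0 (N * sidx c.args.1 + off))
      1 (N * sidx c.args.2.1 + off)) 2 (N * sidx c.args.2.2 + off)) i = idx₀ i := by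
    intro i hi hv
    rw [Function.update_of_ne (by omega), Function.update_of_ne (by omega),
      Function.update_of_ne (by omega), hif i hi hv]
  have h3 : (Function.update (Function.update (Function.update σidx 0 (N * sidx c.args.1 + off))
      1 (N * sidx c.args.2.1 + off)) 2 (N * sidx c.args.2.2 + off)) 3 = off := by
    simp [hoff]
  have h0 : (Function.update (Function.update (Function.update σidx 0 (N * sidx c.args.1 + off))
      1 (N * sidx c.args.2.1 + off)) 2 (N * sidx c.args.2.2 + off)) 0
      = N * sidx c.args.1 + off := by simp
  have h1 : (Function.update (Function.update (Function.update σidx 0 (N * sidx c.args.1 + off))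
      1 (N * sidx c.args.2.1 + off)) 2 (N * sidx c.args.2.2 + off)) 1
      = N * sidx c.args.2.1 + off := by simp
  have h2 : (Function.update (Function.update (Function.update σidx 0 (N * sidx c.args.1 + off))
      1 (N * sidx c.args.2.1 + off)) 2 (N * sidx c.args.2.2 + off)) 2
      = N * sidx c.args.2.2 + off := by simp
  generalize Function.update (Function.update (Function.update σidx 0 (N * sidx c.args.1 + off))
      1 (N * sidx c.args.2.1 + off)) 2 (N * sidx c.args.2.2 + off) = τ at hI hF h0 h1 h2 h3
  have hpc' : σpc + 3 + 1 = l.length + 4 * min (spc + 1) A.length := by rw [hpc, hp0, hp1]; ring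
  have upd_idx : ∀ i w w', w = N * w' →
      (∀ k, Function.update τ (N * i + r) w (N * k + r) = N * Function.update sidx i w' k) := by
    intro i w w' hw k
    simp only [Function.update_apply, hinj]
    split_ifs <;> simp [hI, hw]
  have upd_mem : ∀ a w k, Function.update σmem (N * a + off) w (N * k + off) =
      Function.update smem a w k := by
    intro a w k
    simp only [Function.update_apply, hinj']
    split_ifs <;> simp [hmem]
  have idx_case : ∀ i w w', w = N * w' → Simulates N r off l.length A.length idx₀ mem₀
      ⟨spc + 1, Function.update sidx i w', smem⟩
      ⟨σpc + 3 + 1, Function.update τ (N * i + r) w, σmem⟩ := by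
    intro i w w' hw
    refine ⟨hpc', ?_, upd_idx i w w' hw, hmem, ?_, hmf⟩
    · simp only; rw [Function.update_of_ne (hn3 i), h3]
    · intro k hk hv
      simp only; rw [Function.update_of_ne (hv i), hF k hk hv]
  have mem_case : ∀ a w, Simulates N r off l.length A.length idx₀ mem₀
      ⟨spc + 1, sidx, Function.update smem a w⟩
      ⟨σpc + 3 + 1, τ, Function.update σmem (N * a + off) w⟩ := by
    intro a w
    refine ⟨hpc', h3, hI, upd_mem a w, hF, ?_⟩
    intro x hx
    simp only; rw [Function.update_of_ne (hx a), hmf x hx]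
  have jump_case : ∀ (p q : Prop) [Decidable p] [Decidable q] (k : ℕ), (p ↔ q) →
      Simulates N r off l.length A.length idx₀ mem₀ ⟨if p then k else spc + 1, sidx, smem⟩
        ⟨if q then l.length + 4 * min k A.length else σpc + 3 + 1, τ, σmem⟩ := by
    intro p q _ _ k hpq
    refine ⟨?_, h3, hI, hmem, hF, hmf⟩
    by_cases hq : q
    · simp [hq, hpq.2 hq]
    · simp [hq, mt hpq.1 hq, hpc']
  cases c <;> simp only [RInstr.args] at h0 h1 h2 <;>
    simp only [RInstr.exec, RInstr.core, h0, h1, h2, hmem, hI]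
  case idxConst i k => exact idx_case i _ _ rfl
  case idxAdd i j k => exact idx_case i _ _ (by ring)
  case idxSub i j k => exact idx_case i _ _ (Nat.mul_sub _ _ _).symm
  case idxJumpLe i j k => exact jump_case _ _ k (hle _ _).symm
  case jumpLe i j k => exact jump_case _ _ k Iff.rfl
  all_goals exact mem_case _ _

lemma Simulates.iterate {A l post : RProgram} {ω : ℕ → ℝ} {N r off : ℕ} {idx₀ : ℕ → ℕ}
    {mem₀ : ℕ → ℝ} {s σ : RState} (hN : 0 < N) (hr : 4 ≤ r)
    (h : Simulates N r off l.length A.length idx₀ mem₀ s σ) (t : ℕ)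
    (hs : ∀ u < t, ((A.step (fun v => ω (N * v + off)))^[u] s).pc < A.length) :
    Simulates N r off l.length A.length idx₀ mem₀ ((A.step (fun v => ω (N * v + off)))^[t] s)
      (((l ++ A.simFrag N r l.length ++ post : RProgram).step ω)^[4 * t] σ) := by
  induction t with
  | zero => simpa using h
  | succ t ih =>
    have := (ih fun u hu => hs u (by omega)).step (post := post) (ω := ω) hN hr (hs t (by omega))
    rw [Function.iterate_succ_apply', Nat.mul_succ, Nat.add_comm, Function.iterate_add_apply]
    exact this

lemma haltsAt_sInf {A : RProgram} {ω : ℕ → ℝ} {d : ℕ} {x : Fin d → ℝ} {t : ℕ}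
    (h : A.HaltsAt ω x t) : A.HaltsAt ω x (sInf {t | A.HaltsAt ω x t}) :=
  Nat.sInf_mem (s := {t | A.HaltsAt ω x t}) ⟨t, h⟩

/-- A halting program can be run inside a larger program. -/
lemma triple_simFrag {A : RProgram} {ω : ℕ → ℝ} {N r off m T : ℕ} (hN : 0 < N) (hr : 4 ≤ r)
    (y : Fin m → ℝ) (idx₀ : ℕ → ℕ) (mem₀ : ℕ → ℝ)
    (hT : ∃ t ≤ T, A.HaltsAt (fun v => ω (N * v + off)) y t)
    (h3 : idx₀ 3 = off) (hidx : ∀ i, idx₀ (N * i + r) = 0)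
    (hmem : ∀ v, mem₀ (N * v + off) = (start y).mem v) :
    Fragment.Triple ω (A.simFrag N r) (4 * T)
      (fun idx mem => idx = idx₀ ∧ mem = mem₀)
      (fun idx mem => (∀ v, mem (N * v + off) = A.finalMem (fun v => ω (N * v + off)) y v) ∧
        (∀ i, 4 ≤ i → (∀ v, i ≠ N * v + r) → idx i = idx₀ i) ∧
        ∀ x, (∀ v, x ≠ N * v + off) → mem x = mem₀ x) := by
  intro l post idx mem hP
  rw [hP.1, hP.2]
  obtain ⟨t, htT, ht⟩ := hT
  have hstart : Simulates N r off l.length A.length idx₀ mem₀ (start y) ⟨l.length, idx₀, mem₀⟩ :=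
    ⟨by simp [start], h3, by simpa [start] using hidx, hmem, fun _ _ _ => rfl, fun _ _ => rfl⟩
  -- The first halting time is used rather than `t`: before it the program counter lies inside `A`,
  -- as `Simulates.iterate` requires, and it is the time at which `finalMem` reads the memory.
  set t₀ := sInf {t | A.HaltsAt (fun v => ω (N * v + off)) y t} with ht₀
  have hsim := hstart.iterate (post := post) (ω := ω) hN hr t₀ (by
    intro u hu
    have := Nat.notMem_of_lt_sInf hu
    simpa [HaltsAt, after] using this)
  have hle : t₀ ≤ t := Nat.sInf_le ht
  have hhalt : A.length ≤ ((A.step (fun v => ω (N * v + off)))^[t₀] (start y)).pc := haltsAt_sInf ht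
  refine ⟨_, _, ⟨hsim.mem, hsim.idx_frame, hsim.mem_frame⟩, 4 * t₀, by omega, ?_⟩
  have hpc := hsim.pc
  -- Jumps past the end of `A` are clamped to its length, so every way of halting leads to the line
  -- just after the fragment.
  rw [min_eq_right hhalt] at hpc
  rw [length_simFrag]
  generalize ((l ++ A.simFrag N r l.length ++ post : RProgram).step ω)^[4 * t₀] _ = σ at hpc
  cases σ
  simp only at hpc
  subst hpc
  rfl

lemma step_of_length_le {p : RProgram} {ω : ℕ → ℝ} {s : RState} (h : p.length ≤ s.pc) :
    p.step ω s = s := by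
  simp [step, List.getElem?_eq_none h]

/-- A halted machine stays put, so any halted configuration may replace the one at the first halting
time. -/
lemma finalMem_of_reaches {p : RProgram} {ω : ℕ → ℝ} {d : ℕ} {x : Fin d → ℝ} {t : ℕ} {s : RState}
    (h : (p.step ω)^[t] (start x) = s) (hs : p.length ≤ s.pc) : p.finalMem ω x = s.mem := by
  have ht : p.HaltsAt ω x t := by simpa [HaltsAt, after, h] using hs
  have h₀ := haltsAt_sInf ht
  have hle : sInf {t | p.HaltsAt ω x t} ≤ t := Nat.sInf_le ht
  obtain ⟨u, hu⟩ := Nat.exists_eq_add_of_le' hle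
  rw [finalMem, after, ← h, hu, Function.iterate_add_apply]
  congr 1
  exact (Function.iterate_fixed (step_of_length_le h₀) u).symm

end RProgram

/-! ### The cloning test as a program -/

/-- Parameters of the cloning test: `M` samples of length `m`, rotation coefficients `a`, `b`,
threshold `τ`, and for each entry `e` of a sample the standard deviation `sd e` of the noise and the
position `pos e` of its Gaussian on the tape. -/
structure CloneTest : Type where
  M : ℕ
  m : ℕ
  a : ℝ
  b : ℝ
  τ : ℝ
  sd : ℕ → ℝ
  pos : ℕ → ℕ

namespace CloneTest

variable (K : CloneTest)

/-- Offset of the memory and of the tape of the `j`-th copy of the simulated program. -/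
def off (j : ℕ) : ℕ := K.M * K.m + 6 + j

/-- The part of the tape used by the `j`-th copy of the simulated program. -/
def tape (ω : ℕ → ℝ) (j : ℕ) : ℕ → ℝ := fun v => ω (K.M * v + K.off j)

/-- The auxiliary noise for entry `e` of sample `j`. -/
def noise (ω : ℕ → ℝ) (j e : ℕ) : ℝ := K.sd e * ω (j * K.m + K.pos e)

/-- First clone of sample `j`. -/
def fst (ω inp : ℕ → ℝ) (j e : ℕ) : ℝ := K.a * inp (j * K.m + e) + K.b * K.noise ω j e

/-- Second clone of sample `j`. -/
def snd (ω inp : ℕ → ℝ) (j e : ℕ) : ℝ := K.b * inp (j * K.m + e) - K.a * K.noise ω j e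

/-- Output of the program `A` on the first clone of sample `j`. -/
noncomputable def out (A : RProgram) (ω inp : ℕ → ℝ) (j : ℕ) : ℕ → ℝ :=
  A.finalMem (K.tape ω j) fun e : Fin K.m => K.fst ω inp j e

/-- Positive if and only if sample `j` passes the test. -/
noncomputable def val (A : RProgram) (ω inp : ℕ → ℝ) (j : ℕ) : ℝ :=
  Real.sqrt ((∑ e ∈ Finset.range K.m, K.out A ω inp j e * K.snd ω inp j e) -
    K.τ * Real.sqrt (∑ e ∈ Finset.range K.m, K.out A ω inp j e * K.out A ω inp j e))

/-- Computation of entry `e` of the first clone. -/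
def prepOps (j e : ℕ) : List MemOp :=
  [.const (K.M * K.m + 3) (K.sd e), .gauss (K.M * K.m + 4) (j * K.m + K.pos e),
    .mul (K.M * K.m + 4) (K.M * K.m + 3) (K.M * K.m + 4),
    .const (K.M * K.m + 3) K.b, .mul (K.M * K.m + 4) (K.M * K.m + 3) (K.M * K.m + 4),
    .const (K.M * K.m + 3) K.a, .mul (K.M * K.m + 5) (K.M * K.m + 3) (j * K.m + e),
    .add (K.M * e + K.off j) (K.M * K.m + 5) (K.M * K.m + 4)]

/-- Contribution of entry `e` to the inner product and to the norm. -/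
def accOps (j e : ℕ) : List MemOp :=
  [.const (K.M * K.m + 3) (K.sd e), .gauss (K.M * K.m + 4) (j * K.m + K.pos e),
    .mul (K.M * K.m + 4) (K.M * K.m + 3) (K.M * K.m + 4),
    .const (K.M * K.m + 3) K.a, .mul (K.M * K.m + 4) (K.M * K.m + 3) (K.M * K.m + 4),
    .const (K.M * K.m + 3) K.b, .mul (K.M * K.m + 5) (K.M * K.m + 3) (j * K.m + e),
    .sub (K.M * K.m + 4) (K.M * K.m + 5) (K.M * K.m + 4),
    .mul (K.M * K.m + 4) (K.M * e + K.off j) (K.M * K.m + 4),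
    .add (K.M * K.m + 1) (K.M * K.m + 1) (K.M * K.m + 4),
    .mul (K.M * K.m + 4) (K.M * e + K.off j) (K.M * e + K.off j),
    .add (K.M * K.m + 2) (K.M * K.m + 2) (K.M * K.m + 4)]

/-- Comparison of inner product and norm. -/
def cmpOps : List MemOp :=
  [.sqrt (K.M * K.m + 2) (K.M * K.m + 2), .const (K.M * K.m + 3) K.τ,
    .mul (K.M * K.m + 2) (K.M * K.m + 3) (K.M * K.m + 2),
    .sub (K.M * K.m + 1) (K.M * K.m + 1) (K.M * K.m + 2),
    .sqrt (K.M * K.m + 1) (K.M * K.m + 1), .add (K.M * K.m) (K.M * K.m) (K.M * K.m + 1)]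

/-- The test of sample `j`. -/
def block (A : RProgram) (j : ℕ) : Fragment :=
  Fragment.seq (MemOp.frag ((List.range K.m).flatMap (K.prepOps j)))
    (Fragment.seq (fun _ => [.idxConst 3 (K.off j)])
      (Fragment.seq (A.simFrag K.M (j + 4))
        (MemOp.frag (([.const (K.M * K.m + 1) 0, .const (K.M * K.m + 2) 0] : List MemOp) ++
          (List.range K.m).flatMap (K.accOps j) ++ K.cmpOps))))

/-- The whole test. -/
def code (A : RProgram) : Fragment :=
  Fragment.seq (Fragment.rep (K.block A) K.M)
    (MemOp.frag [.const (K.M * K.m + 3) 0, .add 0 (K.M * K.m) (K.M * K.m + 3)])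

/-- The program carrying out the test. -/
def program (A : RProgram) : RProgram := K.code A 0

variable {K}

/-- Memory layout: the input fills the cells below `M * m`, cell `M * m` accumulates the result, the
next five are scratch, and from `M * m + 6` on the residue classes modulo `M` belong to the copies.
The clone is written straight into the class of copy `j`, so the input survives. -/
lemma run_prep {ω inp mem : ℕ → ℝ} {j : ℕ} (hj : j < K.M)
    (hmem : ∀ x < K.M * K.m, mem x = inp x) (k : ℕ) (hk : k ≤ K.m) :
    (∀ e < k, MemOp.run ω ((List.range k).flatMap (K.prepOps j)) mem (K.M * e + K.off j) =
      K.fst ω inp j e) ∧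
    ∀ x, x ≠ K.M * K.m + 3 → x ≠ K.M * K.m + 4 → x ≠ K.M * K.m + 5 →
      (∀ e < k, x ≠ K.M * e + K.off j) →
        MemOp.run ω ((List.range k).flatMap (K.prepOps j)) mem x = mem x := by
  induction k with
  | zero => simp [MemOp.run]
  | succ k ih =>
    obtain ⟨ih₁, ih₂⟩ := ih (by omega)
    have hin : j * K.m + k < K.M * K.m := by
      calc j * K.m + k < j * K.m + K.m := by omega
        _ = (j + 1) * K.m := by ring
        _ ≤ K.M * K.m := Nat.mul_le_mul_right _ hj
    have hinp : MemOp.run ω ((List.range k).flatMap (K.prepOps j)) mem (j * K.m + k) =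
        inp (j * K.m + k) := by
      rw [ih₂ _ (by omega) (by omega) (by omega) (by intro e _; simp only [off]; omega), hmem _ hin]
    simp only [List.range_succ, List.flatMap_append, MemOp.run_append, List.flatMap_singleton]
    generalize MemOp.run ω ((List.range k).flatMap (K.prepOps j)) mem = mem' at *
    have hoff : K.off j = K.M * K.m + 6 + j := rfl
    have key : MemOp.run ω (K.prepOps j k) mem' (K.M * k + K.off j) = K.fst ω inp j k := by
      have e1 : j * K.m + k ≠ K.M * K.m + 3 := by omega
      have e2 : j * K.m + k ≠ K.M * K.m + 4 := by omega
      simp [MemOp.run, prepOps, MemOp.eval, e1, e2, hinp, CloneTest.fst, noise]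
    have key' : ∀ x, x ≠ K.M * K.m + 3 → x ≠ K.M * K.m + 4 → x ≠ K.M * K.m + 5 →
        x ≠ K.M * k + K.off j → MemOp.run ω (K.prepOps j k) mem' x = mem' x := by
      intro x h3 h4 h5 hx
      simp [MemOp.run, prepOps, MemOp.eval, Function.update_apply, h3, h4, h5, hx]
    constructor
    · intro e he
      by_cases hek : e = k
      · rw [hek, key]
      · rw [key' _ (by omega) (by omega) (by omega), ih₁ e (by omega)]
        intro h
        exact hek (Nat.eq_of_mul_eq_mul_left (by omega) (Nat.add_right_cancel h))
    · intro x h3 h4 h5 hx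
      rw [key' x h3 h4 h5 (hx k (by omega)), ih₂ x h3 h4 h5 fun e he => hx e (by omega)]

/-- The tape can be read again at the same position, so the auxiliary noise is recomputed here
instead of being stored while the estimator runs. Only scratch cells are written. -/
lemma run_acc {ω inp mem X : ℕ → ℝ} {j : ℕ} (hj : j < K.M)
    (hmem : ∀ x < K.M * K.m, mem x = inp x) (hX : ∀ e, mem (K.M * e + K.off j) = X e)
    (k : ℕ) (hk : k ≤ K.m) :
    MemOp.run ω ((List.range k).flatMap (K.accOps j)) mem (K.M * K.m + 1) =
      mem (K.M * K.m + 1) + ∑ e ∈ Finset.range k, X e * K.snd ω inp j e ∧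
    MemOp.run ω ((List.range k).flatMap (K.accOps j)) mem (K.M * K.m + 2) =
      mem (K.M * K.m + 2) + ∑ e ∈ Finset.range k, X e * X e ∧
    ∀ x, x ≤ K.M * K.m ∨ K.M * K.m + 6 ≤ x →
      MemOp.run ω ((List.range k).flatMap (K.accOps j)) mem x = mem x := by
  induction k with
  | zero => simp [MemOp.run]
  | succ k ih =>
    obtain ⟨ih₁, ih₂, ih₃⟩ := ih (by omega)
    have hin : j * K.m + k < K.M * K.m := by
      calc j * K.m + k < j * K.m + K.m := by omega
        _ = (j + 1) * K.m := by ring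
        _ ≤ K.M * K.m := Nat.mul_le_mul_right _ hj
    have hinp := (ih₃ (j * K.m + k) (by omega)).trans (hmem _ hin)
    have hout := (ih₃ (K.M * k + K.off j) (by simp only [off]; omega)).trans (hX k)
    simp only [List.range_succ, List.flatMap_append, MemOp.run_append, List.flatMap_singleton]
    generalize MemOp.run ω ((List.range k).flatMap (K.accOps j)) mem = mem' at *
    have hoff : K.off j = K.M * K.m + 6 + j := rfl
    have e1 : j * K.m + k ≠ K.M * K.m + 3 := by omega
    have e2 : j * K.m + k ≠ K.M * K.m + 4 := by omega
    have f1 : K.M * k + K.off j ≠ K.M * K.m + 1 := by omega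
    have f3 : K.M * k + K.off j ≠ K.M * K.m + 3 := by omega
    have f4 : K.M * k + K.off j ≠ K.M * K.m + 4 := by omega
    have f5 : K.M * k + K.off j ≠ K.M * K.m + 5 := by omega
    refine ⟨?_, ?_, ?_⟩
    · simp [MemOp.run, accOps, MemOp.eval, Function.update_apply, e1, e2, f3, f4, f5, hinp, hout,
        ih₁, CloneTest.snd, noise, Finset.sum_range_succ, add_assoc]
    · simp [MemOp.run, accOps, MemOp.eval, Function.update_apply, f1, f3, f4, f5, hout,
        ih₂, Finset.sum_range_succ, add_assoc]
    · intro x hx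
      have h1 : x ≠ K.M * K.m + 1 := by omega
      have h2 : x ≠ K.M * K.m + 2 := by omega
      have h3 : x ≠ K.M * K.m + 3 := by omega
      have h4 : x ≠ K.M * K.m + 4 := by omega
      have h5 : x ≠ K.M * K.m + 5 := by omega
      simp [MemOp.run, accOps, MemOp.eval, Function.update_apply, h1, h2, h3, h4, h5, ih₃ x hx]

/-- State of the machine before the test of sample `j`. -/
structure Invariant (K : CloneTest) (A : RProgram) (ω inp : ℕ → ℝ) (j : ℕ) (idx : ℕ → ℕ)
    (mem : ℕ → ℝ) : Prop where
  idx_zero : ∀ i k, j ≤ k → k < K.M → idx (K.M * i + (k + 4)) = 0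
  input : ∀ x < K.M * K.m, mem x = inp x
  acc : mem (K.M * K.m) = ∑ k ∈ Finset.range j, K.val A ω inp k
  mem_zero : ∀ v k, j ≤ k → k < K.M → mem (K.M * v + K.off k) = 0

lemma mul_add_ne {N u v j k s : ℕ} (hj : j < N) (hk : k < N) (h : j ≠ k) :
    N * u + (s + j) ≠ N * v + (s + k) := by
  intro e
  have e' : N * u + j = N * v + k := by omega
  have := congrArg (· % N) e'
  simp only [Nat.mul_add_mod, Nat.mod_eq_of_lt hj, Nat.mod_eq_of_lt hk] at this
  exact h this

/-- Block `j` touches only its own residue classes, the scratch cells and registers, and the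
accumulator. The classes of later copies therefore remain zero, which is what lets each copy of `A`
start from its proper initial configuration. -/
lemma triple_block {A : RProgram} {ω inp : ℕ → ℝ} {T j : ℕ} (hj : j < K.M)
    (hT : ∀ (x : Fin K.m → ℝ) (ω : ℕ → ℝ), ∃ t ≤ T, A.HaltsAt ω x t) :
    (K.block A j).Triple ω (80 * K.m + 4 * T + 33) (K.Invariant A ω inp j)
      (K.Invariant A ω inp (j + 1)) := by
  have hM : 0 < K.M := by omega
  have hlen : ∀ (f : ℕ → List MemOp) (c : ℕ), (∀ e, (f e).length = c) →
      ((List.range K.m).flatMap f).length = c * K.m := by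
    intro f c hf
    simp [List.length_flatMap, hf, mul_comm]
  intro l r idx mem hI
  set mem₁ := MemOp.run ω ((List.range K.m).flatMap (K.prepOps j)) mem with hmem₁
  obtain ⟨hp₁, hp₂⟩ := run_prep (ω := ω) hj hI.input K.m le_rfl
  rw [← hmem₁] at hp₁ hp₂
  have hoff : ∀ k, K.off k = K.M * K.m + 6 + k := fun _ => rfl
  have hin₁ : ∀ x ≤ K.M * K.m, mem₁ x = mem x := fun x hx =>
    hp₂ x (by omega) (by omega) (by omega) fun e _ => by rw [hoff]; omega
  have hwork : ∀ v, mem₁ (K.M * v + K.off j) =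
      (RProgram.start fun e : Fin K.m => K.fst ω inp j e).mem v := by
    intro v
    -- Inside the input range the cell holds the first clone; beyond it the initial configuration of
    -- `A` demands zeros, which the invariant supplies.
    by_cases hv : v < K.m
    · simp [RProgram.start, hv, hp₁ v hv]
    · simp only [RProgram.start, hv, dite_false]
      rw [hp₂ _ (by rw [hoff]; omega) (by rw [hoff]; omega) (by rw [hoff]; omega),
        hI.mem_zero v j le_rfl hj]
      intro e he h
      exact hv (Nat.eq_of_mul_eq_mul_left hM (Nat.add_right_cancel h) ▸ he)
  have hnext : ∀ v k, j + 1 ≤ k → k < K.M → mem₁ (K.M * v + K.off k) = 0 := by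
    intro v k hk hkM
    rw [hp₂ _ (by rw [hoff]; omega) (by rw [hoff]; omega) (by rw [hoff]; omega),
      hI.mem_zero v k (by omega) hkM]
    intro e _
    exact mul_add_ne hkM hj (by omega)
  have t1 : Fragment.Triple ω (MemOp.frag ((List.range K.m).flatMap (K.prepOps j))) (32 * K.m)
      (fun i' m' => i' = idx ∧ m' = mem)
      (fun i' m' => (∀ i, 3 ≤ i → i' i = idx i) ∧ m' = mem₁) := by
    have := MemOp.triple_frag ω ((List.range K.m).flatMap (K.prepOps j))
      (P := fun i' m' => i' = idx ∧ m' = mem)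
      (Q := fun i' m' => (∀ i, 3 ≤ i → i' i = idx i) ∧ m' = mem₁)
      (by rintro i' i'' m' ⟨rfl, rfl⟩ h; exact ⟨h, rfl⟩)
    rw [hlen _ 8 (fun e => rfl)] at this
    convert this using 1
    ring
  have t2 : Fragment.Triple ω (fun _ => [.idxConst 3 (K.off j)]) 1
      (fun i' m' => (∀ i, 3 ≤ i → i' i = idx i) ∧ m' = mem₁)
      (fun i' m' => i' 3 = K.off j ∧ (∀ i, 4 ≤ i → i' i = idx i) ∧ m' = mem₁) := by
    rintro l r i' m' ⟨h, rfl⟩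
    refine ⟨Function.update i' 3 (K.off j), _, ⟨by simp, ?_, rfl⟩, ?_⟩
    · intro i hi
      rw [Function.update_of_ne (by omega), h i (by omega)]
    · exact RProgram.Reaches.single (c := .idxConst 3 (K.off j)) (by simp)
  have t3 : Fragment.Triple ω (A.simFrag K.M (j + 4)) (4 * T)
      (fun i' m' => i' 3 = K.off j ∧ (∀ i, 4 ≤ i → i' i = idx i) ∧ m' = mem₁)
      (fun i' m' => (∀ v, m' (K.M * v + K.off j) = K.out A ω inp j v) ∧
        (∀ i, 4 ≤ i → (∀ v, i ≠ K.M * v + (j + 4)) → i' i = idx i) ∧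
        ∀ x, (∀ v, x ≠ K.M * v + K.off j) → m' x = mem₁ x) := by
    rintro l r i' m' ⟨h3, h4, rfl⟩
    obtain ⟨i₂, m₂, ⟨q₁, q₂, q₃⟩, hq⟩ :=
      RProgram.triple_simFrag (A := A) (ω := ω) (N := K.M) (r := j + 4) (off := K.off j) hM (by omega)
      (fun e : Fin K.m => K.fst ω inp j e) i' mem₁ (hT _ _) h3
      (fun i => by rw [h4 _ (by omega), hI.idx_zero i j le_rfl hj]) hwork l r i' mem₁ ⟨rfl, rfl⟩
    exact ⟨i₂, m₂, ⟨q₁, fun i hi hv => (q₂ i hi hv).trans (h4 i hi), q₃⟩, hq⟩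
  have t4 : Fragment.Triple ω (MemOp.frag (([.const (K.M * K.m + 1) 0, .const (K.M * K.m + 2) 0] :
        List MemOp) ++ (List.range K.m).flatMap (K.accOps j) ++ K.cmpOps)) (48 * K.m + 32)
      (fun i' m' => (∀ v, m' (K.M * v + K.off j) = K.out A ω inp j v) ∧
        (∀ i, 4 ≤ i → (∀ v, i ≠ K.M * v + (j + 4)) → i' i = idx i) ∧
        ∀ x, (∀ v, x ≠ K.M * v + K.off j) → m' x = mem₁ x)
      (K.Invariant A ω inp (j + 1)) := by
    have hL : 48 * K.m + 32 = 4 * (([.const (K.M * K.m + 1) 0, .const (K.M * K.m + 2) 0] :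
        List MemOp) ++ (List.range K.m).flatMap (K.accOps j) ++ K.cmpOps).length := by
      rw [List.length_append, List.length_append, hlen _ 12 (fun e => rfl)]
      simp only [cmpOps, List.length_cons, List.length_nil]
      ring
    rw [hL]
    refine MemOp.triple_frag ω _ ?_
    rintro i' i'' m' ⟨q₁, q₂, q₃⟩ hi
    rw [MemOp.run_append, MemOp.run_append]
    set m₂ := MemOp.run ω [.const (K.M * K.m + 1) 0, .const (K.M * K.m + 2) 0] m' with hm₂
    have hm₂' : ∀ x, x ≤ K.M * K.m ∨ K.M * K.m + 6 ≤ x → m₂ x = m' x := by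
      intro x hx
      have h1 : x ≠ K.M * K.m + 1 := by omega
      have h2 : x ≠ K.M * K.m + 2 := by omega
      simp [hm₂, MemOp.run, MemOp.eval, h1, h2]
    have hlow : ∀ x ≤ K.M * K.m, m' x = mem x := fun x hx => by
      rw [q₃ x fun v => by rw [hoff]; omega, hin₁ x hx]
    obtain ⟨s₁, s₂, s₃⟩ := run_acc (ω := ω) (inp := inp) (mem := m₂) (X := K.out A ω inp j) hj
      (fun x hx => by rw [hm₂' x (by omega), hlow x hx.le, hI.input x hx])
      (fun e => by rw [hm₂' _ (by rw [hoff]; omega), q₁]) K.m le_rfl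
    have z₁ : m₂ (K.M * K.m + 1) = 0 := by simp [hm₂, MemOp.run, MemOp.eval]
    have z₂ : m₂ (K.M * K.m + 2) = 0 := by simp [hm₂, MemOp.run, MemOp.eval]
    rw [z₁, zero_add] at s₁
    rw [z₂, zero_add] at s₂
    generalize MemOp.run ω ((List.range K.m).flatMap (K.accOps j)) m₂ = m₃ at *
    have c₁ : ∀ x, x < K.M * K.m ∨ K.M * K.m + 6 ≤ x → MemOp.run ω K.cmpOps m₃ x = m' x := by
      intro x hx
      have h0 : x ≠ K.M * K.m := by omega
      have h1 : x ≠ K.M * K.m + 1 := by omega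
      have h2 : x ≠ K.M * K.m + 2 := by omega
      have h3 : x ≠ K.M * K.m + 3 := by omega
      have h4 := (s₃ x (by omega)).trans (hm₂' x (by omega))
      simp [MemOp.run, cmpOps, MemOp.eval, h0, h1, h2, h3, h4]
    have c₂ : MemOp.run ω K.cmpOps m₃ (K.M * K.m) = mem (K.M * K.m) + K.val A ω inp j := by
      have h4 := ((s₃ (K.M * K.m) (by omega)).trans (hm₂' _ (by omega))).trans (hlow _ le_rfl)
      simp [MemOp.run, cmpOps, MemOp.eval, h4, s₁, s₂, val]
    refine ⟨?_, ?_, ?_, ?_⟩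
    · intro i k hk hkM
      rw [hi _ (by omega), q₂ _ (by omega), hI.idx_zero i k (by omega) hkM]
      intro v
      have := mul_add_ne (s := 4) (u := i) (v := v) hkM hj (by omega)
      rwa [add_comm k, add_comm j]
    · intro x hx
      rw [c₁ x (by omega), hlow x hx.le, hI.input x hx]
    · rw [c₂, hI.acc, Finset.sum_range_succ]
    · intro v k hk hkM
      have hne : ∀ u, K.M * v + K.off k ≠ K.M * u + K.off j := fun u =>
        mul_add_ne hkM hj (by omega)
      rw [c₁ _ (by rw [hoff]; omega), q₃ _ hne, hnext v k hk hkM]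
  have hT' : 80 * K.m + 4 * T + 33 = 32 * K.m + (1 + (4 * T + (48 * K.m + 32))) := by ring
  rw [hT']
  exact t1.seq (t2.seq (t3.seq t4)) l r idx mem ⟨rfl, rfl⟩

lemma reaches_program {A : RProgram} {ω : ℕ → ℝ} {T : ℕ}
    (hT : ∀ (x : Fin K.m → ℝ) (ω : ℕ → ℝ), ∃ t ≤ T, A.HaltsAt ω x t) (x : Fin (K.M * K.m) → ℝ) :
    ∃ idx mem, mem 0 = ∑ j ∈ Finset.range K.M, K.val A ω (RProgram.start x).mem j ∧
      (K.program A).Reaches ω (K.M * (80 * K.m + 4 * T + 33) + 8) (RProgram.start x)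
        ⟨(K.program A).length, idx, mem⟩ := by
  have t1 := Fragment.Triple.rep (K.Invariant A ω (RProgram.start x).mem) K.M
    (fun j hj => triple_block hj hT)
  have t2 : Fragment.Triple ω (MemOp.frag [.const (K.M * K.m + 3) 0,
        .add 0 (K.M * K.m) (K.M * K.m + 3)]) 8 (K.Invariant A ω (RProgram.start x).mem K.M)
      (fun _ mem => mem 0 = ∑ j ∈ Finset.range K.M, K.val A ω (RProgram.start x).mem j) := by
    refine MemOp.triple_frag ω _ ?_
    intro idx idx' mem hI _
    simp [MemOp.run, MemOp.eval, hI.acc]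
  obtain ⟨idx, mem, h, e⟩ := t1.seq t2 [] [] (fun _ => 0) (RProgram.start x).mem
    ⟨fun _ _ _ _ => rfl, fun _ _ => rfl, by simp [RProgram.start], fun v k _ _ => by
      simp only [RProgram.start, off]; rw [dif_neg (by omega)]⟩
  refine ⟨idx, mem, h, ?_⟩
  simpa [program, code, RProgram.start] using e

lemma finalMem_program {A : RProgram} {ω : ℕ → ℝ} {T : ℕ}
    (hT : ∀ (x : Fin K.m → ℝ) (ω : ℕ → ℝ), ∃ t ≤ T, A.HaltsAt ω x t) (x : Fin (K.M * K.m) → ℝ) :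
    (K.program A).finalMem ω x 0 =
      ∑ j ∈ Finset.range K.M, K.val A ω (RProgram.start x).mem j := by
  obtain ⟨idx, mem, h, t, -, e⟩ := reaches_program (ω := ω) hT x
  rw [RProgram.finalMem_of_reaches e le_rfl]
  exact h

lemma val_nonneg (A : RProgram) (ω inp : ℕ → ℝ) (j : ℕ) : 0 ≤ K.val A ω inp j :=
  Real.sqrt_nonneg _

/-- The square root vanishes on nonpositive arguments, so each summand is nonnegative and is
positive exactly for a passing sample. The sum thus computes a disjunction without any jump. -/
lemma accepts_program_iff {A : RProgram} {ω : ℕ → ℝ} {T : ℕ}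
    (hT : ∀ (x : Fin K.m → ℝ) (ω : ℕ → ℝ), ∃ t ≤ T, A.HaltsAt ω x t) (x : Fin (K.M * K.m) → ℝ) :
    (K.program A).Accepts ω x ↔ ∃ j < K.M, 0 < K.val A ω (RProgram.start x).mem j := by
  rw [RProgram.Accepts, finalMem_program hT,
    Finset.sum_pos_iff_of_nonneg fun j _ => val_nonneg ..]
  simp

lemma length_program_le (A : RProgram) :
    (K.program A).length ≤ K.M * (80 * K.m + 4 * A.length + 33) + 8 := by
  have hlen : ∀ (f : ℕ → List MemOp) (c : ℕ), (∀ e, (f e).length = c) →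
      ((List.range K.m).flatMap f).length = c * K.m := by
    intro f c hf
    simp [List.length_flatMap, hf, mul_comm]
  have hb : ∀ j b, (K.block A j b).length ≤ 80 * K.m + 4 * A.length + 33 := by
    intro j b
    simp only [block, Fragment.seq, List.length_append, RProgram.length_simFrag]
    have h1 := MemOp.length_frag_le ((List.range K.m).flatMap (K.prepOps j)) b
    have h2 := fun b' => MemOp.length_frag_le
      (([.const (K.M * K.m + 1) 0, .const (K.M * K.m + 2) 0] : List MemOp) ++
          (List.range K.m).flatMap (K.accOps j) ++ K.cmpOps) b'
    simp only [List.length_append, hlen _ 12 (fun e => (rfl : (K.accOps j e).length = 12)),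
      hlen _ 8 (fun e => (rfl : (K.prepOps j e).length = 8)), cmpOps, List.length_cons,
      List.length_nil] at h1 h2
    have h3 := h2 (b + (MemOp.frag (List.flatMap (K.prepOps j) (List.range K.m)) b).length +
      ([RInstr.idxConst 3 (K.off j)] : RProgram).length + 4 * A.length)
    simp only [List.length_cons, List.length_nil, cmpOps] at h3 ⊢
    omega
  rw [program, code, Fragment.seq, List.length_append]
  refine Nat.add_le_add (Fragment.length_rep_le hb 0) ?_
  exact MemOp.length_frag_le _ _

/-- Running time of the test. -/
lemma runsWithin_program {A : RProgram} {t : ℝ} (hA : A.RunsWithin K.m t) :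
    (K.program A).RunsWithin (K.M * K.m) (K.M * (80 * K.m + 4 * t + 33) + 8) := by
  have ht : 0 ≤ t := (Nat.cast_nonneg _).trans hA.1
  have hT : ∀ (x : Fin K.m → ℝ) (ω : ℕ → ℝ), ∃ u ≤ ⌊t⌋₊, A.HaltsAt ω x u := by
    intro x ω
    obtain ⟨u, hu, h⟩ := hA.2 x ω
    exact ⟨u, Nat.le_floor hu, h⟩
  constructor
  · have h := length_program_le (K := K) A
    calc ((K.program A).length : ℝ) ≤ ((K.M * (80 * K.m + 4 * A.length + 33) + 8 : ℕ) : ℝ) := by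
          exact_mod_cast h
      _ = K.M * (80 * K.m + 4 * (A.length : ℝ) + 33) + 8 := by push_cast; ring
      _ ≤ _ := by gcongr; exact hA.1
  · intro x ω
    obtain ⟨idx, mem, -, u, hu, e⟩ := reaches_program (ω := ω) hT x
    refine ⟨u, ?_, ?_⟩
    · calc (u : ℝ) ≤ ((K.M * (80 * K.m + 4 * ⌊t⌋₊ + 33) + 8 : ℕ) : ℝ) := by exact_mod_cast hu
        _ = K.M * (80 * K.m + 4 * (⌊t⌋₊ : ℝ) + 33) + 8 := by push_cast; ring
        _ ≤ _ := by gcongr; exact Nat.floor_le ht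
    · rw [RProgram.HaltsAt, RProgram.after, e]

end CloneTest

/-! ### Measurability of the output of a program -/

section Measurability

variable {Ω : Type*} [MeasurableSpace Ω]

/-- A random state of the machine all of whose components are measurable. -/
structure MeasurableState (S : Ω → RState) : Prop where
  pc : Measurable fun z => (S z).pc
  idx : ∀ i, Measurable fun z => (S z).idx i
  mem : ∀ v, Measurable fun z => (S z).mem v

/-- Indirect addressing and the choice of the instruction depend on a random natural number;
countability of `ℕ` makes this harmless. -/
lemma Measurable.apply_nat {β : Type*} [MeasurableSpace β] {f : ℕ → Ω → β} {g : Ω → ℕ}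
    (hf : ∀ k, Measurable (f k)) (hg : Measurable g) : Measurable fun z => f (g z) z :=
  (measurable_from_prod_countable_right (f := fun p : ℕ × Ω => f p.1 p.2) hf).comp
    (hg.prodMk measurable_id)

lemma Measurable.update_nat {β : Type*} [MeasurableSpace β] {f : Ω → ℕ → β} {g : Ω → ℕ} {h : Ω → β}
    (hf : ∀ v, Measurable fun z => f z v) (hg : Measurable g) (hh : Measurable h) (v : ℕ) :
    Measurable fun z => Function.update (f z) (g z) (h z) v := by
  simp only [Function.update_apply]
  exact Measurable.ite (hg (measurableSet_singleton v) |> fun h => by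
    simpa [Set.preimage, eq_comm] using h) hh (hf v)

lemma MeasurableState.exec {S : Ω → RState} {ω : Ω → ℕ → ℝ} (hS : MeasurableState S)
    (hω : ∀ v, Measurable fun z => ω z v) (c : RInstr) :
    MeasurableState fun z => c.exec (ω z) (S z) := by
  have hpc : Measurable fun z => (S z).pc + 1 := hS.pc.add_const 1
  have hm : ∀ i, Measurable fun z => (S z).mem ((S z).idx i) := fun i =>
    Measurable.apply_nat (f := fun k z => (S z).mem k) hS.mem (hS.idx i)
  have hw : ∀ i, Measurable fun z => ω z ((S z).idx i) := fun i =>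
    Measurable.apply_nat (f := fun k z => ω z k) hω (hS.idx i)
  have upd_mem : ∀ (i : ℕ) {h : Ω → ℝ}, Measurable h → ∀ v, Measurable fun z =>
      Function.update (S z).mem ((S z).idx i) (h z) v := fun i h hh v =>
    Measurable.update_nat hS.mem (hS.idx i) hh v
  have upd_idx : ∀ (i : ℕ) {h : Ω → ℕ}, Measurable h → ∀ v, Measurable fun z =>
      Function.update (S z).idx i (h z) v := fun i h hh v =>
    Measurable.update_nat hS.idx measurable_const hh v
  cases c with
  | idxConst i k => exact ⟨hpc, upd_idx i measurable_const, hS.mem⟩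
  | idxAdd i j k => exact ⟨hpc, upd_idx i ((hS.idx j).add (hS.idx k)), hS.mem⟩
  | idxSub i j k => exact ⟨hpc, upd_idx i ((hS.idx j).sub (hS.idx k)), hS.mem⟩
  | idxJumpLe i j l =>
    exact ⟨Measurable.ite (measurableSet_le (hS.idx i) (hS.idx j)) measurable_const hpc,
      hS.idx, hS.mem⟩
  | const i c => exact ⟨hpc, hS.idx, upd_mem i measurable_const⟩
  | copy i j => exact ⟨hpc, hS.idx, upd_mem i (hm j)⟩
  | add i j k => exact ⟨hpc, hS.idx, upd_mem i ((hm j).add (hm k))⟩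
  | sub i j k => exact ⟨hpc, hS.idx, upd_mem i ((hm j).sub (hm k))⟩
  | mul i j k => exact ⟨hpc, hS.idx, upd_mem i ((hm j).mul (hm k))⟩
  | div i j k => exact ⟨hpc, hS.idx, upd_mem i ((hm j).div (hm k))⟩
  | sqrt i j => exact ⟨hpc, hS.idx, upd_mem i (hm j).sqrt⟩
  | gauss i j => exact ⟨hpc, hS.idx, upd_mem i (hw j)⟩
  | jumpLe i j l =>
    exact ⟨Measurable.ite (measurableSet_le (hm i) (hm j)) measurable_const hpc, hS.idx, hS.mem⟩

lemma MeasurableState.step {S : Ω → RState} {ω : Ω → ℕ → ℝ} (hS : MeasurableState S)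
    (hω : ∀ v, Measurable fun z => ω z v) (p : RProgram) :
    MeasurableState fun z => p.step (ω z) (S z) := by
  have h : ∀ k : ℕ, MeasurableState fun z =>
      match (p[k]? : Option RInstr) with
      | some c => c.exec (ω z) (S z)
      | none => S z := by
    intro k
    cases (p[k]? : Option RInstr) with
    | none => exact hS
    | some c => exact hS.exec hω c
  exact ⟨Measurable.apply_nat (fun k => (h k).pc) hS.pc,
    fun i => Measurable.apply_nat (fun k => (h k).idx i) hS.pc,
    fun v => Measurable.apply_nat (fun k => (h k).mem v) hS.pc⟩

lemma measurableState_after {d : ℕ} {ω : Ω → ℕ → ℝ} {x : Ω → Fin d → ℝ}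
    (hω : ∀ v, Measurable fun z => ω z v) (hx : ∀ i, Measurable fun z => x z i) (p : RProgram)
    (t : ℕ) : MeasurableState fun z => p.after (ω z) (x z) t := by
  induction t with
  | zero =>
    refine ⟨measurable_const, fun _ => measurable_const, fun v => ?_⟩
    simp only [RProgram.after, RProgram.start, Function.iterate_zero, id]
    by_cases h : v < d
    · simpa [h] using hx _
    · simp [h]
  | succ t ih =>
    simp only [RProgram.after, Function.iterate_succ_apply'] at *
    exact ih.step hω p

lemma measurable_finalMem {d : ℕ} {ω : Ω → ℕ → ℝ} {x : Ω → Fin d → ℝ} {p : RProgram} {b : ℝ}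
    (hω : ∀ v, Measurable fun z => ω z v) (hx : ∀ i, Measurable fun z => x z i)
    (hp : p.RunsWithin d b) (v : ℕ) : Measurable fun z => p.finalMem (ω z) (x z) v := by
  -- The halting time depends on the input; since the halted machine stays put, it may be replaced
  -- by the fixed time `⌊b⌋₊`.
  have h : ∀ z, p.finalMem (ω z) (x z) = (p.after (ω z) (x z) ⌊b⌋₊).mem := by
    intro z
    obtain ⟨t, ht, hh⟩ := hp.2 (x z) (ω z)
    obtain ⟨u, hu⟩ := Nat.exists_eq_add_of_le' (Nat.le_floor ht)
    refine RProgram.finalMem_of_reaches rfl ?_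
    rw [RProgram.HaltsAt, RProgram.after] at hh
    rw [RProgram.after, hu, Function.iterate_add_apply,
      Function.iterate_fixed (RProgram.step_of_length_le hh) u]
    exact hh
  simp only [h]
  exact (measurableState_after hω hx p _).mem v

end Measurability

/-! ### The noise and the random tape -/

instance isProbabilityMeasure_tapeLaw : IsProbabilityMeasure tapeLaw := by
  unfold tapeLaw; infer_instance

lemma measurable_symmetrize (n : ℕ) : Measurable fun (g : Fin n × Fin n → ℝ) (e : Fin n × Fin n) =>
    g (min e.1 e.2, max e.1 e.2) :=
  measurable_pi_lambda _ fun _ => measurable_pi_apply _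

instance isProbabilityMeasure_noiseLaw (n : ℕ) : IsProbabilityMeasure (noiseLaw n) :=
  Measure.isProbabilityMeasure_map (measurable_symmetrize n).aemeasurable

/-- The law of independent centred Gaussians is Gaussian. -/
instance isGaussian_pi_gaussianReal {ι : Type*} [Fintype ι] (m : ι → ℝ) (v : ι → NNReal) :
    IsGaussian (Measure.pi fun i => gaussianReal (m i) (v i)) := by
  have h : iIndepFun (fun i (ω : ι → ℝ) => ω i) (Measure.pi fun i => gaussianReal (m i) (v i)) :=
    iIndepFun_pi (X := fun i x => x) fun i => aemeasurable_id
  have h' : ∀ i, HasGaussianLaw (fun ω : ι → ℝ => ω i)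
      (Measure.pi fun i => gaussianReal (m i) (v i)) := by
    intro i
    refine ⟨?_⟩
    rw [(measurePreserving_eval (fun i => gaussianReal (m i) (v i)) i).map_eq]
    infer_instance
  have := (h.hasGaussianLaw h').isGaussian_map
  simpa using this

/-- Symmetrization as a continuous linear map. -/
noncomputable def symmetrizeCLM (n : ℕ) : (Fin n × Fin n → ℝ) →L[ℝ] (Fin n × Fin n → ℝ) :=
  ContinuousLinearMap.pi fun e => ContinuousLinearMap.proj (min e.1 e.2, max e.1 e.2)

instance isGaussian_noiseLaw (n : ℕ) : IsGaussian (noiseLaw n) :=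
  isGaussian_map (μ := Measure.pi fun e : Fin n × Fin n =>
    gaussianReal 0 (if e.1 = e.2 then 2 else 1)) (symmetrizeCLM n)

lemma integral_dual_pi_gaussianReal {ι : Type*} [Fintype ι] (v : ι → NNReal)
    (L : StrongDual ℝ (ι → ℝ)) : ∫ x, L x ∂(Measure.pi fun i => gaussianReal 0 (v i)) = 0 := by
  classical
  have hL : ∀ x, L x = ∑ i, x i * L (Pi.single i 1) := by
    intro x
    conv_lhs => rw [← Finset.univ_sum_single x, map_sum]
    refine Finset.sum_congr rfl fun i _ => ?_
    have : Pi.single i (x i) = x i • (Pi.single i 1 : ι → ℝ) := by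
      rw [← Pi.single_smul]; simp
    rw [this, map_smul, smul_eq_mul]
  have hi : ∀ i, Integrable (fun x : ι → ℝ => x i) (Measure.pi fun i => gaussianReal 0 (v i)) :=
    fun i => (measurePreserving_eval (fun i => gaussianReal 0 (v i)) i).integrable_comp_of_integrable
      (g := fun x => x) ((memLp_id_gaussianReal' 1 (by simp)).integrable le_rfl)
  rw [integral_congr_ae (ae_of_all _ hL), integral_finsetSum _ fun i _ => (hi i).mul_const _]
  refine Finset.sum_eq_zero fun i _ => ?_
  rw [integral_mul_const]
  have : ∫ x : ι → ℝ, x i ∂(Measure.pi fun i => gaussianReal 0 (v i)) = 0 := by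
    rw [integral_comp_eval (μ := fun i => gaussianReal 0 (v i)) (f := fun x => x)
      aestronglyMeasurable_id, integral_id_gaussianReal]
  rw [this, zero_mul]

lemma integral_dual_noiseLaw (n : ℕ) (L : StrongDual ℝ (Fin n × Fin n → ℝ)) :
    ∫ x, L x ∂(noiseLaw n) = 0 := by
  rw [noiseLaw, integral_map (measurable_symmetrize n).aemeasurable
    L.continuous.aestronglyMeasurable]
  exact integral_dual_pi_gaussianReal _ (L.comp (symmetrizeCLM n))

/-- Two independent copies of the noise may be rotated. -/
lemma map_rotation_noiseLaw (n : ℕ) {a : ℝ} (h₀ : 0 ≤ a) (h₁ : a ≤ 1) :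
    ((noiseLaw n).prod (noiseLaw n)).map
      (fun p => (a • p.1 + √(1 - a ^ 2) • p.2, √(1 - a ^ 2) • p.1 - a • p.2)) =
      (noiseLaw n).prod (noiseLaw n) := by
  -- The angle `arcsin a` has sine `a` and cosine `√(1 - a ^ 2)`. Exchanging the two copies before
  -- rotating gives the stated signs.
  have h := IsGaussian.map_rotation_eq_self_of_forall_strongDual_eq_zero (μ := noiseLaw n)
    (integral_dual_noiseLaw n) (Real.arcsin a)
  conv_rhs => rw [← h, ← Measure.prod_swap, Measure.map_map
    (ContinuousLinearMap.continuous _).measurable measurable_swap]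
  congr 1
  ext p : 1
  simp only [Function.comp_apply, ContinuousLinearMap.rotation_apply, Real.cos_arcsin,
    Real.sin_arcsin (by linarith) h₁, Prod.fst_swap, Prod.snd_swap]
  ext1
  · simp [add_comm]
  · simp only; rw [neg_smul]; abel

/-- Splitting a product measure over a disjoint union. -/
lemma infinitePi_map_sum {α β E : Type*} [MeasurableSpace E] (μ : Measure E)
    [IsProbabilityMeasure μ] :
    (Measure.infinitePi fun _ : α ⊕ β => μ).map
      (fun ω => ((fun i => ω (Sum.inl i)), (fun i => ω (Sum.inr i)))) =
      (Measure.infinitePi fun _ : α => μ).prod (Measure.infinitePi fun _ : β => μ) := by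
  have hm : Measurable fun p : (α → E) × (β → E) => (fun i : α ⊕ β => Sum.elim p.1 p.2 i) := by
    refine measurable_pi_lambda _ fun i => ?_
    cases i with
    | inl i => exact (measurable_pi_apply i).comp measurable_fst
    | inr i => exact (measurable_pi_apply i).comp measurable_snd
  have key : ((Measure.infinitePi fun _ : α => μ).prod (Measure.infinitePi fun _ : β => μ)).map
      (fun p => (fun i : α ⊕ β => Sum.elim p.1 p.2 i)) = Measure.infinitePi fun _ : α ⊕ β => μ := by
    refine Measure.eq_infinitePi _ fun s t ht => ?_
    rw [Measure.map_apply hm (MeasurableSet.pi s.countable_toSet fun i _ => ht i)]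
    have : (fun p : (α → E) × (β → E) => (fun i : α ⊕ β => Sum.elim p.1 p.2 i)) ⁻¹'
        ((s : Set (α ⊕ β)).pi t) =
        ((s.toLeft : Set α).pi fun i => t (Sum.inl i)) ×ˢ
          ((s.toRight : Set β).pi fun i => t (Sum.inr i)) := by
      ext p
      simp [Set.mem_pi]
    rw [this, Measure.prod_prod, Measure.infinitePi_pi _ fun i _ => ht _,
      Measure.infinitePi_pi _ fun i _ => ht _]
    conv_rhs => rw [← Finset.toLeft_disjSum_toRight (u := s)]
    rw [Finset.prod_disjSum]
  rw [← key, Measure.map_map _ hm]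
  · exact Measure.map_id
  · exact (measurable_pi_lambda _ fun i => measurable_pi_apply _).prodMk
      (measurable_pi_lambda _ fun i => measurable_pi_apply _)

/-- The noise matrix made from standard Gaussians. -/
lemma map_scale_pi_gaussianReal (n : ℕ) :
    (Measure.pi fun _ : Fin n × Fin n => gaussianReal 0 1).map
      (fun g e => (if e.1 = e.2 then √2 else 1) * g (min e.1 e.2, max e.1 e.2)) = noiseLaw n := by
  have h : (Measure.pi fun _ : Fin n × Fin n => gaussianReal 0 1).map
      (fun g e => (if e.1 = e.2 then √2 else 1) * g e) =
      Measure.pi fun e : Fin n × Fin n => gaussianReal 0 (if e.1 = e.2 then 2 else 1) := by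
    have hp : ∀ e : Fin n × Fin n, IsProbabilityMeasure ((gaussianReal 0 1).map
        fun x => (if e.1 = e.2 then √2 else 1) * x) := fun e =>
      Measure.isProbabilityMeasure_map (by fun_prop)
    rw [Measure.pi_map_pi (f := fun (e : Fin n × Fin n) (x : ℝ) => (if e.1 = e.2 then √2 else 1) * x)
      fun e => by fun_prop]
    congr 1
    ext1 e
    rw [gaussianReal_map_const_mul]
    congr 1
    · simp
    · split_ifs
      · ext; simp
      · ext; simp
  rw [noiseLaw, ← h, Measure.map_map (measurable_symmetrize n)
    (measurable_pi_lambda _ fun e => (measurable_pi_apply e).const_mul _)]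
  congr 1
  ext g e
  have : min e.1 e.2 = max e.1 e.2 ↔ e.1 = e.2 := by
    rcases le_total e.1 e.2 with h | h
    · simp [h]
    · simp [h, eq_comm]
  simp [this]

/-- Disjoint parts of the tape provide an independent noise matrix and an independent tape. -/
lemma map_tapeLaw {n : ℕ} (u : Fin n × Fin n → ℕ) (w : ℕ → ℕ) (hu : Function.Injective u)
    (hw : Function.Injective w) (huw : ∀ e v, u e ≠ w v) :
    tapeLaw.map (fun ω => ((fun e : Fin n × Fin n =>
      (if e.1 = e.2 then √2 else 1) * ω (u (min e.1 e.2, max e.1 e.2))), fun v => ω (w v))) =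
      (noiseLaw n).prod tapeLaw := by
  -- Reading an i.i.d. family along an injection leaves it i.i.d.; the injection is defined on a
  -- disjoint union, over which the product law splits.
  have h₁ := Measure.map_infinitePi_infinitePi_of_inj (P := fun _ : ℕ => gaussianReal 0 1)
    (f := Sum.elim u w) (hu.sumElim hw huw)
  have h₂ := infinitePi_map_sum (α := Fin n × Fin n) (β := ℕ) (gaussianReal 0 1)
  rw [← h₁, Measure.infinitePi_eq_pi (ι := Fin n × Fin n), Measure.map_map (by fun_prop) (by fun_prop)] at h₂
  have hm : Measurable fun (g : Fin n × Fin n → ℝ) (e : Fin n × Fin n) =>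
      (if e.1 = e.2 then √2 else 1) * g (min e.1 e.2, max e.1 e.2) :=
    measurable_pi_lambda _ fun e => (measurable_pi_apply _).const_mul _
  have h₃ := Measure.map_prod_map (Measure.pi fun _ : Fin n × Fin n => gaussianReal 0 1)
    tapeLaw hm measurable_id
  rw [map_scale_pi_gaussianReal, Measure.map_id] at h₃
  rw [h₃]
  change _ = Measure.map _ (Measure.prod _ (Measure.infinitePi fun _ : ℕ => gaussianReal 0 1))
  rw [← h₂, Measure.map_map (hm.prodMap measurable_id) (by fun_prop)]
  rfl

/-! ### A tail bound for the noise -/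

lemma card_fiber_symmetrize_le {n : ℕ} (f : Fin n × Fin n) :
    (Finset.univ.filter fun e : Fin n × Fin n => (min e.1 e.2, max e.1 e.2) = f).card ≤ 2 := by
  refine (Finset.card_le_card (t := {f, f.swap}) fun e he => ?_).trans Finset.card_le_two
  simp only [Finset.mem_filter, Finset.mem_univ, true_and] at he
  simp only [Finset.mem_insert, Finset.mem_singleton]
  rcases le_total e.1 e.2 with h | h
  · left; rw [← he]; simp [h]
  · right; rw [← he]; simp [h]

/-- Collecting the two positions of each independent entry writes the inner product as `∑ C f * g
f`. A fibre has at most two elements, so `C f ^ 2` is at most twice the sum of the `X e ^ 2` over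
it, and the variances are at most `2`. The total variance is therefore at most `4 ∑ X e ^ 2`. -/
lemma mgf_inner_noiseLaw_le {n : ℕ} (X : Fin n × Fin n → ℝ) (s : ℝ) :
    Integrable (fun W => Real.exp (s * ∑ e, X e * W e)) (noiseLaw n) ∧
    mgf (fun W : Fin n × Fin n → ℝ => ∑ e, X e * W e) (noiseLaw n) s ≤
      Real.exp (2 * s ^ 2 * ∑ e, X e ^ 2) := by
  classical
  set φ : Fin n × Fin n → Fin n × Fin n := fun e => (min e.1 e.2, max e.1 e.2) with hφ
  set C : Fin n × Fin n → ℝ := fun f => ∑ e with φ e = f, X e with hC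
  set v : Fin n × Fin n → NNReal := fun e => if e.1 = e.2 then 2 else 1 with hv
  have hsum : ∀ g : Fin n × Fin n → ℝ, s * ∑ e, X e * g (φ e) = ∑ f, s * C f * g f := by
    intro g
    rw [← Finset.sum_fiberwise (g := φ), Finset.mul_sum]
    refine Finset.sum_congr rfl fun f _ => ?_
    rw [hC, mul_assoc, Finset.sum_mul]
    congr 1
    refine Finset.sum_congr rfl fun e he => ?_
    rw [(Finset.mem_filter.1 he).2]
  have hexp : ∀ g : Fin n × Fin n → ℝ, Real.exp (s * ∑ e, X e * g (φ e)) =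
      ∏ f, Real.exp (s * C f * g f) := fun g => by rw [hsum, Real.exp_sum]
  have hmeas : Measurable fun W : Fin n × Fin n → ℝ => Real.exp (s * ∑ e, X e * W e) := by
    fun_prop
  have hint : Integrable (fun g : Fin n × Fin n → ℝ => ∏ f, Real.exp (s * C f * g f))
      (Measure.pi fun e => gaussianReal 0 (v e)) :=
    Integrable.fintype_prod (f := fun f x => Real.exp (s * C f * x))
      fun f => integrable_exp_mul_gaussianReal _
  constructor
  · rw [noiseLaw, integrable_map_measure hmeas.aestronglyMeasurable
      (measurable_symmetrize n).aemeasurable]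
    refine hint.congr (ae_of_all _ fun g => ?_)
    exact (hexp g).symm
  · rw [mgf, noiseLaw, integral_map (measurable_symmetrize n).aemeasurable
      hmeas.aestronglyMeasurable]
    change ∫ g, Real.exp (s * ∑ e, X e * g (φ e)) ∂(Measure.pi fun e => gaussianReal 0 (v e)) ≤ _
    simp only [hexp]
    rw [integral_fintype_prod_eq_prod (f := fun f x => Real.exp (s * C f * x))]
    have hm : ∀ f, ∫ x, Real.exp (s * C f * x) ∂(gaussianReal 0 (v f)) =
        Real.exp (v f * (s * C f) ^ 2 / 2) := by
      intro f
      have := congrFun (mgf_fun_id_gaussianReal (μ := 0) (v := v f)) (s * C f)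
      simpa [mgf] using this
    simp only [hm]
    rw [← Real.exp_sum, Real.exp_le_exp]
    have hCf : ∀ f, (v f : ℝ) * (s * C f) ^ 2 / 2 ≤ 2 * s ^ 2 * ∑ e with φ e = f, X e ^ 2 := by
      intro f
      have h1 : (C f) ^ 2 ≤ 2 * ∑ e with φ e = f, X e ^ 2 := by
        refine (sq_sum_le_card_mul_sum_sq).trans ?_
        have : ((Finset.univ.filter fun e => φ e = f).card : ℝ) ≤ 2 := by
          exact_mod_cast card_fiber_symmetrize_le f
        exact mul_le_mul_of_nonneg_right this (Finset.sum_nonneg fun _ _ => sq_nonneg _)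
      have h2 : (v f : ℝ) ≤ 2 := by simp only [hv]; split_ifs <;> norm_num
      have h3 : 0 ≤ (s * C f) ^ 2 := sq_nonneg _
      calc (v f : ℝ) * (s * C f) ^ 2 / 2 ≤ 2 * (s * C f) ^ 2 / 2 := by gcongr
        _ = s ^ 2 * C f ^ 2 := by ring
        _ ≤ s ^ 2 * (2 * ∑ e with φ e = f, X e ^ 2) := by gcongr
        _ = _ := by ring
    calc ∑ f, (v f : ℝ) * (s * C f) ^ 2 / 2 ≤ ∑ f, 2 * s ^ 2 * ∑ e with φ e = f, X e ^ 2 :=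
          Finset.sum_le_sum fun f _ => hCf f
      _ = _ := by rw [← Finset.mul_sum, Finset.sum_fiberwise]

/-- The inner product of a fixed matrix with the noise has a Gaussian tail. -/
lemma noiseLaw_inner_tail {n : ℕ} (X : Fin n × Fin n → ℝ) {τ : ℝ} (hτ : 0 ≤ τ) :
    (noiseLaw n).real {W | τ * √(∑ e, X e ^ 2) < ∑ e, X e * W e} ≤ Real.exp (-τ ^ 2 / 8) := by
  set S := ∑ e, X e ^ 2 with hS
  have hS0 : 0 ≤ S := Finset.sum_nonneg fun _ _ => sq_nonneg _
  rcases hS0.eq_or_lt with h0 | hpos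
  · have hX : ∀ e, X e = 0 := fun e => by
      have := (Finset.sum_eq_zero_iff_of_nonneg (fun e _ => sq_nonneg (X e))).1 h0.symm e
        (Finset.mem_univ e)
      simpa using this
    have : {W : Fin n × Fin n → ℝ | τ * √S < ∑ e, X e * W e} = ∅ := by
      ext W
      simp [hX, ← h0]
    rw [this]
    simpa using (Real.exp_pos _).le
  · have hr : 0 < √S := Real.sqrt_pos.2 hpos
    have hr2 : √S ^ 2 = S := Real.sq_sqrt hS0
    -- This minimizes `-s τ √S + 2 s² S`, with minimum `-τ² / 8`.
    set s := τ / (4 * √S) with hs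
    have hs0 : 0 ≤ s := by positivity
    obtain ⟨hi, hm⟩ := mgf_inner_noiseLaw_le X s
    have h := measure_ge_le_exp_mul_mgf (μ := noiseLaw n)
      (X := fun W : Fin n × Fin n → ℝ => ∑ e, X e * W e) (τ * √S) hs0 hi
    have hsub : {W : Fin n × Fin n → ℝ | τ * √S < ∑ e, X e * W e} ⊆
        {W | τ * √S ≤ ∑ e, X e * W e} := fun W hW => le_of_lt (Set.mem_ofPred.1 hW)
    refine (measureReal_mono (μ := noiseLaw n) hsub).trans (h.trans ?_)
    calc Real.exp (-s * (τ * √S)) * mgf (fun W : Fin n × Fin n → ℝ => ∑ e, X e * W e) (noiseLaw n) s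
        ≤ Real.exp (-s * (τ * √S)) * Real.exp (2 * s ^ 2 * S) := by gcongr
      _ = Real.exp (-τ ^ 2 / 8) := by
        rw [← Real.exp_add]
        congr 1
        rw [hs, show 2 * (τ / (4 * √S)) ^ 2 * S = 2 * (τ / (4 * √S)) ^ 2 * √S ^ 2 by rw [hr2]]
        field_simp
        ring

/-! ### The law of the two clones of a sample -/

lemma isProbabilityMeasure_berLaw {ρ : ℝ} (h₀ : 0 ≤ ρ) (h₁ : ρ ≤ 1) :
    IsProbabilityMeasure (berLaw ρ) := by
  refine ⟨?_⟩
  simp only [berLaw, Measure.coe_add, Measure.coe_smul, Pi.add_apply, Pi.smul_apply,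
    measure_univ, smul_eq_mul, mul_one]
  rw [← ENNReal.ofReal_add h₀ (by linarith)]
  simp

lemma isProbabilityMeasure_signalLaw (n : ℕ) {ρ : ℝ} (h₀ : 0 ≤ ρ) (h₁ : ρ ≤ 1) :
    IsProbabilityMeasure (signalLaw n ρ) := by
  have := isProbabilityMeasure_berLaw h₀ h₁
  unfold signalLaw
  infer_instance

@[fun_prop]
lemma measurable_spike {n : ℕ} (lam : ℝ) : Measurable (spike lam : (Fin n → ℝ) → _) := by
  unfold spike
  fun_prop

lemma isProbabilityMeasure_plantedLaw (n : ℕ) (lam : ℝ) {ρ : ℝ} (h₀ : 0 ≤ ρ) (h₁ : ρ ≤ 1) :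
    IsProbabilityMeasure (plantedLaw n lam ρ) := by
  have := isProbabilityMeasure_signalLaw n h₀ h₁
  exact Measure.isProbabilityMeasure_map (by fun_prop)

lemma plantedLaw_zero (n : ℕ) {ρ : ℝ} (h₀ : 0 ≤ ρ) (h₁ : ρ ≤ 1) :
    plantedLaw n 0 ρ = noiseLaw n := by
  have := isProbabilityMeasure_signalLaw n h₀ h₁
  have h : (fun z : (Fin n → ℝ) × (Fin n × Fin n → ℝ) => spike 0 z.1 + z.2) = Prod.snd := by
    ext z e
    simp [spike]
  rw [plantedLaw, h, Measure.map_snd_prod, measure_univ, one_smul]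

/-- The two clones of a planted sample are planted samples with independent noise. -/
lemma map_clone_plantedLaw (n : ℕ) (lam : ℝ) {ρ a : ℝ} (h₀ : 0 ≤ ρ) (h₁ : ρ ≤ 1)
    (ha₀ : 0 ≤ a) (ha₁ : a ≤ 1) :
    ((plantedLaw n lam ρ).prod ((noiseLaw n).prod tapeLaw)).map
      (fun p => ((a • p.1 + √(1 - a ^ 2) • p.2.1, p.2.2), √(1 - a ^ 2) • p.1 - a • p.2.1)) =
    ((((signalLaw n ρ).prod (noiseLaw n)).prod tapeLaw).prod (noiseLaw n)).map
      (fun p => ((spike (a * lam) p.1.1.1 + p.1.1.2, p.1.2),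
        spike (√(1 - a ^ 2) * lam) p.1.1.1 + p.2)) := by
  have := isProbabilityMeasure_signalLaw n h₀ h₁
  set b := √(1 - a ^ 2) with hb
  set σ := signalLaw n ρ
  set N := noiseLaw n
  have hrot : MeasurePreserving (fun p : (Fin n × Fin n → ℝ) × (Fin n × Fin n → ℝ) =>
      (a • p.1 + b • p.2, b • p.1 - a • p.2)) (N.prod N) (N.prod N) :=
    ⟨by fun_prop, map_rotation_noiseLaw n ha₀ ha₁⟩
  -- The seven maps regroup `((θ, W), (Z, ω))` so that `(W, Z)` can be rotated, then move the second
  -- rotated noise to the last place, outside everything the estimator sees.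
  have e₁ := measurePreserving_prodAssoc σ N (N.prod tapeLaw)
  have e₂ := (MeasurePreserving.id σ).prod ((measurePreserving_prodAssoc N N tapeLaw).symm)
  have e₃ := (MeasurePreserving.id σ).prod (hrot.prod (MeasurePreserving.id tapeLaw))
  have e₄ := (MeasurePreserving.id σ).prod (measurePreserving_prodAssoc N N tapeLaw)
  have e₅ := (MeasurePreserving.id σ).prod ((MeasurePreserving.id N).prod
    (Measure.measurePreserving_swap (μ := N) (ν := tapeLaw)))
  have e₆ := (measurePreserving_prodAssoc σ N (tapeLaw.prod N)).symm
  have e₇ := (measurePreserving_prodAssoc (σ.prod N) tapeLaw N).symm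
  have e := e₇.comp (e₆.comp (e₅.comp (e₄.comp (e₃.comp (e₂.comp e₁)))))
  have hP : plantedLaw n lam ρ = (σ.prod N).map fun z => spike lam z.1 + z.2 := rfl
  have hm : Measurable fun z : (Fin n → ℝ) × (Fin n × Fin n → ℝ) => spike lam z.1 + z.2 := by
    fun_prop
  have hQ : (plantedLaw n lam ρ).prod (N.prod tapeLaw) =
      ((σ.prod N).prod (N.prod tapeLaw)).map
        (Prod.map (fun z => spike lam z.1 + z.2) id) := by
    have := Measure.map_prod_map (σ.prod N) (N.prod tapeLaw) hm measurable_id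
    rw [Measure.map_id] at this
    rw [hP, this]
  rw [hQ, Measure.map_map (by fun_prop) (hm.prodMap measurable_id), ← e.map_eq,
    Measure.map_map (by fun_prop) e.measurable]
  congr 1
  ext1 p
  obtain ⟨⟨θ, W⟩, Z, ω⟩ := p
  simp only [Function.comp_apply, Prod.map_apply, id]
  ext x
  all_goals simp [spike, MeasurableEquiv.prodAssoc]
  all_goals ring

/-! ### Testing a single sample -/

/-- The sample `y` passes the test, with auxiliary noise `z` and random tape `ω`. -/
def Pass {n : ℕ} (A : RProgram) (a τ : ℝ) (y z : Fin n × Fin n → ℝ) (ω : ℕ → ℝ) : Prop :=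
  τ * √(∑ e, A.estimate ω (a • y + √(1 - a ^ 2) • z) e ^ 2) <
    ∑ e, A.estimate ω (a • y + √(1 - a ^ 2) • z) e * (√(1 - a ^ 2) • y - a • z) e

lemma measurable_estimate {n : ℕ} {A : RProgram} {t : ℝ} (hA : A.RunsWithin (n * n) t)
    {Ω : Type*} [MeasurableSpace Ω] {ω : Ω → ℕ → ℝ} {Y : Ω → Fin n × Fin n → ℝ}
    (hω : Measurable ω) (hY : Measurable Y) (e : Fin n × Fin n) :
    Measurable fun z => A.estimate (ω z) (Y z) e :=
  measurable_finalMem (fun v => (measurable_pi_apply v).comp hω)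
    (fun _ => (measurable_pi_apply _).comp hY) hA _

/-- The event that the second clone `q.2` is correlated with the estimate from the first. -/
def correlated {n : ℕ} (A : RProgram) (τ : ℝ) :
    Set (((Fin n × Fin n → ℝ) × (ℕ → ℝ)) × (Fin n × Fin n → ℝ)) :=
  {q | τ * √(∑ e, A.estimate q.1.2 q.1.1 e ^ 2) < ∑ e, A.estimate q.1.2 q.1.1 e * q.2 e}

lemma measurableSet_correlated {n : ℕ} {A : RProgram} {t : ℝ} (hA : A.RunsWithin (n * n) t)
    (τ : ℝ) : MeasurableSet (correlated (n := n) A τ) := by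
  have h : ∀ e : Fin n × Fin n, Measurable
      fun q : ((Fin n × Fin n → ℝ) × (ℕ → ℝ)) × (Fin n × Fin n → ℝ) =>
        A.estimate q.1.2 q.1.1 e := fun e => measurable_estimate hA (by fun_prop) (by fun_prop) e
  refine measurableSet_lt ?_ ?_
  · exact ((Finset.measurable_sum _ fun e _ => (h e).pow_const 2).sqrt).const_mul _
  · exact Finset.measurable_sum _ fun e _ => (h e).mul (by fun_prop)

lemma measurableSet_pass {n : ℕ} {A : RProgram} {t : ℝ} (hA : A.RunsWithin (n * n) t) (a τ : ℝ) :
    MeasurableSet {p : (Fin n × Fin n → ℝ) × (Fin n × Fin n → ℝ) × (ℕ → ℝ) |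
      Pass A a τ p.1 p.2.1 p.2.2} := by
  have hm : Measurable fun p : (Fin n × Fin n → ℝ) × (Fin n × Fin n → ℝ) × (ℕ → ℝ) =>
      ((a • p.1 + √(1 - a ^ 2) • p.2.1, p.2.2), √(1 - a ^ 2) • p.1 - a • p.2.1) := by fun_prop
  exact hm (measurableSet_correlated hA τ)

/-- A bound for every section bounds the measure in the product. -/
lemma measureReal_prod_le {α β : Type*} [MeasurableSpace α] [MeasurableSpace β] {μ : Measure α}
    {ν : Measure β} [IsProbabilityMeasure μ] [IsProbabilityMeasure ν] {S : Set (α × β)}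
    (hS : MeasurableSet S) {c : ℝ} (h : ∀ x, ν.real (Prod.mk x ⁻¹' S) ≤ c) :
    (μ.prod ν).real S ≤ c := by
  rcases isEmpty_or_nonempty α with hα | ⟨⟨x⟩⟩
  · exact absurd (measure_univ (μ := μ)) (by simp [Set.eq_empty_of_isEmpty])
  have hc : 0 ≤ c := measureReal_nonneg.trans (h x)
  rw [measureReal_def, Measure.prod_apply hS]
  refine ENNReal.toReal_le_of_le_ofReal hc ?_
  calc ∫⁻ x, ν (Prod.mk x ⁻¹' S) ∂μ ≤ ∫⁻ _, ENNReal.ofReal c ∂μ := by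
        refine lintegral_mono fun x => ?_
        rw [← ofReal_measureReal]
        exact ENNReal.ofReal_le_ofReal (h x)
    _ = ENNReal.ofReal c := by simp

/-- A sample without signal rarely passes. -/
lemma null_pass_le {n : ℕ} {A : RProgram} {t a τ : ℝ} (hA : A.RunsWithin (n * n) t)
    (ha₀ : 0 ≤ a) (ha₁ : a ≤ 1) (hτ : 0 ≤ τ) :
    ((noiseLaw n).prod ((noiseLaw n).prod tapeLaw)).real {p | Pass A a τ p.1 p.2.1 p.2.2} ≤
      Real.exp (-τ ^ 2 / 8) := by
  have := isProbabilityMeasure_signalLaw n (ρ := 0) le_rfl zero_le_one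
  -- Pure noise is the planted model of strength zero, so the cloning identity covers it.
  -- Conditionally on the first clone and the tape, the estimate is a fixed matrix and the Gaussian
  -- tail applies.
  have h := map_clone_plantedLaw n 0 (ρ := 0) (a := a) le_rfl zero_le_one ha₀ ha₁
  rw [plantedLaw_zero n le_rfl zero_le_one] at h
  have hc := measurableSet_correlated (n := n) hA τ
  have h' := congrArg (fun μ => μ.real (correlated A τ)) h
  rw [map_measureReal_apply (by fun_prop) hc, map_measureReal_apply (by fun_prop) hc] at h'
  refine (le_of_eq h').trans (measureReal_prod_le ?_ ?_)
  · exact (by fun_prop : Measurable _) hc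
  · intro x
    convert noiseLaw_inner_tail (A.estimate x.2 (spike (a * 0) x.1.1 + x.1.2)) hτ using 2
    ext W
    simp [correlated, spike]

lemma corr_le_one {n : ℕ} (X T : Fin n × Fin n → ℝ) : corr X T ≤ 1 :=
  div_le_one_of_le₀ (Real.sum_mul_le_sqrt_mul_sqrt _ _ _) (by positivity)

/-- A function bounded by one with mean at least `c` is often at least `c / 2`. -/
lemma measureReal_lt_half_le {Ω : Type*} [MeasurableSpace Ω] {μ : Measure Ω}
    [IsProbabilityMeasure μ] {f : Ω → ℝ} {c : ℝ} (hf : Measurable f) (h₁ : ∀ x, f x ≤ 1)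
    (hc : 0 < c) (h : c ≤ ∫ x, f x ∂μ) : μ.real {x | f x < c / 2} ≤ 1 - c / 2 := by
  have hi : Integrable f μ := by
    -- The integral of a non-integrable function is zero by convention, which contradicts `0 < c ≤ ∫
    -- f`.
    by_contra hn
    rw [integral_undef hn] at h
    linarith
  have hm : MeasurableSet {x | f x < c / 2} := measurableSet_lt hf measurable_const
  have hle : ∀ x, f x ≤ {x | f x < c / 2}ᶜ.indicator 1 x + c / 2 := by
    intro x
    by_cases hx : f x < c / 2
    · simp [hx, hx.le]
    · have := h₁ x
      simp [hx]
      linarith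
  have hind : Integrable ({x | f x < c / 2}ᶜ.indicator (1 : Ω → ℝ)) μ :=
    (integrable_const (1 : ℝ)).indicator hm.compl
  have h2 : ∫ x, f x ∂μ ≤ μ.real {x | f x < c / 2}ᶜ + c / 2 := by
    refine (integral_mono hi (hind.add (integrable_const _)) hle).trans ?_
    · rw [integral_add' hind (integrable_const _), integral_indicator_one hm.compl]
      simp
  rw [probReal_compl_eq_one_sub hm] at h2
  linarith

/-- If the estimator is correlated with the signal, then a planted sample passes with positive
probability. -/
lemma planted_not_pass_le {n : ℕ} {A : RProgram} {t a τ lam ρ c s : ℝ}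
    (hA : A.RunsWithin (n * n) t) (h₀ : 0 ≤ ρ) (h₁ : ρ ≤ 1) (ha₀ : 0 < a) (ha₁ : a ≤ 1)
    (hτ : 0 ≤ τ) (hlam : 0 < lam) (hc : 0 < c) (hcorr : c ≤ expectedCorr A n (a * lam) ρ)
    (hs : 4 * τ < √(1 - a ^ 2) * lam * c * s) :
    ((plantedLaw n lam ρ).prod ((noiseLaw n).prod tapeLaw)).real
        {p | ¬ Pass A a τ p.1 p.2.1 p.2.2} ≤
      1 - c / 2 + (signalLaw n ρ).real {θ | √(∑ e : Fin n × Fin n, (θ e.1 * θ e.2) ^ 2) < s} +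
        Real.exp (-τ ^ 2 / 8) := by
  have := isProbabilityMeasure_signalLaw n h₀ h₁
  have h := map_clone_plantedLaw n lam (ρ := ρ) (a := a) h₀ h₁ ha₀.le ha₁
  set b := √(1 - a ^ 2) with hb
  have hb0 : 0 ≤ b := Real.sqrt_nonneg _
  have hcm := (measurableSet_correlated (n := n) hA τ).compl
  have h' := congrArg (fun μ => μ.real (correlated A τ)ᶜ) h
  rw [map_measureReal_apply (by fun_prop) hcm, map_measureReal_apply (by fun_prop) hcm] at h'
  refine (le_of_eq h').trans ?_
  set μ₃ := ((signalLaw n ρ).prod (noiseLaw n)).prod tapeLaw with hμ₃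
  set X : ((Fin n → ℝ) × (Fin n × Fin n → ℝ)) × (ℕ → ℝ) → Fin n × Fin n → ℝ := fun z =>
    A.estimate z.2 (spike (a * lam) z.1.1 + z.1.2) with hX
  have hXm : ∀ e, Measurable fun z => X z e := fun e =>
    measurable_estimate hA (by fun_prop) (by fun_prop) e
  have hcorrm : Measurable fun z : ((Fin n → ℝ) × (Fin n × Fin n → ℝ)) × (ℕ → ℝ) =>
      corr (X z) (spike (a * lam) z.1.1) := by
    unfold corr spike
    refine Measurable.div ?_ (Measurable.mul ?_ ?_)
    · exact Finset.measurable_sum _ fun e _ => (hXm e).mul (by fun_prop)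
    · exact (Finset.measurable_sum _ fun e _ => (hXm e).pow_const 2).sqrt
    · fun_prop
  have hE₁ : μ₃.real {z | corr (X z) (spike (a * lam) z.1.1) < c / 2} ≤ 1 - c / 2 :=
    measureReal_lt_half_le hcorrm (fun z => corr_le_one _ _) hc hcorr
  -- The noise of the second clone is independent of the estimate `X`. Using `-X` turns the upper
  -- tail bound into the lower tail needed here.
  have hE₃ : (μ₃.prod (noiseLaw n)).real
      {q | τ * √(∑ e, (-X q.1 e) ^ 2) < ∑ e, (-X q.1 e) * q.2 e} ≤ Real.exp (-τ ^ 2 / 8) := by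
    refine measureReal_prod_le ?_ fun x => noiseLaw_inner_tail (fun e => -X x e) hτ
    refine measurableSet_lt ?_ ?_
    · exact ((Finset.measurable_sum _ fun e _ =>
        (((hXm e).comp measurable_fst).neg).pow_const 2).sqrt).const_mul _
    · exact Finset.measurable_sum _ fun e _ =>
        (((hXm e).comp measurable_fst).neg).mul (by fun_prop)
  set E₁ : Set ((((Fin n → ℝ) × (Fin n × Fin n → ℝ)) × (ℕ → ℝ)) × (Fin n × Fin n → ℝ)) :=
    Prod.fst ⁻¹' {z | corr (X z) (spike (a * lam) z.1.1) < c / 2}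
  set E₂ : Set ((((Fin n → ℝ) × (Fin n × Fin n → ℝ)) × (ℕ → ℝ)) × (Fin n × Fin n → ℝ)) :=
    (fun q => q.1.1.1) ⁻¹' {θ | √(∑ e : Fin n × Fin n, (θ e.1 * θ e.2) ^ 2) < s}
  have hm₁ : (μ₃.prod (noiseLaw n)).real E₁ ≤ 1 - c / 2 := by
    rw [(measurePreserving_fst (μ := μ₃) (ν := noiseLaw n)).measureReal_preimage
      (measurableSet_lt hcorrm measurable_const).nullMeasurableSet]
    exact hE₁
  have hm₂ : (μ₃.prod (noiseLaw n)).real E₂ =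
      (signalLaw n ρ).real {θ | √(∑ e : Fin n × Fin n, (θ e.1 * θ e.2) ^ 2) < s} := by
    have hp : MeasurePreserving (fun q : (((Fin n → ℝ) × (Fin n × Fin n → ℝ)) × (ℕ → ℝ)) ×
        (Fin n × Fin n → ℝ) => q.1.1.1) (μ₃.prod (noiseLaw n)) (signalLaw n ρ) :=
      (measurePreserving_fst (μ := signalLaw n ρ) (ν := noiseLaw n)).comp
        ((measurePreserving_fst (μ := (signalLaw n ρ).prod (noiseLaw n)) (ν := tapeLaw)).comp
          measurePreserving_fst)
    refine hp.measureReal_preimage (measurableSet_lt ?_ measurable_const).nullMeasurableSet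
    fun_prop
  refine (measureReal_mono (s₂ := (E₁ ∪ E₂) ∪
    {q | τ * √(∑ e, (-X q.1 e) ^ 2) < ∑ e, (-X q.1 e) * q.2 e}) ?_).trans ?_
  · intro q hq
    by_contra hn
    simp only [Set.mem_union, not_or] at hn
    obtain ⟨⟨n₁, n₂⟩, n₃⟩ := hn
    have n₁ : c / 2 ≤ corr (X q.1) (spike (a * lam) q.1.1.1) := not_lt.1 n₁
    have n₂ : s ≤ √(∑ e : Fin n × Fin n, (q.1.1.1 e.1 * q.1.1.1 e.2) ^ 2) := not_lt.1 n₂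
    have n₃ : ∑ e, (-X q.1 e) * q.2 e ≤ τ * √(∑ e, (-X q.1 e) ^ 2) := not_lt.1 n₃
    refine hq ?_
    change τ * √(∑ e, X q.1 e ^ 2) < ∑ e, X q.1 e * (spike (b * lam) q.1.1.1 + q.2) e
    set θ := q.1.1.1
    set R := √(∑ e, X q.1 e ^ 2) with hR
    set F := √(∑ e : Fin n × Fin n, (θ e.1 * θ e.2) ^ 2) with hF
    set I := ∑ e : Fin n × Fin n, X q.1 e * (θ e.1 * θ e.2) with hI
    have hal : 0 < a * lam := mul_pos ha₀ hlam
    have hc1 : corr (X q.1) (spike (a * lam) θ) = I / (R * F) := by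
      have i1 : ∑ e, X q.1 e * spike (a * lam) θ e = a * lam * I := by
        rw [hI, Finset.mul_sum]
        exact Finset.sum_congr rfl fun e _ => by simp only [spike]; ring
      have i2 : √(∑ e, spike (a * lam) θ e ^ 2) = a * lam * F := by
        have : ∑ e, spike (a * lam) θ e ^ 2 =
            (a * lam) ^ 2 * ∑ e : Fin n × Fin n, (θ e.1 * θ e.2) ^ 2 := by
          rw [Finset.mul_sum]
          exact Finset.sum_congr rfl fun e _ => by simp only [spike]; ring
        rw [this, Real.sqrt_mul (sq_nonneg _), Real.sqrt_sq hal.le]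
      rw [corr, i1, i2, ← hR]
      rw [show R * (a * lam * F) = a * lam * (R * F) by ring,
        mul_div_mul_left _ _ hal.ne']
    rw [hc1] at n₁
    -- A zero denominator would make the correlation zero, which is below `c / 2`.
    have hRF : 0 < R * F := by
      rcases (mul_nonneg (Real.sqrt_nonneg _) (Real.sqrt_nonneg _) : 0 ≤ R * F).eq_or_lt with h0 | h0
      · rw [← h0, div_zero] at n₁; linarith
      · exact h0
    rw [le_div_iff₀ hRF] at n₁
    have hR0 : 0 < R := by
      have hRn : 0 ≤ R := Real.sqrt_nonneg _
      rcases hRn.eq_or_lt with h0 | h0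
      · rw [← h0, zero_mul] at hRF
        exact absurd hRF (lt_irrefl _)
      · exact h0
    have j1 : ∑ e, X q.1 e * (spike (b * lam) θ + q.2) e =
        b * lam * I + ∑ e, X q.1 e * q.2 e := by
      rw [hI, Finset.mul_sum, ← Finset.sum_add_distrib]
      exact Finset.sum_congr rfl fun e _ => by simp only [spike, Pi.add_apply]; ring
    have j2 : -∑ e, X q.1 e * q.2 e ≤ τ * R := by
      have : ∑ e, (-X q.1 e) * q.2 e = -∑ e, X q.1 e * q.2 e := by
        rw [← Finset.sum_neg_distrib]
        exact Finset.sum_congr rfl fun e _ => by ring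
      rw [← this]
      simpa only [neg_sq] using n₃
    have hbl : 0 ≤ b * lam := mul_nonneg hb0 hlam.le
    have j3 : b * lam * (c / 2 * (R * s)) ≤ b * lam * I := by
      refine mul_le_mul_of_nonneg_left (le_trans ?_ n₁) hbl
      gcongr
    rw [j1]
    -- The signal contributes at least `b * lam * c * R * s / 2 > 2 * τ * R`, and the noise removes
    -- at most `τ * R`.
    nlinarith [mul_lt_mul_of_pos_right hs hR0]
  · refine (measureReal_union_le _ _).trans (add_le_add ((measureReal_union_le _ _).trans ?_) hE₃)
    rw [hm₂]
    gcongr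

/-! ### The size of the signal -/

lemma integral_berLaw {ρ : ℝ} (h₀ : 0 ≤ ρ) (h₁ : ρ ≤ 1) (f : ℝ → ℝ) :
    ∫ x, f x ∂(berLaw ρ) = ρ * f 1 + (1 - ρ) * f 0 := by
  rw [berLaw, integral_add_measure, integral_smul_measure, integral_smul_measure, integral_dirac,
    integral_dirac]
  · simp [h₀, h₁]
  · exact (integrable_dirac (by simp)).smul_measure (by simp)
  · exact (integrable_dirac (by simp)).smul_measure (by simp)

lemma integrable_berLaw (ρ : ℝ) (f : ℝ → ℝ) : Integrable f (berLaw ρ) := by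
  unfold berLaw
  exact ((integrable_dirac (by simp)).smul_measure (by simp)).add_measure
    ((integrable_dirac (by simp)).smul_measure (by simp))

/-- The Frobenius norm of `θ θᵀ` is `∑ θ i ^ 2`, a binomial variable of mean `ρ n`. Chernoff at
parameter `-1` gives `exp(ρ n / 2 - 0.6 ρ n)`, where `0.6` is a lower bound for `1 - e⁻¹`. -/
lemma signalLaw_small_le (n : ℕ) {ρ : ℝ} (h₀ : 0 ≤ ρ) (h₁ : ρ ≤ 1) :
    (signalLaw n ρ).real {θ | √(∑ e : Fin n × Fin n, (θ e.1 * θ e.2) ^ 2) < ρ * n / 2} ≤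
      Real.exp (-(ρ * n / 10)) := by
  have hb := isProbabilityMeasure_berLaw h₀ h₁
  have := isProbabilityMeasure_signalLaw n h₀ h₁
  have hsq : ∀ θ : Fin n → ℝ, √(∑ e : Fin n × Fin n, (θ e.1 * θ e.2) ^ 2) = ∑ i, θ i ^ 2 := by
    intro θ
    rw [Fintype.sum_prod_type]
    simp only [mul_pow, ← Finset.mul_sum, ← Finset.sum_mul]
    exact Real.sqrt_mul_self (Finset.sum_nonneg fun _ _ => sq_nonneg _)
  simp only [hsq]
  have hexp : ∀ θ : Fin n → ℝ, Real.exp (-1 * ∑ i, θ i ^ 2) = ∏ i, Real.exp (-θ i ^ 2) := by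
    intro θ
    rw [← Real.exp_sum, Finset.sum_neg_distrib, neg_one_mul]
  have hint : Integrable (fun θ : Fin n → ℝ => Real.exp (-1 * ∑ i, θ i ^ 2)) (signalLaw n ρ) := by
    simp only [hexp]
    exact Integrable.fintype_prod (f := fun _ x => Real.exp (-x ^ 2)) fun _ => integrable_berLaw _ _
  have h := measure_le_le_exp_mul_mgf (μ := signalLaw n ρ) (X := fun θ : Fin n → ℝ => ∑ i, θ i ^ 2)
    (ρ * n / 2) (by norm_num : (-1 : ℝ) ≤ 0) hint
  have hsub : {θ : Fin n → ℝ | ∑ i, θ i ^ 2 < ρ * n / 2} ⊆ {θ | ∑ i, θ i ^ 2 ≤ ρ * n / 2} :=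
    fun θ hθ => le_of_lt (Set.mem_ofPred.1 hθ)
  refine (measureReal_mono hsub).trans (h.trans ?_)
  have hm : mgf (fun θ : Fin n → ℝ => ∑ i, θ i ^ 2) (signalLaw n ρ) (-1) ≤
      Real.exp (-(0.6 * ρ * n)) := by
    rw [mgf]
    simp only [hexp]
    rw [signalLaw, integral_fintype_prod_eq_pow (fun x => Real.exp (-x ^ 2)),
      integral_berLaw h₀ h₁, Fintype.card_fin]
    have e1 : Real.exp (-1) ≤ 0.4 := by
      rw [Real.exp_neg, inv_le_comm₀ (Real.exp_pos _) (by norm_num)]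
      have := Real.exp_one_gt_d9
      norm_num at *
      linarith
    have e2 : ρ * Real.exp (-1 ^ 2) + (1 - ρ) * Real.exp (-0 ^ 2) ≤ Real.exp (-(0.6 * ρ)) := by
      have := Real.add_one_le_exp (-(0.6 * ρ))
      norm_num at *
      nlinarith
    calc _ ≤ Real.exp (-(0.6 * ρ)) ^ n := by
          refine pow_le_pow_left₀ ?_ e2 n
          have : 0 ≤ 1 - ρ := by linarith
          positivity
      _ = _ := by rw [← Real.exp_nat_mul]; ring_nf
  calc Real.exp (-(-1) * (ρ * n / 2)) * mgf (fun θ : Fin n → ℝ => ∑ i, θ i ^ 2) (signalLaw n ρ) (-1)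
      ≤ Real.exp (-(-1) * (ρ * n / 2)) * Real.exp (-(0.6 * ρ * n)) := by gcongr
    _ = _ := by rw [← Real.exp_add]; ring_nf

/-! ### Errors of the cloning test -/

/-- The cloning test for `M` matrices of size `n`. -/
noncomputable def cloneTest (n M : ℕ) (a τ : ℝ) : CloneTest where
  M := M
  m := n * n
  a := a
  b := √(1 - a ^ 2)
  τ := τ
  sd e := if h : e < n * n then
    if (finProdFinEquiv.symm ⟨e, h⟩ : Fin n × Fin n).1 =
      (finProdFinEquiv.symm ⟨e, h⟩ : Fin n × Fin n).2 then √2 else 1 else 0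
  pos e := if h : e < n * n then
    (finProdFinEquiv (min (finProdFinEquiv.symm ⟨e, h⟩ : Fin n × Fin n).1
        (finProdFinEquiv.symm ⟨e, h⟩ : Fin n × Fin n).2,
      max (finProdFinEquiv.symm ⟨e, h⟩ : Fin n × Fin n).1
        (finProdFinEquiv.symm ⟨e, h⟩ : Fin n × Fin n).2) : Fin (n * n)) else 0

/-- The auxiliary noise matrix for sample `j`. -/
noncomputable def auxNoise (n j : ℕ) (ω : ℕ → ℝ) (e : Fin n × Fin n) : ℝ :=
  (if e.1 = e.2 then √2 else 1) *
    ω (j * (n * n) + (finProdFinEquiv (min e.1 e.2, max e.1 e.2) : Fin (n * n)))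

lemma cloneTest_noise (n M : ℕ) (a τ : ℝ) (ω : ℕ → ℝ) (j : ℕ) (e : Fin n × Fin n) :
    (cloneTest n M a τ).noise ω j (finProdFinEquiv e : Fin (n * n)) = auxNoise n j ω e := by
  have h : ((finProdFinEquiv e : Fin (n * n)) : ℕ) < n * n := Fin.is_lt _
  simp only [CloneTest.noise, cloneTest, auxNoise, dif_pos h, Fin.eta, Equiv.symm_apply_apply]

lemma start_flatten {n M : ℕ} (y : Fin M → Fin n × Fin n → ℝ) (j : Fin M) (e : Fin n × Fin n) :
    (RProgram.start (flatten y)).mem (j * (n * n) + (finProdFinEquiv e : Fin (n * n))) =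
      y j e := by
  have key : ((finProdFinEquiv (j, (finProdFinEquiv e : Fin (n * n))) : Fin (M * (n * n))) : ℕ) =
      j * (n * n) + (finProdFinEquiv e : Fin (n * n)) := by
    rw [finProdFinEquiv_apply_val (j, (finProdFinEquiv e : Fin (n * n)))]
    ring
  rw [← key]
  generalize hq : (finProdFinEquiv (j, (finProdFinEquiv e : Fin (n * n))) : Fin (M * (n * n))) = q
  simp only [RProgram.start, dif_pos q.is_lt, Fin.eta, flatten]
  rw [← hq, Equiv.symm_apply_apply, Equiv.symm_apply_apply]

lemma val_cloneTest_pos_iff {n M : ℕ} (A : RProgram) (a τ : ℝ) (y : Fin M → Fin n × Fin n → ℝ)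
    (ω : ℕ → ℝ) (j : Fin M) :
    0 < (cloneTest n M a τ).val A ω (RProgram.start (flatten y)).mem j ↔
      Pass A a τ (y j) (auxNoise n j ω) ((cloneTest n M a τ).tape ω j) := by
  set K := cloneTest n M a τ with hK
  set inp := (RProgram.start (flatten y)).mem with hinp
  have hm : K.m = n * n := rfl
  have hinp' : ∀ e : Fin n × Fin n,
      inp (j * (n * n) + (finProdFinEquiv e : Fin (n * n))) = y j e := start_flatten y j
  have hnoise := cloneTest_noise n M a τ ω j
  have hfst : ∀ e : Fin n × Fin n, K.fst ω inp j (finProdFinEquiv e : Fin (n * n)) =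
      (a • y j + √(1 - a ^ 2) • auxNoise n j ω) e := by
    intro e
    rw [CloneTest.fst, hnoise, hm, hinp']
    rfl
  have hfst' : ∀ i : Fin (n * n), K.fst ω inp j i =
      (a • y j + √(1 - a ^ 2) • auxNoise n j ω) (finProdFinEquiv.symm i) := by
    intro i
    have := hfst (finProdFinEquiv.symm i)
    rwa [Equiv.apply_symm_apply] at this
  have hsnd : ∀ e : Fin n × Fin n, K.snd ω inp j (finProdFinEquiv e : Fin (n * n)) =
      (√(1 - a ^ 2) • y j - a • auxNoise n j ω) e := by
    intro e
    rw [CloneTest.snd, hnoise, hm, hinp']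
    rfl
  have hout : ∀ e : Fin n × Fin n, K.out A ω inp j (finProdFinEquiv e : Fin (n * n)) =
      A.estimate (K.tape ω j) (a • y j + √(1 - a ^ 2) • auxNoise n j ω) e := by
    intro e
    rw [CloneTest.out, RProgram.estimate]
    congr 1
    funext i
    exact hfst' i
  have hsum : ∀ f : ℕ → ℝ, ∑ e ∈ Finset.range K.m, f e =
      ∑ e : Fin n × Fin n, f (finProdFinEquiv e : Fin (n * n)) := by
    intro f
    rw [hm, ← Fin.sum_univ_eq_sum_range]
    exact (Equiv.sum_comp finProdFinEquiv fun i : Fin (n * n) => f i).symm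
  rw [CloneTest.val, Real.sqrt_pos, sub_pos, hsum, hsum, Pass]
  simp only [hout, hsnd, ← pow_two]
  rfl

/-- Auxiliary noise uses tape positions below `M * (n * n)`, the simulated copies only later ones.
Independence between different `j` is never needed: the errors use one sample at a time or a union
bound. -/
lemma map_auxNoise_tape {n M : ℕ} (a τ : ℝ) (j : Fin M) :
    tapeLaw.map (fun ω => (auxNoise n j ω, (cloneTest n M a τ).tape ω j)) =
      (noiseLaw n).prod tapeLaw := by
  have hM : 0 < M := j.pos
  refine map_tapeLaw (fun e => j * (n * n) + (finProdFinEquiv e : Fin (n * n)))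
    (fun v => M * v + (M * (n * n) + 6 + j)) ?_ ?_ ?_
  · intro e e' h
    simp only [Nat.add_left_cancel_iff] at h
    exact finProdFinEquiv.injective (Fin.ext h)
  · intro v v' h
    exact Nat.eq_of_mul_eq_mul_left hM (Nat.add_right_cancel h)
  · intro e v
    have h1 : ((finProdFinEquiv e : Fin (n * n)) : ℕ) < n * n := Fin.is_lt _
    have h2 : (j : ℕ) * (n * n) + n * n ≤ M * (n * n) := by
      rw [← Nat.succ_mul]; exact Nat.mul_le_mul_right _ j.2
    omega

lemma measurable_auxNoise (n j : ℕ) : Measurable (auxNoise n j) := by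
  unfold auxNoise
  fun_prop

lemma measurable_tape (K : CloneTest) (j : ℕ) : Measurable fun ω => K.tape ω j := by
  unfold CloneTest.tape
  fun_prop

lemma measurable_flatten {M n : ℕ} : Measurable (flatten : (Fin M → Fin n × Fin n → ℝ) → _) := by
  unfold flatten
  fun_prop

section Errors

variable {n M : ℕ} {A : RProgram} {t a τ : ℝ}

/-- The event that sample `j` passes. -/
def passEvent (n M : ℕ) (A : RProgram) (a τ : ℝ) (j : Fin M) :
    Set ((Fin M → Fin n × Fin n → ℝ) × (ℕ → ℝ)) :=
  {z | Pass A a τ (z.1 j) (auxNoise n j z.2) ((cloneTest n M a τ).tape z.2 j)}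

lemma accepts_cloneTest_iff (hA : A.RunsWithin (n * n) t) (y : Fin M → Fin n × Fin n → ℝ)
    (ω : ℕ → ℝ) :
    ((cloneTest n M a τ).program A).Accepts ω (flatten y) ↔ ∃ j, (y, ω) ∈ passEvent n M A a τ j := by
  have hT : ∀ (x : Fin (n * n) → ℝ) (ω : ℕ → ℝ), ∃ u ≤ ⌊t⌋₊, A.HaltsAt ω x u := by
    intro x ω
    obtain ⟨u, hu, h⟩ := hA.2 x ω
    exact ⟨u, Nat.le_floor hu, h⟩
  refine (CloneTest.accepts_program_iff (K := cloneTest n M a τ) (T := ⌊t⌋₊) hT (flatten y)).trans ?_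
  constructor
  · rintro ⟨j, hj, h⟩
    exact ⟨⟨j, hj⟩, (val_cloneTest_pos_iff A a τ y ω ⟨j, hj⟩).1 h⟩
  · rintro ⟨j, h⟩
    exact ⟨j, j.2, (val_cloneTest_pos_iff A a τ y ω j).2 h⟩

/-- The law of the data used for the test of sample `j`. -/
lemma measure_passEvent (hA : A.RunsWithin (n * n) t) (j : Fin M)
    (μ : Fin M → Measure (Fin n × Fin n → ℝ)) [∀ i, IsProbabilityMeasure (μ i)] :
    ((Measure.pi μ).prod tapeLaw) (passEvent n M A a τ j) =
        ((μ j).prod ((noiseLaw n).prod tapeLaw)) {p | Pass A a τ p.1 p.2.1 p.2.2} ∧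
    ((Measure.pi μ).prod tapeLaw) (passEvent n M A a τ j)ᶜ =
        ((μ j).prod ((noiseLaw n).prod tapeLaw)) {p | ¬ Pass A a τ p.1 p.2.1 p.2.2} := by
  have hp : MeasurePreserving (fun ω => (auxNoise n j ω, (cloneTest n M a τ).tape ω j)) tapeLaw
      ((noiseLaw n).prod tapeLaw) :=
    ⟨(measurable_auxNoise n j).prodMk (measurable_tape _ j), map_auxNoise_tape a τ j⟩
  have h := (measurePreserving_eval μ j).prod hp
  exact ⟨h.measure_preimage (measurableSet_pass hA a τ).nullMeasurableSet,
    h.measure_preimage (measurableSet_pass hA a τ).compl.nullMeasurableSet⟩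

lemma measurableSet_accepts (hA : A.RunsWithin (n * n) t) :
    MeasurableSet {z : (Fin (M * (n * n)) → ℝ) × (ℕ → ℝ) |
      ((cloneTest n M a τ).program A).Accepts z.2 z.1} := by
  refine measurableSet_lt measurable_const ?_
  exact measurable_finalMem (fun v => by fun_prop) (fun i => by fun_prop)
    (CloneTest.runsWithin_program (K := cloneTest n M a τ) hA) 0

lemma prod_map_flatten (μ : Measure (Fin M → Fin n × Fin n → ℝ)) [IsFiniteMeasure μ] :
    (μ.map flatten).prod tapeLaw = (μ.prod tapeLaw).map (Prod.map flatten id) := by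
  have h := Measure.map_prod_map μ tapeLaw (measurable_flatten (M := M) (n := n)) measurable_id
  rwa [Measure.map_id] at h

/-- Type-I error of the test. -/
lemma null_error_le (hA : A.RunsWithin (n * n) t) (ha₀ : 0 ≤ a) (ha₁ : a ≤ 1) (hτ : 0 ≤ τ) :
    ((hiddenNull M (noiseLaw n)).prod tapeLaw).real
        {z | ((cloneTest n M a τ).program A).Accepts z.2 z.1} ≤ M * Real.exp (-τ ^ 2 / 8) := by
  rw [hiddenNull, prod_map_flatten, map_measureReal_apply (measurable_flatten.prodMap measurable_id)
    (measurableSet_accepts hA)]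
  have hset : Prod.map flatten id ⁻¹' {z : (Fin (M * (n * n)) → ℝ) × (ℕ → ℝ) |
      ((cloneTest n M a τ).program A).Accepts z.2 z.1} = ⋃ j, passEvent n M A a τ j := by
    ext z
    simp only [Set.mem_preimage, Set.mem_iUnion]
    exact accepts_cloneTest_iff hA z.1 z.2
  rw [hset]
  refine (measureReal_iUnion_fintype_le _).trans ?_
  calc _ ≤ ∑ _j : Fin M, Real.exp (-τ ^ 2 / 8) := by
        refine Finset.sum_le_sum fun j _ => ?_
        rw [measureReal_def, (measure_passEvent hA j fun _ => noiseLaw n).1, ← measureReal_def]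
        exact null_pass_le hA ha₀ ha₁ hτ
    _ = _ := by simp

/-- Type-II error of the test. -/
lemma planted_error_le {P : Measure (Fin n × Fin n → ℝ)} [IsProbabilityMeasure P] {δ : ℝ}
    (hM : 0 < M) (hA : A.RunsWithin (n * n) t)
    (hδ : (P.prod ((noiseLaw n).prod tapeLaw)).real {p | ¬ Pass A a τ p.1 p.2.1 p.2.2} ≤ δ) :
    ((hiddenPlanted M P (noiseLaw n)).prod tapeLaw).real
        {z | ¬ ((cloneTest n M a τ).program A).Accepts z.2 z.1} ≤ δ := by
  have hδ0 : 0 ≤ δ := measureReal_nonneg.trans hδ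
  have hMtop : (M : ℝ≥0∞)⁻¹ ≠ ∞ := by simp [hM.ne']
  have hprob : ∀ κ j : Fin M, IsProbabilityMeasure (if j = κ then P else noiseLaw n) := by
    intro κ j
    split_ifs <;> infer_instance
  have hfin : ∀ κ : Fin M, IsFiniteMeasure ((M : ℝ≥0∞)⁻¹ •
      Measure.pi fun j : Fin M => if j = κ then P else noiseLaw n) := fun κ =>
    Measure.smul_finite _ hMtop
  have hS := (measurableSet_accepts (M := M) (a := a) (τ := τ) hA).compl
  rw [hiddenPlanted, prod_map_flatten]
  change (Measure.map _ _).real {z : (Fin (M * (n * n)) → ℝ) × (ℕ → ℝ) |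
      ((cloneTest n M a τ).program A).Accepts z.2 z.1}ᶜ ≤ δ
  rw [map_measureReal_apply (measurable_flatten.prodMap measurable_id) hS, measureReal_def]
  refine ENNReal.toReal_le_of_le_ofReal hδ0 ?_
  have hS' := (measurable_flatten.prodMap measurable_id) hS
  rw [Measure.prod_apply hS', lintegral_finsetSum_measure]
  have hκ : ∀ κ : Fin M, ∫⁻ x, tapeLaw (Prod.mk x ⁻¹' (Prod.map flatten id ⁻¹'
      {z : (Fin (M * (n * n)) → ℝ) × (ℕ → ℝ) |
        ((cloneTest n M a τ).program A).Accepts z.2 z.1}ᶜ))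
      ∂((M : ℝ≥0∞)⁻¹ • Measure.pi fun j : Fin M => if j = κ then P else noiseLaw n) ≤
      (M : ℝ≥0∞)⁻¹ * ENNReal.ofReal δ := by
    intro κ
    rw [lintegral_smul_measure, ← Measure.prod_apply hS', smul_eq_mul]
    gcongr
    -- If the test rejects, then in particular the planted sample `κ` has failed; the other samples
    -- can only help.
    have hsub : Prod.map flatten id ⁻¹' {z : (Fin (M * (n * n)) → ℝ) × (ℕ → ℝ) |
        ((cloneTest n M a τ).program A).Accepts z.2 z.1}ᶜ ⊆ (passEvent n M A a τ κ)ᶜ := by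
      intro z hz hp
      exact hz ((accepts_cloneTest_iff hA z.1 z.2).2 ⟨κ, hp⟩)
    refine (measure_mono hsub).trans ?_
    rw [(measure_passEvent hA κ fun j => if j = κ then P else noiseLaw n).2, if_pos rfl,
      ← ofReal_measureReal]
    exact ENNReal.ofReal_le_ofReal hδ
  refine (Finset.sum_le_sum fun κ _ => hκ κ).trans (le_of_eq ?_)
  rw [Finset.sum_const, Finset.card_univ, Fintype.card_fin, nsmul_eq_mul, ← mul_assoc,
    ENNReal.mul_inv_cancel (by simp [hM.ne']) (by simp), one_mul]

end Errors

/-! ### Hermite polynomials and the standard Gaussian -/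

section Hermite

open Polynomial in
lemma integrable_eval_gaussianReal (p : ℝ[X]) :
    Integrable (fun x => p.eval x) (gaussianReal 0 1) := by
  have hpow : ∀ k : ℕ, Integrable (fun x : ℝ => x ^ k) (gaussianReal 0 1) := by
    intro k
    have h := (memLp_id_gaussianReal' (μ := 0) (v := 1) (k : ℝ≥0∞) (by simp)).integrable_norm_pow'
    refine (integrable_norm_iff (by fun_prop)).1 (h.congr (ae_of_all _ fun x => ?_))
    simp
  simp only [Polynomial.eval_eq_sum_range]
  exact integrable_finsetSum _ fun k _ => (hpow k).const_mul _

lemma integrable_smul_gaussianPDFReal {f : ℝ → ℝ} (hf : Integrable f (gaussianReal 0 1)) :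
    Integrable fun x => f x * gaussianPDFReal 0 1 x := by
  rw [gaussianReal_of_var_ne_zero 0 one_ne_zero,
    integrable_withDensity_iff_integrable_smul' (measurable_gaussianPDF 0 1)
      (ae_of_all _ fun x => gaussianPDF_lt_top)] at hf
  refine hf.congr (ae_of_all _ fun x => ?_)
  simp [toReal_gaussianPDF, mul_comm]

open Polynomial in
/-- Gaussian integration by parts. -/
lemma integral_mul_eval_gaussianReal (p : ℝ[X]) :
    ∫ x, x * p.eval x ∂(gaussianReal 0 1) = ∫ x, (derivative p).eval x ∂(gaussianReal 0 1) := by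
  have hd : ∀ x, HasDerivAt (gaussianPDFReal 0 1) (-(x * gaussianPDFReal 0 1 x)) x := by
    intro x
    unfold gaussianPDFReal
    have h1 : HasDerivAt (fun x : ℝ => -(x - 0) ^ 2 / (2 * ((1 : NNReal) : ℝ))) (-x) x := by
      have := (((hasDerivAt_id x).sub_const 0).pow 2).neg.div_const (2 * ((1 : NNReal) : ℝ))
      refine this.congr_deriv ?_
      simp only [id_eq, NNReal.coe_one]
      norm_num
      ring
    refine (h1.exp.const_mul (√(2 * Real.pi * ((1 : NNReal) : ℝ)))⁻¹).congr_deriv ?_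
    ring
  have hXp := integrable_smul_gaussianPDFReal (integrable_eval_gaussianReal (X * p))
  have hp := integrable_smul_gaussianPDFReal (integrable_eval_gaussianReal p)
  have hp' := integrable_smul_gaussianPDFReal (integrable_eval_gaussianReal (derivative p))
  have h := integral_mul_deriv_eq_deriv_mul_of_integrable (u := fun x => p.eval x)
    (u' := fun x => (derivative p).eval x) (v := gaussianPDFReal 0 1)
    (v' := fun x => -(x * gaussianPDFReal 0 1 x)) (fun x _ => p.hasDerivAt x) (fun x _ => hd x)
    (by
      refine hXp.neg.congr (ae_of_all _ fun x => ?_)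
      simp only [Pi.neg_apply, Pi.mul_apply, eval_mul, eval_X]
      ring) hp' hp
  rw [integral_gaussianReal_eq_integral_smul one_ne_zero,
    integral_gaussianReal_eq_integral_smul one_ne_zero]
  simp only [smul_eq_mul]
  have h2 : ∫ x, gaussianPDFReal 0 1 x * (x * p.eval x) =
      -∫ x, p.eval x * -(x * gaussianPDFReal 0 1 x) := by
    rw [← integral_neg]
    congr 1
    ext x
    ring
  rw [h2, h, neg_neg]
  congr 1
  ext x
  ring

/-- Hermite polynomials with real coefficients. -/
noncomputable def hermiteReal (k : ℕ) : Polynomial ℝ :=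
  (Polynomial.hermite k).map (Int.castRingHom ℝ)

open Polynomial in
lemma hermiteReal_succ (k : ℕ) :
    hermiteReal (k + 1) = X * hermiteReal k - derivative (hermiteReal k) := by
  simp [hermiteReal, hermite_succ, derivative_map]

-- The recursion `He_{k+1} = X He_k - He_k'` and Gaussian integration by parts move one derivative
-- onto `p`; iterating moves all `k`. Orthogonality, and the vanishing against polynomials of degree
-- below `k`, follow at once.
open Polynomial in
lemma integral_mul_hermiteReal (p : ℝ[X]) (k : ℕ) :
    ∫ x, (p * hermiteReal k).eval x ∂(gaussianReal 0 1) =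
      ∫ x, (derivative^[k] p).eval x ∂(gaussianReal 0 1) := by
  induction k generalizing p with
  | zero => simp [hermiteReal]
  | succ k ih =>
    rw [Function.iterate_succ_apply, ← ih (derivative p)]
    have e : ∀ x, (p * hermiteReal (k + 1)).eval x =
        x * (p * hermiteReal k).eval x - (p * derivative (hermiteReal k)).eval x := by
      intro x
      rw [hermiteReal_succ]
      simp only [eval_mul, eval_sub, eval_X]
      ring
    simp only [e]
    have hi : Integrable (fun x => x * (p * hermiteReal k).eval x) (gaussianReal 0 1) := by
      refine (integrable_eval_gaussianReal (X * (p * hermiteReal k))).congr (ae_of_all _ fun x => ?_)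
      simp
    rw [integral_sub hi (integrable_eval_gaussianReal _), integral_mul_eval_gaussianReal,
      ← integral_sub (integrable_eval_gaussianReal _) (integrable_eval_gaussianReal _)]
    congr 1
    ext x
    rw [derivative_mul]
    simp

open Polynomial in
lemma integral_hermiteReal_mul (k l : ℕ) :
    ∫ x, (hermiteReal k * hermiteReal l).eval x ∂(gaussianReal 0 1) =
      if k = l then (k.factorial : ℝ) else 0 := by
  have hdeg : ∀ k, (hermiteReal k).natDegree = k := fun k => by
    rw [hermiteReal, (hermite_monic k).natDegree_map, natDegree_hermite]
  have hlt : ∀ k l, k < l → ∫ x, (hermiteReal k * hermiteReal l).eval x ∂(gaussianReal 0 1) = 0 := by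
    intro k l h
    rw [integral_mul_hermiteReal, iterate_derivative_eq_zero (by rwa [hdeg])]
    simp
  rcases lt_trichotomy k l with h | h | h
  · rw [hlt k l h, if_neg h.ne]
  · subst h
    rw [integral_mul_hermiteReal, if_pos rfl]
    have hc : derivative^[k] (hermiteReal k) = C (k.factorial : ℝ) := by
      have h0 : (derivative^[k] (hermiteReal k)).natDegree = 0 := by
        have := natDegree_iterate_derivative (hermiteReal k) k
        rw [hdeg, Nat.sub_self] at this
        omega
      rw [eq_C_of_natDegree_eq_zero h0, coeff_iterate_derivative]
      have hm : (hermiteReal k).coeff k = 1 := by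
        rw [hermiteReal, coeff_map, coeff_hermite_self]
        simp
      simp [hm, Nat.descFactorial_self]
    simp [hc]
  · rw [mul_comm, hlt l k h, if_neg h.ne']

open Polynomial in
/-- Moments of a shifted Gaussian through Hermite coefficients. -/
lemma integral_add_pow_gaussianReal (u : ℝ) (b D : ℕ) (hb : b ≤ D) :
    ∫ x, (x + u) ^ b ∂(gaussianReal 0 1) = ∑ a ∈ Finset.range (D + 1),
      u ^ a / a.factorial * ∫ x, (X ^ b * hermiteReal a).eval x ∂(gaussianReal 0 1) := by
  -- The terms beyond `b` vanish, so the sum may run up to a bound `D` common to all coordinates, as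
  -- the multivariate product requires.
  have hz : ∀ a, b < a → ∫ x, (X ^ b * hermiteReal a).eval x ∂(gaussianReal 0 1) = 0 := by
    intro a ha
    rw [integral_mul_hermiteReal, iterate_derivative_eq_zero (by simpa using ha)]
    simp
  have hsub : Finset.range (b + 1) ⊆ Finset.range (D + 1) := Finset.range_mono (by omega)
  rw [← Finset.sum_subset hsub fun a _ ha => by
    rw [hz a (by simpa [Nat.lt_succ_iff] using ha), mul_zero]]
  have hi : ∀ k : ℕ, Integrable (fun x : ℝ => x ^ k) (gaussianReal 0 1) := fun k => by
    simpa using integrable_eval_gaussianReal (X ^ k)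
  have e : ∀ x : ℝ, (x + u) ^ b =
      ∑ a ∈ Finset.range (b + 1), u ^ a * x ^ (b - a) * (b.choose a : ℝ) := by
    intro x
    rw [add_comm, add_pow]
  simp only [e]
  rw [integral_finsetSum _ fun a _ => ((hi _).const_mul _).mul_const _]
  refine Finset.sum_congr rfl fun a _ => ?_
  rw [integral_mul_hermiteReal, iterate_derivative_X_pow_eq_natCast_mul, integral_mul_const,
    integral_const_mul]
  simp only [eval_mul, eval_natCast, eval_pow, eval_X]
  rw [integral_const_mul, Nat.descFactorial_eq_factorial_mul_choose]
  have : (a.factorial : ℝ) ≠ 0 := by exact_mod_cast a.factorial_ne_zero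
  push_cast
  field_simp

end Hermite

/-! ### Low-degree projection of a Gaussian mixture -/

section LowDegree

variable {ι : Type*} [Fintype ι]

/-- The standard Gaussian measure. -/
noncomputable abbrev stdGaussianPi (ι : Type*) [Fintype ι] : Measure (ι → ℝ) :=
  Measure.pi fun _ => gaussianReal 0 1

lemma integrable_prod_eval (p : ι → Polynomial ℝ) :
    Integrable (fun x : ι → ℝ => ∏ i, (p i).eval (x i)) (stdGaussianPi ι) :=
  Integrable.fintype_prod (f := fun i x => (p i).eval x) fun i => integrable_eval_gaussianReal (p i)

lemma integrable_mvEval_add (f : MvPolynomial ι ℝ) (u : ι → ℝ) :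
    Integrable (fun x => MvPolynomial.eval (x + u) f) (stdGaussianPi ι) := by
  simp only [MvPolynomial.eval_eq']
  refine integrable_finsetSum _ fun d _ => Integrable.const_mul ?_ _
  have := integrable_prod_eval fun i => (Polynomial.X + Polynomial.C (u i)) ^ d i
  simpa only [Polynomial.eval_pow, Polynomial.eval_add, Polynomial.eval_X, Polynomial.eval_C,
    Pi.add_apply] using this

lemma integrable_mvEval (f : MvPolynomial ι ℝ) :
    Integrable (fun x => MvPolynomial.eval x f) (stdGaussianPi ι) := by
  simpa using integrable_mvEval_add f 0

/-- Products of Hermite polynomials. -/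
noncomputable def mvHermite (α : ι → ℕ) : MvPolynomial ι ℝ :=
  ∏ i, Polynomial.aeval (MvPolynomial.X i) (hermiteReal (α i))

lemma eval_mvHermite (α : ι → ℕ) (x : ι → ℝ) :
    MvPolynomial.eval x (mvHermite α) = ∏ i, (hermiteReal (α i)).eval (x i) := by
  rw [mvHermite, map_prod]
  refine Finset.prod_congr rfl fun i _ => ?_
  rw [Polynomial.aeval_def, Polynomial.hom_eval₂, MvPolynomial.eval_X, Polynomial.eval]
  congr 1
  ext
  simp

lemma integral_mvHermite_mul (α β : ι → ℕ) :
    ∫ x, MvPolynomial.eval x (mvHermite α * mvHermite β) ∂(stdGaussianPi ι) =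
      if α = β then ∏ i, ((α i).factorial : ℝ) else 0 := by
  classical
  have e : ∀ x : ι → ℝ, MvPolynomial.eval x (mvHermite α * mvHermite β) =
      ∏ i, (hermiteReal (α i) * hermiteReal (β i)).eval (x i) := by
    intro x
    rw [map_mul, eval_mvHermite, eval_mvHermite, ← Finset.prod_mul_distrib]
    simp
  simp only [e]
  rw [integral_fintype_prod_eq_prod (μ := fun _ => gaussianReal 0 1)
    (f := fun i x => (hermiteReal (α i) * hermiteReal (β i)).eval x)]
  simp only [integral_hermiteReal_mul]
  split_ifs with h
  · subst h; simp
  · obtain ⟨i, hi⟩ := Function.ne_iff.1 h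
    exact Finset.prod_eq_zero (Finset.mem_univ i) (if_neg hi)

open Classical in
/-- Multi-indices of degree at most `D`. -/
noncomputable def multiIndices (ι : Type*) [Fintype ι] (D : ℕ) : Finset (ι → ℕ) :=
  (Fintype.piFinset fun _ : ι => Finset.range (D + 1)).filter fun α => ∑ i, α i ≤ D

/-- Multiply the one-dimensional expansions over the coordinates. The product ranges over a box of
multi-indices, but one of degree above `D` exceeds `β` in some coordinate, where the Hermite
coefficient is zero. -/
lemma integral_monomial_add (u : ι → ℝ) (β : ι → ℕ) {D : ℕ} (hβ : ∑ i, β i ≤ D) :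
    ∫ x : ι → ℝ, ∏ i, (x i + u i) ^ β i ∂(stdGaussianPi ι) = ∑ α ∈ multiIndices ι D,
      (∏ i, u i ^ α i / (α i).factorial) *
        ∫ x : ι → ℝ, (∏ i, x i ^ β i) * MvPolynomial.eval x (mvHermite α) ∂(stdGaussianPi ι) := by
  classical
  have hle : ∀ i, β i ≤ D := fun i =>
    (Finset.single_le_sum (fun _ _ => Nat.zero_le _) (Finset.mem_univ i)).trans hβ
  set c : ℕ → ℕ → ℝ := fun b a =>
    ∫ x, (Polynomial.X ^ b * hermiteReal a).eval x ∂(gaussianReal 0 1) with hc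
  have hc0 : ∀ b a, b < a → c b a = 0 := by
    intro b a h
    simp only [hc]
    rw [integral_mul_hermiteReal, Polynomial.iterate_derivative_eq_zero (by simpa using h)]
    simp
  have hprod : ∀ α : ι → ℕ,
      ∫ x : ι → ℝ, (∏ i, x i ^ β i) * MvPolynomial.eval x (mvHermite α) ∂(stdGaussianPi ι) =
        ∏ i, c (β i) (α i) := by
    intro α
    have e : ∀ x : ι → ℝ, (∏ i, x i ^ β i) * MvPolynomial.eval x (mvHermite α) =
        ∏ i, (Polynomial.X ^ β i * hermiteReal (α i)).eval (x i) := by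
      intro x
      rw [eval_mvHermite, ← Finset.prod_mul_distrib]
      simp
    simp only [e]
    exact integral_fintype_prod_eq_prod (μ := fun _ => gaussianReal 0 1)
      (f := fun i x => (Polynomial.X ^ β i * hermiteReal (α i)).eval x)
  rw [integral_fintype_prod_eq_prod (μ := fun _ => gaussianReal 0 1) (f := fun i x => (x + u i) ^ β i)]
  simp only [hprod, ← Finset.prod_mul_distrib]
  calc ∏ i, ∫ x, (x + u i) ^ β i ∂(gaussianReal 0 1)
      = ∏ i, ∑ a ∈ Finset.range (D + 1), u i ^ a / a.factorial * c (β i) a :=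
        Finset.prod_congr rfl fun i _ => integral_add_pow_gaussianReal (u i) (β i) D (hle i)
    _ = ∑ α ∈ Fintype.piFinset fun _ : ι => Finset.range (D + 1),
        ∏ i, u i ^ α i / (α i).factorial * c (β i) (α i) := Finset.prod_univ_sum _ _
    _ = _ := by
      rw [multiIndices, Finset.sum_filter_of_ne]
      intro α _ hne
      by_contra hgt
      have : ∃ i, β i < α i := by
        by_contra hn
        push Not at hn
        exact hgt ((Finset.sum_le_sum fun i _ => hn i).trans hβ)
      obtain ⟨i, hi⟩ := this
      exact hne (Finset.prod_eq_zero (Finset.mem_univ i) (by rw [hc0 _ _ hi, mul_zero]))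

/-- The mean of a low-degree polynomial under a shifted Gaussian through Hermite coefficients. -/
lemma integral_mvEval_add (u : ι → ℝ) (f : MvPolynomial ι ℝ) {D : ℕ} (hf : f.totalDegree ≤ D) :
    ∫ x, MvPolynomial.eval (x + u) f ∂(stdGaussianPi ι) = ∑ α ∈ multiIndices ι D,
      (∏ i, u i ^ α i / (α i).factorial) *
        ∫ x, MvPolynomial.eval x (f * mvHermite α) ∂(stdGaussianPi ι) := by
  have hmon : ∀ d ∈ f.support, ∑ i, d i ≤ D := by
    intro d hd
    have := (MvPolynomial.le_totalDegree hd).trans hf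
    rwa [Finsupp.sum_fintype _ _ (fun _ => rfl)] at this
  have hi : ∀ (d : ι →₀ ℕ) α, Integrable (fun x : ι → ℝ =>
      MvPolynomial.coeff d f * ((∏ i, x i ^ d i) * MvPolynomial.eval x (mvHermite α)))
      (stdGaussianPi ι) := by
    intro d α
    refine Integrable.const_mul ?_ _
    refine (integrable_mvEval (MvPolynomial.monomial d 1 * mvHermite α)).congr
      (ae_of_all _ fun x => ?_)
    simp [MvPolynomial.eval_monomial, Finsupp.prod_fintype]
  have hi' : ∀ d : ι →₀ ℕ, Integrable (fun x : ι → ℝ => ∏ i, (x i + u i) ^ d i)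
      (stdGaussianPi ι) := by
    intro d
    have := integrable_prod_eval fun i => (Polynomial.X + Polynomial.C (u i)) ^ d i
    simpa only [Polynomial.eval_pow, Polynomial.eval_add, Polynomial.eval_X, Polynomial.eval_C]
      using this
  have e₁ : ∀ x : ι → ℝ, MvPolynomial.eval (x + u) f =
      ∑ d ∈ f.support, MvPolynomial.coeff d f * ∏ i, (x i + u i) ^ d i := fun x => by
    rw [MvPolynomial.eval_eq']; rfl
  have e₂ : ∀ (α) (x : ι → ℝ), MvPolynomial.eval x (f * mvHermite α) = ∑ d ∈ f.support,
      MvPolynomial.coeff d f * ((∏ i, x i ^ d i) * MvPolynomial.eval x (mvHermite α)) := by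
    intro α x
    rw [map_mul, MvPolynomial.eval_eq', Finset.sum_mul]
    simp only [mul_assoc]
  simp only [e₁, e₂]
  rw [integral_finsetSum _ fun d _ => (hi' d).const_mul _]
  simp only [integral_finsetSum _ fun d _ => hi d _, integral_const_mul]
  rw [Finset.sum_congr rfl fun d hd => by rw [integral_monomial_add u d (hmon d hd)]]
  simp only [Finset.mul_sum]
  rw [Finset.sum_comm]
  refine Finset.sum_congr rfl fun α _ => Finset.sum_congr rfl fun d _ => ?_
  ring

/-- The multinomial theorem, degree by degree. It collapses the squared Hermite coefficients of the
mixture into powers of an inner product. -/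
lemma sum_multiIndices (y : ι → ℝ) (D : ℕ) :
    ∑ α ∈ multiIndices ι D, ∏ i, y i ^ α i / (α i).factorial =
      ∑ m ∈ Finset.range (D + 1), (∑ i, y i) ^ m / m.factorial := by
  classical
  rw [← Finset.sum_fiberwise_of_maps_to (s := multiIndices ι D) (t := Finset.range (D + 1))
    (g := fun α => ∑ i, α i)]
  · refine Finset.sum_congr rfl fun m hm => ?_
    have hset : (multiIndices ι D).filter (fun α => ∑ i, α i = m) =
        Finset.piAntidiag Finset.univ m := by
      ext α
      simp only [multiIndices, Finset.mem_filter, Fintype.mem_piFinset, Finset.mem_range,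
        Finset.mem_piAntidiag, Finset.mem_univ, implies_true, and_true]
      simp only [Finset.mem_range] at hm
      constructor
      · exact fun h => h.2
      · intro h
        have h' : ∑ i, α i = m := h
        refine ⟨⟨fun i => ?_, by omega⟩, h⟩
        have : α i ≤ ∑ i, α i := Finset.single_le_sum (f := α) (fun _ _ => Nat.zero_le _) (Finset.mem_univ i)
        omega
    rw [hset, Finset.sum_pow_eq_sum_piAntidiag, Finset.sum_div]
    refine Finset.sum_congr rfl fun α hα => ?_
    have hsum : ∑ i, α i = m := (Finset.mem_piAntidiag.1 hα).1
    have hspec := Nat.multinomial_spec Finset.univ α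
    rw [hsum] at hspec
    have h1 : (∏ i, ((α i).factorial : ℝ)) ≠ 0 :=
      Finset.prod_ne_zero_iff.2 fun i _ => by exact_mod_cast (α i).factorial_ne_zero
    have h2 : (m.factorial : ℝ) ≠ 0 := by exact_mod_cast m.factorial_ne_zero
    have h3 : (∏ i, ((α i).factorial : ℝ)) * (Nat.multinomial Finset.univ α : ℝ) = m.factorial := by
      exact_mod_cast hspec
    rw [Finset.prod_div_distrib, div_eq_div_iff h1 h2, ← h3]
    ring
  · intro α hα
    simp only [multiIndices, Finset.mem_filter] at hα
    simp only [Finset.mem_range]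
    omega

/-- Low-degree polynomials cannot distinguish a mixture of shifted Gaussians from the standard
Gaussian better than the truncated exponential series of the overlap allows. -/
theorem sq_mixture_integral_le {Ω : Type*} [Fintype Ω] (p : Ω → ℝ)
    (u : Ω → ι → ℝ) (f : MvPolynomial ι ℝ) {D : ℕ} (hf : f.totalDegree ≤ D) :
    (∑ w, p w * ∫ x, MvPolynomial.eval (x + u w) f ∂(stdGaussianPi ι)) ^ 2 ≤
      (∫ x, MvPolynomial.eval x f ^ 2 ∂(stdGaussianPi ι)) *
        ∑ m ∈ Finset.range (D + 1), ∑ w, ∑ w', p w * p w' *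
          ((∑ i, u w i * u w' i) ^ m / m.factorial) := by
  classical
  set E : MvPolynomial ι ℝ → ℝ := fun g => ∫ x, MvPolynomial.eval x g ∂(stdGaussianPi ι) with hE
  set μ : (ι → ℕ) → ℝ := fun α => ∑ w, p w * ∏ i, u w i ^ α i / (α i).factorial with hμ
  -- This is the low-degree projection of the likelihood ratio: it represents the mixture mean of
  -- every polynomial of degree at most `D`. Completeness of the Hermite system is not needed.
  set L : MvPolynomial ι ℝ := ∑ α ∈ multiIndices ι D, MvPolynomial.C (μ α) * mvHermite α with hL
  have hadd : ∀ g h, E (g + h) = E g + E h := fun g h => by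
    simp only [hE, map_add]
    exact integral_add (integrable_mvEval g) (integrable_mvEval h)
  have hsm : ∀ (c : ℝ) g, E (MvPolynomial.C c * g) = c * E g := fun c g => by
    simp only [hE, map_mul, MvPolynomial.eval_C, integral_const_mul]
  have hsum : ∀ (s : Finset (ι → ℕ)) (g : (ι → ℕ) → MvPolynomial ι ℝ),
      E (∑ α ∈ s, g α) = ∑ α ∈ s, E (g α) := fun s g => by
    simp only [hE, map_sum]
    exact integral_finsetSum _ fun α _ => integrable_mvEval (g α)
  have hB : ∑ w, p w * ∫ x, MvPolynomial.eval (x + u w) f ∂(stdGaussianPi ι) = E (f * L) := by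
    have e : f * L = ∑ α ∈ multiIndices ι D, MvPolynomial.C (μ α) * (f * mvHermite α) := by
      rw [hL, Finset.mul_sum]
      exact Finset.sum_congr rfl fun α _ => by ring
    rw [e, hsum]
    simp only [hsm, integral_mvEval_add _ f hf, Finset.mul_sum]
    rw [Finset.sum_comm]
    refine Finset.sum_congr rfl fun α _ => ?_
    rw [hμ, Finset.sum_mul]
    exact Finset.sum_congr rfl fun w _ => by ring
  have hC : E (L * L) = ∑ m ∈ Finset.range (D + 1), ∑ w, ∑ w', p w * p w' *
          ((∑ i, u w i * u w' i) ^ m / m.factorial) := by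
    have e : L * L = ∑ α ∈ multiIndices ι D, ∑ β ∈ multiIndices ι D,
        MvPolynomial.C (μ α * μ β) * (mvHermite α * mvHermite β) := by
      rw [hL, Finset.sum_mul_sum]
      refine Finset.sum_congr rfl fun α _ => Finset.sum_congr rfl fun β _ => ?_
      rw [map_mul]; ring
    rw [e, hsum]
    simp only [hsum, hsm]
    have h1 : ∀ α ∈ multiIndices ι D, ∑ β ∈ multiIndices ι D,
        μ α * μ β * E (mvHermite α * mvHermite β) = ∑ w, ∑ w', p w * p w' *
          ∏ i, (u w i * u w' i) ^ α i / (α i).factorial := by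
      intro α hα
      rw [Finset.sum_eq_single α]
      · simp only [hE]
        rw [integral_mvHermite_mul, if_pos rfl, hμ, Finset.sum_mul_sum, Finset.sum_mul]
        refine Finset.sum_congr rfl fun w _ => ?_
        rw [Finset.sum_mul]
        refine Finset.sum_congr rfl fun w' _ => ?_
        have : ∏ i, (u w i * u w' i) ^ α i / ((α i).factorial : ℝ) =
            (∏ i, u w i ^ α i / ((α i).factorial : ℝ)) * (∏ i, u w' i ^ α i / ((α i).factorial : ℝ)) *
              ∏ i, ((α i).factorial : ℝ) := by
          rw [← Finset.prod_mul_distrib, ← Finset.prod_mul_distrib]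
          refine Finset.prod_congr rfl fun i _ => ?_
          have : ((α i).factorial : ℝ) ≠ 0 := by exact_mod_cast (α i).factorial_ne_zero
          field_simp
          rw [mul_pow]
        rw [this]
        ring
      · intro β _ hne
        simp only [hE]
        rw [integral_mvHermite_mul, if_neg hne.symm, mul_zero]
      · exact fun h => absurd hα h
    rw [Finset.sum_congr rfl h1, Finset.sum_comm, Finset.sum_comm (s := Finset.range (D + 1))]
    refine Finset.sum_congr rfl fun w _ => ?_
    rw [Finset.sum_comm, Finset.sum_comm (s := Finset.range (D + 1))]
    refine Finset.sum_congr rfl fun w' _ => ?_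
    rw [← Finset.mul_sum, ← Finset.mul_sum, sum_multiIndices]
  have hA : ∫ x, MvPolynomial.eval x f ^ 2 ∂(stdGaussianPi ι) = E (f * f) := by
    simp only [hE, map_mul, pow_two]
  rw [hB, hA, ← hC]
  -- Cauchy–Schwarz for `f` and `L`, through the discriminant of `t ↦ E((f - tL)²)`.
  have hquad : ∀ t : ℝ, 0 ≤ E (L * L) * (t * t) + (-2 * E (f * L)) * t + E (f * f) := by
    intro t
    have e : (f - MvPolynomial.C t * L) * (f - MvPolynomial.C t * L) =
        MvPolynomial.C (t * t) * (L * L) + (MvPolynomial.C (-2 * t) * (f * L) + f * f) := by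
      simp only [map_mul, map_neg, map_ofNat]
      ring
    have h0 : 0 ≤ E ((f - MvPolynomial.C t * L) * (f - MvPolynomial.C t * L)) := by
      simp only [hE, map_mul]
      exact integral_nonneg fun x => mul_self_nonneg _
    rw [e, hadd, hadd, hsm, hsm] at h0
    linarith
  have := discrim_le_zero hquad
  rw [discrim] at this
  nlinarith

end LowDegree

/-! ### The planted model as a finite mixture of shifted Gaussians -/

section Mixture

variable {n M : ℕ}

/-- Probability of a binary vector under i.i.d. Bernoulli entries. -/
noncomputable def bitWeight (ρ : ℝ) (θ : Fin n → Bool) : ℝ := ∏ i, if θ i then ρ else 1 - ρ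

/-- A binary vector as a real vector. -/
def bitVec (θ : Fin n → Bool) (i : Fin n) : ℝ := if θ i then 1 else 0

lemma bitWeight_nonneg {ρ : ℝ} (h₀ : 0 ≤ ρ) (h₁ : ρ ≤ 1) (θ : Fin n → Bool) :
    0 ≤ bitWeight ρ θ :=
  Finset.prod_nonneg fun i _ => by split_ifs <;> linarith

lemma sum_prod_bool {R : Type*} [CommSemiring R] (f : Fin n → Bool → R) :
    ∑ θ : Fin n → Bool, ∏ i, f i (θ i) = ∏ i, (f i true + f i false) := by
  have h := Finset.prod_univ_sum (fun _ : Fin n => (Finset.univ : Finset Bool)) f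
  rw [Fintype.piFinset_univ] at h
  rw [← h]
  exact Finset.prod_congr rfl fun i _ => Fintype.sum_bool (f i)

lemma sum_bitWeight (ρ : ℝ) : ∑ θ : Fin n → Bool, bitWeight ρ θ = 1 := by
  unfold bitWeight
  rw [sum_prod_bool fun _ b => if b then ρ else 1 - ρ]
  simp

/-- The signal takes finitely many values, so the planted law is a finite mixture of shifted
Gaussians and the low-degree bound needs only finite sums. -/
lemma signalLaw_eq_sum {ρ : ℝ} (h₀ : 0 ≤ ρ) (h₁ : ρ ≤ 1) :
    signalLaw n ρ = ∑ θ : Fin n → Bool,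
      ENNReal.ofReal (bitWeight ρ θ) • Measure.dirac (bitVec θ) := by
  have := isProbabilityMeasure_berLaw h₀ h₁
  refine Measure.pi_eq fun s hs => ?_
  have hw : ∀ θ : Fin n → Bool, ENNReal.ofReal (bitWeight ρ θ) =
      ∏ i, ENNReal.ofReal (if θ i then ρ else 1 - ρ) := fun θ =>
    ENNReal.ofReal_prod_of_nonneg fun i _ => by split_ifs <;> linarith
  have hd : ∀ θ : Fin n → Bool, Measure.dirac (bitVec θ) (Set.univ.pi s) =
      ∏ i, (s i).indicator (1 : ℝ → ℝ≥0∞) (if θ i then 1 else 0) := by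
    intro θ
    rw [Measure.dirac_apply' _ (MeasurableSet.univ_pi hs)]
    by_cases h : bitVec θ ∈ Set.univ.pi s
    · rw [Set.indicator_of_mem h]
      refine (Finset.prod_eq_one fun i _ => ?_).symm
      exact Set.indicator_of_mem (h i (Set.mem_univ i)) _
    · rw [Set.indicator_of_notMem h]
      simp only [Set.mem_pi, Set.mem_univ, true_imp_iff, not_forall] at h
      obtain ⟨i, hi⟩ := h
      exact (Finset.prod_eq_zero (Finset.mem_univ i) (Set.indicator_of_notMem hi _)).symm
  rw [Measure.finsetSum_apply]
  simp only [Measure.smul_apply, smul_eq_mul, hw, hd, ← Finset.prod_mul_distrib]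
  rw [sum_prod_bool fun i b => ENNReal.ofReal (if b then ρ else 1 - ρ) *
    (s i).indicator (1 : ℝ → ℝ≥0∞) (if b then 1 else 0)]
  refine Finset.prod_congr rfl fun i _ => ?_
  simp [berLaw, Measure.dirac_apply' _ (hs i)]

lemma plantedLaw_eq_sum {ρ : ℝ} (lam : ℝ) (h₀ : 0 ≤ ρ) (h₁ : ρ ≤ 1) :
    plantedLaw n lam ρ = ∑ θ : Fin n → Bool,
      ENNReal.ofReal (bitWeight ρ θ) • (noiseLaw n).map fun W => spike lam (bitVec θ) + W := by
  have hm : Measurable fun z : (Fin n → ℝ) × (Fin n × Fin n → ℝ) => spike lam z.1 + z.2 := by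
    unfold spike
    fun_prop
  ext S hS
  rw [plantedLaw, Measure.map_apply hm hS, Measure.prod_apply (hm hS), signalLaw_eq_sum h₀ h₁,
    lintegral_finsetSum_measure, Measure.finsetSum_apply]
  refine Finset.sum_congr rfl fun θ _ => ?_
  rw [lintegral_smul_measure, lintegral_dirac' _ (measurable_measure_prodMk_left (hm hS)),
    Measure.smul_apply, Measure.map_apply (by fun_prop) hS]
  rfl

/-- The Gaussian matrices built from standard Gaussians. -/
noncomputable def gaussMatrices (g : Fin M × (Fin n × Fin n) → ℝ) : Fin M → Fin n × Fin n → ℝ :=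
  fun j e => (if e.1 = e.2 then √2 else 1) * g (j, (min e.1 e.2, max e.1 e.2))

lemma measurable_gaussMatrices : Measurable (gaussMatrices (M := M) (n := n)) := by
  unfold gaussMatrices
  fun_prop

lemma map_gaussMatrices :
    (stdGaussianPi (Fin M × (Fin n × Fin n))).map gaussMatrices =
      Measure.pi fun _ : Fin M => noiseLaw n := by
  have h := Measure.infinitePi_map_curry (ι := Fin M) (κ := Fin n × Fin n) (X := ℝ)
    (fun _ _ => gaussianReal 0 1)
  rw [Measure.infinitePi_eq_pi, Measure.infinitePi_eq_pi] at h
  simp only [Measure.infinitePi_eq_pi] at h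
  have hm : Measurable fun (g : Fin n × Fin n → ℝ) (e : Fin n × Fin n) =>
      (if e.1 = e.2 then √2 else 1) * g (min e.1 e.2, max e.1 e.2) := by fun_prop
  have h2 := Measure.pi_map_pi (μ := fun _ : Fin M => stdGaussianPi (Fin n × Fin n))
    (f := fun _ (g : Fin n × Fin n → ℝ) (e : Fin n × Fin n) =>
      (if e.1 = e.2 then √2 else 1) * g (min e.1 e.2, max e.1 e.2)) fun _ => hm.aemeasurable
  rw [map_scale_pi_gaussianReal] at h2
  rw [← h2, ← h, Measure.map_map (by fun_prop) (MeasurableEquiv.measurable _)]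
  rfl

lemma hiddenNull_eq_map :
    hiddenNull M (noiseLaw n) =
      (stdGaussianPi (Fin M × (Fin n × Fin n))).map fun g => flatten (gaussMatrices g) := by
  rw [hiddenNull, ← map_gaussMatrices, Measure.map_map measurable_flatten measurable_gaussMatrices]
  rfl

/-- The signal in sample `κ`. -/
def hiddenSpike (lam : ℝ) (κ : Fin M) (θ : Fin n → Bool) : Fin M → Fin n × Fin n → ℝ :=
  fun j => if j = κ then spike lam (bitVec θ) else 0

lemma pi_planted_eq_sum {ρ : ℝ} (lam : ℝ) (h₀ : 0 ≤ ρ) (h₁ : ρ ≤ 1) (κ : Fin M) :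
    (Measure.pi fun j : Fin M => if j = κ then plantedLaw n lam ρ else noiseLaw n) =
      ∑ θ : Fin n → Bool, ENNReal.ofReal (bitWeight ρ θ) •
        (stdGaussianPi (Fin M × (Fin n × Fin n))).map fun g =>
          hiddenSpike lam κ θ + gaussMatrices g := by
  have := isProbabilityMeasure_plantedLaw (n := n) (lam := lam) h₀ h₁
  have : ∀ j : Fin M, IsProbabilityMeasure
      (if j = κ then plantedLaw n lam ρ else noiseLaw n) := fun j => by
    split_ifs <;> infer_instance
  refine Measure.pi_eq fun s hs => ?_
  have hmap : ∀ θ : Fin n → Bool, (stdGaussianPi (Fin M × (Fin n × Fin n))).map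
      (fun g => hiddenSpike lam κ θ + gaussMatrices g) =
      Measure.pi fun j : Fin M => (noiseLaw n).map fun W => hiddenSpike lam κ θ j + W := by
    intro θ
    rw [← Measure.pi_map_pi (fun _ => by fun_prop), ← map_gaussMatrices,
      Measure.map_map (by fun_prop) measurable_gaussMatrices]
    rfl
  have hp : ∀ (θ : Fin n → Bool) (j : Fin M),
      IsProbabilityMeasure ((noiseLaw n).map fun W => hiddenSpike lam κ θ j + W) := fun θ j =>
    Measure.isProbabilityMeasure_map (by fun_prop)
  rw [Measure.finsetSum_apply]
  simp only [Measure.smul_apply, smul_eq_mul, hmap, Measure.pi_pi]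
  have hκ : κ ∈ (Finset.univ : Finset (Fin M)) := Finset.mem_univ κ
  rw [← Finset.mul_prod_erase _ _ hκ, if_pos rfl, plantedLaw_eq_sum lam h₀ h₁,
    Measure.finsetSum_apply, Finset.sum_mul]
  refine Finset.sum_congr rfl fun θ _ => ?_
  rw [← Finset.mul_prod_erase _ _ hκ, Measure.smul_apply, smul_eq_mul, mul_assoc]
  congr 2
  · simp [hiddenSpike]
  · refine Finset.prod_congr rfl fun j hj => ?_
    simp [hiddenSpike, Finset.ne_of_mem_erase hj]

/-- The normalized mean of the Gaussian coordinates. -/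
noncomputable def hiddenMean (lam : ℝ) (w : Fin M × (Fin n → Bool)) :
    Fin M × (Fin n × Fin n) → ℝ := fun i =>
  if i.1 = w.1 ∧ i.2.1 ≤ i.2.2 then
    spike lam (bitVec w.2) i.2 / (if i.2.1 = i.2.2 then √2 else 1) else 0

lemma hiddenSpike_add_gaussMatrices (lam : ℝ) (w : Fin M × (Fin n → Bool))
    (g : Fin M × (Fin n × Fin n) → ℝ) :
    hiddenSpike lam w.1 w.2 + gaussMatrices g = gaussMatrices (g + hiddenMean lam w) := by
  funext j e
  have hle : min e.1 e.2 ≤ max e.1 e.2 := min_le_max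
  have hs : spike lam (bitVec w.2) (min e.1 e.2, max e.1 e.2) = spike lam (bitVec w.2) e := by
    rcases le_total e.1 e.2 with h | h
    · simp [h]
    · simp [h, spike, mul_comm]
  have heq : (min e.1 e.2 = max e.1 e.2) ↔ e.1 = e.2 := by
    rcases le_total e.1 e.2 with h | h <;> simp [h, eq_comm]
  simp only [Pi.add_apply, hiddenSpike, gaussMatrices, hiddenMean, hle, and_true, hs, heq]
  by_cases hj : j = w.1
  · have hne : (if e.1 = e.2 then √2 else 1) ≠ 0 := by split_ifs <;> positivity
    simp only [hj, if_true]
    field_simp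
    ring
  · simp [hj]

/-- The overlap of two binary vectors. -/
def overlap (θ θ' : Fin n → Bool) : ℝ := ∑ i, bitVec θ i * bitVec θ' i

/-- Only entries with `i ≤ j` are free, and dividing by the standard deviation gives diagonal
products weight `1/2`. Adding the transposed sum restores the full square `overlap ^ 2`, whence the
factor `lam ^ 2 / 2`. Signals in different samples have disjoint supports. -/
lemma sum_hiddenMean_mul (lam : ℝ) (w w' : Fin M × (Fin n → Bool)) :
    ∑ i, hiddenMean lam w i * hiddenMean lam w' i =
      if w.1 = w'.1 then lam ^ 2 / 2 * overlap w.2 w'.2 ^ 2 else 0 := by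
  rw [Fintype.sum_prod_type]
  split_ifs with h
  · rw [Finset.sum_eq_single w.1]
    · set x : Fin n → ℝ := fun i => bitVec w.2 i * bitVec w'.2 i with hx
      set F : Fin n × Fin n → ℝ := fun e => if e.1 ≤ e.2 then
        x e.1 * x e.2 / (if e.1 = e.2 then 2 else 1) else 0 with hF
      have e1 : ∀ e : Fin n × Fin n, hiddenMean lam w (w.1, e) * hiddenMean lam w' (w.1, e) =
          lam ^ 2 * F e := by
        intro e
        simp only [hiddenMean, ← h, true_and, hF, hx, spike]
        split_ifs
        · rw [div_mul_div_comm, Real.mul_self_sqrt (by norm_num)]; ring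
        · ring
        · ring
      have e2 : ∑ e, F e = ∑ e : Fin n × Fin n, F e.swap :=
        (Equiv.sum_comp (Equiv.prodComm (Fin n) (Fin n)) F).symm
      have e3 : ∑ e, F e + ∑ e : Fin n × Fin n, F e.swap = overlap w.2 w'.2 ^ 2 := by
        rw [← Finset.sum_add_distrib, pow_two, overlap, Finset.sum_mul_sum,
          ← Fintype.sum_prod_type']
        refine Finset.sum_congr rfl fun e _ => ?_
        simp only [hF, Prod.fst_swap, Prod.snd_swap]
        rcases lt_trichotomy e.1 e.2 with h | h | h
        · simp [h.le, h.ne, h.not_ge, hx]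
        · simp [h, hx]
        · simp [h.le, h.ne, h.not_ge, hx, mul_comm]
      simp only [e1, ← Finset.mul_sum]
      linarith [e2, e3, congrArg (fun z => lam ^ 2 / 2 * z) e3, congrArg (fun z => lam ^ 2 / 2 * z) e2]
    · intro j _ hj
      simp [hiddenMean, hj]
    · simp
  · refine Finset.sum_eq_zero fun j _ => Finset.sum_eq_zero fun e _ => ?_
    simp only [hiddenMean]
    by_cases hj : j = w.1
    · simp [hj, h]
    · simp [hj]

/-- Moments of the overlap of two independent signals. -/
noncomputable def overlapMoment (n : ℕ) (ρ : ℝ) (k : ℕ) : ℝ :=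
  ∑ θ : Fin n → Bool, ∑ θ' : Fin n → Bool, bitWeight ρ θ * bitWeight ρ θ' * overlap θ θ' ^ k

/-- A polynomial in the entries of the matrices as a polynomial in standard Gaussians. -/
noncomputable def pullback (f : MvPolynomial (Fin (M * (n * n))) ℝ) :
    MvPolynomial (Fin M × (Fin n × Fin n)) ℝ :=
  MvPolynomial.bind₁ (fun a =>
    let e : Fin n × Fin n := finProdFinEquiv.symm (finProdFinEquiv.symm a).2
    MvPolynomial.C (if e.1 = e.2 then √2 else 1) *
      MvPolynomial.X ((finProdFinEquiv.symm a).1, (min e.1 e.2, max e.1 e.2))) f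

lemma eval_pullback (f : MvPolynomial (Fin (M * (n * n))) ℝ) (g : Fin M × (Fin n × Fin n) → ℝ) :
    MvPolynomial.eval g (pullback f) = MvPolynomial.eval (flatten (gaussMatrices g)) f := by
  rw [pullback, MvPolynomial.eval, MvPolynomial.eval₂Hom_bind₁]
  congr 2
  funext a
  simp [flatten, gaussMatrices]

lemma totalDegree_pullback_le (f : MvPolynomial (Fin (M * (n * n))) ℝ) :
    (pullback f).totalDegree ≤ f.totalDegree := by
  rw [pullback, MvPolynomial.bind₁, MvPolynomial.aeval_def, MvPolynomial.eval₂_eq']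
  refine (MvPolynomial.totalDegree_finsetSum _ _).trans (Finset.sup_le fun d hd => ?_)
  refine (MvPolynomial.totalDegree_mul _ _).trans ?_
  rw [MvPolynomial.algebraMap_eq, MvPolynomial.totalDegree_C, zero_add]
  refine (MvPolynomial.totalDegree_finsetProd _ _).trans ?_
  refine le_trans (Finset.sum_le_sum fun a _ => ?_) (le_of_eq_of_le
    (Finsupp.sum_fintype d (fun _ k => k) (fun _ => rfl)).symm (MvPolynomial.le_totalDegree hd))
  refine (MvPolynomial.totalDegree_pow _ _).trans ?_
  refine (Nat.mul_le_mul_left _ ?_).trans (Nat.mul_one _).le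
  refine (MvPolynomial.totalDegree_mul _ _).trans ?_
  rw [MvPolynomial.totalDegree_C, MvPolynomial.totalDegree_X]

lemma integral_hiddenNull (f : MvPolynomial (Fin (M * (n * n))) ℝ) :
    ∫ x, MvPolynomial.eval x f ^ 2 ∂(hiddenNull M (noiseLaw n)) =
      ∫ g, MvPolynomial.eval g (pullback f) ^ 2 ∂(stdGaussianPi (Fin M × (Fin n × Fin n))) := by
  have hm : Measurable fun g : Fin M × (Fin n × Fin n) → ℝ => flatten (gaussMatrices g) :=
    measurable_flatten.comp measurable_gaussMatrices
  rw [hiddenNull_eq_map, integral_map hm.aemeasurable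
    (f := fun x => MvPolynomial.eval x f ^ 2)
    ((MvPolynomial.continuous_eval f).pow 2).aestronglyMeasurable]
  simp only [eval_pullback]

lemma integral_hiddenPlanted {ρ : ℝ} (lam : ℝ) (h₀ : 0 ≤ ρ) (h₁ : ρ ≤ 1)
    (f : MvPolynomial (Fin (M * (n * n))) ℝ) :
    ∫ x, MvPolynomial.eval x f ∂(hiddenPlanted M (plantedLaw n lam ρ) (noiseLaw n)) =
      ∑ w : Fin M × (Fin n → Bool), ((M : ℝ)⁻¹ * bitWeight ρ w.2) *
        ∫ g, MvPolynomial.eval (g + hiddenMean lam w) (pullback f)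
          ∂(stdGaussianPi (Fin M × (Fin n × Fin n))) := by
  have hc : Continuous fun y : Fin M → Fin n × Fin n → ℝ => MvPolynomial.eval (flatten y) f := by
    refine (MvPolynomial.continuous_eval f).comp ?_
    unfold flatten
    fun_prop
  have hm : ∀ w : Fin M × (Fin n → Bool), Measurable fun g : Fin M × (Fin n × Fin n) → ℝ =>
      hiddenSpike lam w.1 w.2 + gaussMatrices g := fun w =>
    measurable_const.add measurable_gaussMatrices
  have hev : ∀ (w : Fin M × (Fin n → Bool)) g,
      MvPolynomial.eval (flatten (hiddenSpike lam w.1 w.2 + gaussMatrices g)) f =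
        MvPolynomial.eval (g + hiddenMean lam w) (pullback f) := fun w g => by
    rw [eval_pullback, hiddenSpike_add_gaussMatrices]
  have hint : ∀ w : Fin M × (Fin n → Bool), Integrable
      (fun y : Fin M → Fin n × Fin n → ℝ => MvPolynomial.eval (flatten y) f)
      ((stdGaussianPi (Fin M × (Fin n × Fin n))).map fun g =>
        hiddenSpike lam w.1 w.2 + gaussMatrices g) := by
    intro w
    rw [integrable_map_measure hc.aestronglyMeasurable (hm w).aemeasurable]
    refine (integrable_mvEval_add (pullback f) (hiddenMean lam w)).congr (ae_of_all _ fun g => ?_)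
    exact (hev w g).symm
  have hint' : ∀ w : Fin M × (Fin n → Bool), Integrable
      (fun y : Fin M → Fin n × Fin n → ℝ => MvPolynomial.eval (flatten y) f)
      (ENNReal.ofReal (bitWeight ρ w.2) • (stdGaussianPi (Fin M × (Fin n × Fin n))).map fun g =>
        hiddenSpike lam w.1 w.2 + gaussMatrices g) := fun w =>
    (hint w).smul_measure ENNReal.ofReal_ne_top
  rw [hiddenPlanted, integral_map measurable_flatten.aemeasurable
    (MvPolynomial.continuous_eval f).aestronglyMeasurable]
  simp only [pi_planted_eq_sum lam h₀ h₁]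
  rcases Nat.eq_zero_or_pos M with rfl | hM
  · simp
  rw [integral_finsetSum_measure fun κ _ => ?_, Fintype.sum_prod_type]
  · refine Finset.sum_congr rfl fun κ _ => ?_
    rw [integral_smul_measure, integral_finsetSum_measure fun θ _ => hint' (κ, θ), Finset.smul_sum]
    refine Finset.sum_congr rfl fun θ _ => ?_
    rw [integral_smul_measure, integral_map (hm (κ, θ)).aemeasurable hc.aestronglyMeasurable]
    simp only [hev (κ, θ)]
    rw [ENNReal.toReal_ofReal (bitWeight_nonneg h₀ h₁ θ)]
    simp [mul_assoc]
  · refine Integrable.smul_measure ?_ (by simp [hM.ne'])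
    exact integrable_finsetSum_measure.2 fun θ _ => hint' (κ, θ)

/-- Low-degree second moment bound for the hidden-sample problem. -/
lemma sq_integral_hiddenPlanted_le {ρ : ℝ} (lam : ℝ) (h₀ : 0 ≤ ρ) (h₁ : ρ ≤ 1) (hM : 0 < M)
    {D : ℕ} (f : MvPolynomial (Fin (M * (n * n))) ℝ) (hf : f.totalDegree ≤ D) :
    (∫ x, MvPolynomial.eval x f ∂(hiddenPlanted M (plantedLaw n lam ρ) (noiseLaw n))) ^ 2 ≤
      (∫ x, MvPolynomial.eval x f ^ 2 ∂(hiddenNull M (noiseLaw n))) *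
        (1 + (M : ℝ)⁻¹ * ∑ m ∈ Finset.Icc 1 D,
          (lam ^ 2 / 2) ^ m * overlapMoment n ρ (2 * m) / m.factorial) := by
  rw [integral_hiddenPlanted lam h₀ h₁, integral_hiddenNull]
  refine (sq_mixture_integral_le (fun w : Fin M × (Fin n → Bool) => (M : ℝ)⁻¹ * bitWeight ρ w.2)
    (hiddenMean lam) (pullback f) ((totalDegree_pullback_le f).trans hf)).trans (le_of_eq ?_)
  congr 1
  have hM' : (M : ℝ) ≠ 0 := by exact_mod_cast hM.ne'
  rw [Finset.range_eq_Ico, Finset.sum_eq_sum_Ico_succ_bot (by omega)]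
  -- The term `m = 0` is the squared total mass of the mixture, which is one. For `m ≥ 1` only the
  -- `M` pairs of equal positions out of `M ^ 2` survive, which leaves a factor `1 / M`.
  congr 1
  · simp only [pow_zero, Nat.factorial_zero, Nat.cast_one, div_one, mul_one]
    rw [← Finset.sum_mul_sum]
    have : ∑ w : Fin M × (Fin n → Bool), (M : ℝ)⁻¹ * bitWeight ρ w.2 = 1 := by
      rw [← Finset.mul_sum, Fintype.sum_prod_type]
      simp [sum_bitWeight, hM']
    rw [this, one_mul]
  · rw [Finset.mul_sum]
    refine Finset.sum_congr rfl fun m hm => ?_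
    have hm0 : m ≠ 0 := by have := (Finset.mem_Icc.1 hm).1; omega
    simp only [sum_hiddenMean_mul]
    simp only [Fintype.sum_prod_type]
    have key : ∀ (κ : Fin M) (θ : Fin n → Bool), ∑ κ' : Fin M, ∑ θ' : Fin n → Bool,
        (M : ℝ)⁻¹ * bitWeight ρ θ * ((M : ℝ)⁻¹ * bitWeight ρ θ') *
          ((if κ = κ' then lam ^ 2 / 2 * overlap θ θ' ^ 2 else 0) ^ m / m.factorial) =
        (M : ℝ)⁻¹ * (M : ℝ)⁻¹ * ((lam ^ 2 / 2) ^ m / m.factorial) *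
          ∑ θ' : Fin n → Bool, bitWeight ρ θ * bitWeight ρ θ' * overlap θ θ' ^ (2 * m) := by
      intro κ θ
      rw [Finset.sum_eq_single κ, Finset.mul_sum]
      · refine Finset.sum_congr rfl fun θ' _ => ?_
        rw [if_pos rfl, mul_pow, ← pow_mul]
        ring
      · intro κ' _ hne
        refine Finset.sum_eq_zero fun θ' _ => ?_
        rw [if_neg hne.symm, zero_pow hm0, zero_div, mul_zero]
      · simp
    simp only [key, ← Finset.mul_sum]
    rw [Finset.sum_const, Finset.card_univ, Fintype.card_fin, nsmul_eq_mul]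
    change _ * ((M : ℝ) * overlapMoment n ρ (2 * m)) = _
    field_simp

end Mixture

/-! ### Moments of the overlap -/

section Overlap

variable {n : ℕ} {ρ : ℝ}

lemma overlap_nonneg (θ θ' : Fin n → Bool) : 0 ≤ overlap θ θ' :=
  Finset.sum_nonneg fun i _ => by
    unfold bitVec
    split_ifs <;> norm_num

lemma overlap_le (θ θ' : Fin n → Bool) : overlap θ θ' ≤ n := by
  calc overlap θ θ' ≤ ∑ _i : Fin n, (1 : ℝ) := Finset.sum_le_sum fun i _ => by
        unfold bitVec
        split_ifs <;> norm_num
    _ = n := by simp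

/-- The overlap counts the coordinates where both signals are one, so it is binomial with parameters
`n` and `ρ ^ 2`; this is its moment generating function. -/
lemma sum_exp_overlap (s : ℝ) :
    ∑ θ : Fin n → Bool, ∑ θ' : Fin n → Bool,
      bitWeight ρ θ * bitWeight ρ θ' * Real.exp (s * overlap θ θ') =
        (1 + ρ ^ 2 * (Real.exp s - 1)) ^ n := by
  have e : ∀ θ θ' : Fin n → Bool,
      bitWeight ρ θ * bitWeight ρ θ' * Real.exp (s * overlap θ θ') =
        ∏ i, (if θ i then ρ else 1 - ρ) * (if θ' i then ρ else 1 - ρ) *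
          Real.exp (s * ((if θ i then 1 else 0) * (if θ' i then 1 else 0))) := by
    intro θ θ'
    rw [overlap, Finset.mul_sum, Real.exp_sum, bitWeight, bitWeight, ← Finset.prod_mul_distrib,
      ← Finset.prod_mul_distrib]
    rfl
  simp only [e]
  have h1 : ∀ θ : Fin n → Bool, ∑ θ' : Fin n → Bool,
      ∏ i, (if θ i then ρ else 1 - ρ) * (if θ' i then ρ else 1 - ρ) *
          Real.exp (s * ((if θ i then 1 else 0) * (if θ' i then 1 else 0))) =
      ∏ i, ((if θ i then ρ else 1 - ρ) * ρ * Real.exp (s * (if θ i then 1 else 0)) +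
        (if θ i then ρ else 1 - ρ) * (1 - ρ)) := by
    intro θ
    rw [sum_prod_bool fun i b => (if θ i then ρ else 1 - ρ) * (if b then ρ else 1 - ρ) *
          Real.exp (s * ((if θ i then 1 else 0) * (if b then 1 else 0)))]
    simp
  simp only [h1]
  rw [sum_prod_bool fun _ b => (if b then ρ else 1 - ρ) * ρ * Real.exp (s * (if b then 1 else 0)) +
        (if b then ρ else 1 - ρ) * (1 - ρ)]
  simp only [Finset.prod_const, Finset.card_univ, Fintype.card_fin]
  congr 1
  simp
  ring

lemma overlapMoment_le_pow (h₀ : 0 ≤ ρ) (h₁ : ρ ≤ 1) (k : ℕ) : overlapMoment n ρ k ≤ (n : ℝ) ^ k := by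
  calc overlapMoment n ρ k
      ≤ ∑ θ : Fin n → Bool, ∑ θ' : Fin n → Bool, bitWeight ρ θ * bitWeight ρ θ' * (n : ℝ) ^ k := by
        refine Finset.sum_le_sum fun θ _ => Finset.sum_le_sum fun θ' _ => ?_
        refine mul_le_mul_of_nonneg_left (pow_le_pow_left₀ (overlap_nonneg _ _) (overlap_le _ _) _) ?_
        exact mul_nonneg (bitWeight_nonneg h₀ h₁ _) (bitWeight_nonneg h₀ h₁ _)
    _ = (n : ℝ) ^ k := by
        simp only [← Finset.sum_mul, ← Finset.mul_sum, sum_bitWeight, one_mul, mul_one]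

/-- From `x / r ≤ exp(x / r - 1)`, the power `x ^ k` is at most `r ^ k e^(-k) e^(s x)` with `s = k /
r ≤ 1`. The exponential moment is at most `exp(2 s n ρ ^ 2) ≤ e^(2k)`, since `e^s - 1 ≤ 2s` on the
unit interval. The parameter `r` is taken to be the mean for small `k` and `k` itself for large `k`.
-/
lemma overlapMoment_le (h₀ : 0 ≤ ρ) (h₁ : ρ ≤ 1) {k : ℕ} {r : ℝ} (hr : 0 < r) (hkr : k ≤ r)
    (hμr : n * ρ ^ 2 ≤ r) : overlapMoment n ρ k ≤ (Real.exp 1 * r) ^ k := by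
  set s : ℝ := k / r with hs
  have hs0 : 0 ≤ s := by positivity
  have hs1 : s ≤ 1 := (div_le_one hr).2 hkr
  have hpt : ∀ θ θ' : Fin n → Bool,
      overlap θ θ' ^ k ≤ r ^ k * Real.exp (-k) * Real.exp (s * overlap θ θ') := by
    intro θ θ'
    have h1 : overlap θ θ' / r ≤ Real.exp (overlap θ θ' / r - 1) := by
      have := Real.add_one_le_exp (overlap θ θ' / r - 1)
      linarith
    have h2 := pow_le_pow_left₀ (div_nonneg (overlap_nonneg θ θ') hr.le) h1 k
    rw [div_pow, div_le_iff₀ (by positivity), ← Real.exp_nat_mul] at h2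
    refine h2.trans (le_of_eq ?_)
    rw [mul_comm, mul_assoc, ← Real.exp_add, hs]
    congr 2
    ring
  have hexp : Real.exp s - 1 ≤ 2 * s := by
    have h := Real.abs_exp_sub_one_sub_id_le (x := s) (by rwa [abs_of_nonneg hs0])
    have h' := (abs_le.1 h).2
    nlinarith
  have hmgf : (1 + ρ ^ 2 * (Real.exp s - 1)) ^ n ≤ Real.exp (2 * k) := by
    have hb : 0 ≤ ρ ^ 2 * (Real.exp s - 1) :=
      mul_nonneg (sq_nonneg _) (by linarith [Real.one_le_exp hs0])
    calc (1 + ρ ^ 2 * (Real.exp s - 1)) ^ n ≤ Real.exp (ρ ^ 2 * (Real.exp s - 1)) ^ n := by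
          refine pow_le_pow_left₀ (by linarith) ?_ n
          rw [add_comm]
          exact Real.add_one_le_exp _
      _ = Real.exp (n * (ρ ^ 2 * (Real.exp s - 1))) := (Real.exp_nat_mul _ _).symm
      _ ≤ Real.exp (2 * k) := by
          refine Real.exp_le_exp.2 ?_
          calc (n : ℝ) * (ρ ^ 2 * (Real.exp s - 1)) = n * ρ ^ 2 * (Real.exp s - 1) := by ring
            _ ≤ n * ρ ^ 2 * (2 * s) := mul_le_mul_of_nonneg_left hexp (by positivity)
            _ ≤ r * (2 * s) := mul_le_mul_of_nonneg_right hμr (by positivity)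
            _ = 2 * k := by rw [hs]; field_simp
  calc overlapMoment n ρ k
      ≤ ∑ θ : Fin n → Bool, ∑ θ' : Fin n → Bool, r ^ k * Real.exp (-k) *
          (bitWeight ρ θ * bitWeight ρ θ' * Real.exp (s * overlap θ θ')) := by
        refine Finset.sum_le_sum fun θ _ => Finset.sum_le_sum fun θ' _ => ?_
        have hw := mul_nonneg (bitWeight_nonneg h₀ h₁ θ) (bitWeight_nonneg h₀ h₁ θ')
        have := mul_le_mul_of_nonneg_left (hpt θ θ') hw
        linarith
    _ = r ^ k * Real.exp (-k) * (1 + ρ ^ 2 * (Real.exp s - 1)) ^ n := by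
        simp only [← Finset.mul_sum, sum_exp_overlap]
    _ ≤ r ^ k * Real.exp (-k) * Real.exp (2 * k) := mul_le_mul_of_nonneg_left hmgf (by positivity)
    _ = (Real.exp 1 * r) ^ k := by
        rw [mul_assoc, ← Real.exp_add, mul_pow, ← Real.exp_nat_mul, mul_comm]
        congr 2
        ring

lemma pow_self_div_factorial_le (m : ℕ) :
    (m : ℝ) ^ m / m.factorial ≤ Real.exp 1 ^ m := by
  have := Real.pow_div_factorial_le_exp (m : ℝ) (Nat.cast_nonneg m) m
  rwa [← Real.exp_nat_mul, mul_one]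

/-- Below the mean, `2m ≤ n ρ ^ 2`, the moment is at most `(e n ρ ^ 2)^(2m)` and the term belongs to
an exponential series; the `4` bounds `e ^ 2 / 2`. Above the mean, the moment is at most `(2 e
m)^(2m)`, or trivially `n ^ (2m)`; with `m ^ m / m! ≤ e ^ m`, the two alternatives of `h` are
exactly what makes these terms at most `2⁻ᵐ`. -/
lemma overlapMoment_term_le {lam : ℝ} (h₀ : 0 ≤ ρ) (h₁ : ρ ≤ 1) {m : ℕ} (hm : 0 < m)
    (h : 4 * Real.exp 1 ^ 3 * (lam ^ 2 * m) ≤ 1 ∨ Real.exp 1 * (lam ^ 2 * n ^ 2) ≤ m) :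
    (lam ^ 2 / 2) ^ m * overlapMoment n ρ (2 * m) / m.factorial ≤
      (4 * (lam ^ 2 * (n * ρ ^ 2) ^ 2)) ^ m / m.factorial + (1 / 2) ^ m := by
  have hf : (0 : ℝ) < m.factorial := by exact_mod_cast m.factorial_pos
  have hmR : (0 : ℝ) < m := by exact_mod_cast hm
  have hfac := pow_self_div_factorial_le m
  have he : Real.exp 1 ^ 2 ≤ 8 := by
    nlinarith [Real.exp_one_lt_d9, Real.exp_pos 1]
  rcases le_or_gt (2 * m : ℝ) (n * ρ ^ 2) with hμ | hμ
  · have hmom := overlapMoment_le (n := n) h₀ h₁ (k := 2 * m) (r := n * ρ ^ 2) (by linarith)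
      (by push_cast; exact hμ) le_rfl
    have hle : (lam ^ 2 / 2) ^ m * overlapMoment n ρ (2 * m) ≤
        (4 * (lam ^ 2 * (n * ρ ^ 2) ^ 2)) ^ m := by
      calc (lam ^ 2 / 2) ^ m * overlapMoment n ρ (2 * m)
          ≤ (lam ^ 2 / 2) ^ m * (Real.exp 1 * (n * ρ ^ 2)) ^ (2 * m) :=
            mul_le_mul_of_nonneg_left hmom (by positivity)
        _ = (lam ^ 2 / 2 * (Real.exp 1 * (n * ρ ^ 2)) ^ 2) ^ m := by rw [pow_mul, ← mul_pow]
        _ ≤ _ := by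
            refine pow_le_pow_left₀ (by positivity) ?_ m
            have : 0 ≤ lam ^ 2 * (n * ρ ^ 2) ^ 2 := by positivity
            nlinarith
    have h1 := div_le_div_of_nonneg_right hle hf.le
    have h2 : (0 : ℝ) ≤ (1 / 2) ^ m := by positivity
    linarith
  · have hpos : 0 ≤ (4 * (lam ^ 2 * (n * ρ ^ 2) ^ 2)) ^ m / (m.factorial : ℝ) := by positivity
    suffices hs : (lam ^ 2 / 2) ^ m * overlapMoment n ρ (2 * m) / m.factorial ≤ (1 / 2) ^ m by
      linarith
    -- both remaining cases bound the moment by `(x m)^m` with `x` small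
    have key : ∀ x : ℝ, 0 ≤ x → Real.exp 1 * x ≤ 1 / 2 →
        (lam ^ 2 / 2) ^ m * overlapMoment n ρ (2 * m) ≤ (x * m) ^ m →
        (lam ^ 2 / 2) ^ m * overlapMoment n ρ (2 * m) / m.factorial ≤ (1 / 2) ^ m := by
      intro x hx hx2 hle
      calc _ ≤ (x * m) ^ m / m.factorial := div_le_div_of_nonneg_right hle hf.le
        _ = x ^ m * ((m : ℝ) ^ m / m.factorial) := by rw [mul_pow, mul_div_assoc]
        _ ≤ x ^ m * Real.exp 1 ^ m := mul_le_mul_of_nonneg_left hfac (by positivity)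
        _ = (Real.exp 1 * x) ^ m := by rw [mul_pow, mul_comm]
        _ ≤ (1 / 2) ^ m := pow_le_pow_left₀ (by positivity) hx2 m
    rcases h with h | h
    · refine key (2 * Real.exp 1 ^ 2 * (lam ^ 2 * m)) (by positivity) (by nlinarith) ?_
      have hmom := overlapMoment_le (n := n) h₀ h₁ (k := 2 * m) (r := 2 * m) (by linarith)
        (by push_cast; exact le_rfl) hμ.le
      calc (lam ^ 2 / 2) ^ m * overlapMoment n ρ (2 * m)
          ≤ (lam ^ 2 / 2) ^ m * (Real.exp 1 * (2 * m)) ^ (2 * m) :=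
            mul_le_mul_of_nonneg_left hmom (by positivity)
        _ = (lam ^ 2 / 2 * (Real.exp 1 * (2 * m)) ^ 2) ^ m := by rw [pow_mul, ← mul_pow]
        _ = _ := by congr 1; ring
    · refine key (lam ^ 2 / 2 * n ^ 2 / m) (by positivity) ?_ ?_
      · rw [← mul_div_assoc, div_le_iff₀ hmR]
        linarith
      · calc (lam ^ 2 / 2) ^ m * overlapMoment n ρ (2 * m)
            ≤ (lam ^ 2 / 2) ^ m * (n : ℝ) ^ (2 * m) :=
              mul_le_mul_of_nonneg_left (overlapMoment_le_pow h₀ h₁ _) (by positivity)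
          _ = (lam ^ 2 / 2 * (n : ℝ) ^ 2) ^ m := by rw [pow_mul, ← mul_pow]
          _ = _ := by rw [div_mul_cancel₀ _ hmR.ne']

lemma sum_overlapMoment_le {lam : ℝ} (h₀ : 0 ≤ ρ) (h₁ : ρ ≤ 1) {D : ℕ}
    (h : ∀ m : ℕ, 0 < m → m ≤ D →
      4 * Real.exp 1 ^ 3 * (lam ^ 2 * m) ≤ 1 ∨ Real.exp 1 * (lam ^ 2 * n ^ 2) ≤ m) :
    ∑ m ∈ Finset.Icc 1 D, (lam ^ 2 / 2) ^ m * overlapMoment n ρ (2 * m) / m.factorial ≤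
      Real.exp (4 * (lam ^ 2 * (n * ρ ^ 2) ^ 2)) + 2 := by
  have hsub : Finset.Icc 1 D ⊆ Finset.range (D + 1) := fun m hm => by
    have := (Finset.mem_Icc.1 hm).2
    exact Finset.mem_range.2 (by omega)
  calc _ ≤ ∑ m ∈ Finset.Icc 1 D,
        ((4 * (lam ^ 2 * (n * ρ ^ 2) ^ 2)) ^ m / m.factorial + (1 / 2 : ℝ) ^ m) :=
        Finset.sum_le_sum fun m hm => overlapMoment_term_le h₀ h₁ (Finset.mem_Icc.1 hm).1
          (h m (Finset.mem_Icc.1 hm).1 (Finset.mem_Icc.1 hm).2)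
    _ ≤ ∑ m ∈ Finset.range (D + 1),
        ((4 * (lam ^ 2 * (n * ρ ^ 2) ^ 2)) ^ m / m.factorial + (1 / 2 : ℝ) ^ m) :=
        Finset.sum_le_sum_of_subset_of_nonneg hsub fun m _ _ => by positivity
    _ ≤ _ := by
        rw [Finset.sum_add_distrib]
        refine add_le_add (Real.sum_le_exp_of_nonneg (by positivity) _) ?_
        exact sum_geometric_two_le _

end Overlap

/-! ### The low-degree advantage -/

lemma one_le_lowDegAdv {d : ℕ} (D : ℕ) (P Q : Measure (Fin d → ℝ)) [IsProbabilityMeasure P]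
    [IsProbabilityMeasure Q] : 1 ≤ lowDegAdv D P Q := by
  refine le_iSup₂_of_le (1 : MvPolynomial (Fin d) ℝ) (by simp) ?_
  simp

/-- The product form of the hypothesis also settles polynomials with zero second moment under `Q`:
their mean under `P` is then zero. -/
lemma lowDegAdv_le {d D : ℕ} {P Q : Measure (Fin d → ℝ)} {B : ℝ}
    (h : ∀ f : MvPolynomial (Fin d) ℝ, f.totalDegree ≤ D →
      (∫ x, MvPolynomial.eval x f ∂P) ^ 2 ≤ (∫ x, MvPolynomial.eval x f ^ 2 ∂Q) * B) :
    lowDegAdv D P Q ≤ ENNReal.ofReal √B := by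
  refine iSup₂_le fun f hf => ENNReal.div_le_of_le_mul ?_
  rw [← ENNReal.ofReal_mul (Real.sqrt_nonneg _), mul_comm,
    ← Real.sqrt_mul (integral_nonneg fun x => sq_nonneg _)]
  exact ENNReal.ofReal_le_ofReal (Real.le_sqrt_of_sq_le (h f hf))

lemma isProbabilityMeasure_hiddenNull {n M : ℕ} :
    IsProbabilityMeasure (hiddenNull M (noiseLaw n)) :=
  Measure.isProbabilityMeasure_map measurable_flatten.aemeasurable

lemma isProbabilityMeasure_hiddenPlanted {n M : ℕ} (hM : 0 < M)
    (P : Measure (Fin n × Fin n → ℝ)) [IsProbabilityMeasure P] :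
    IsProbabilityMeasure (hiddenPlanted M P (noiseLaw n)) := by
  have hp : ∀ κ j : Fin M, IsProbabilityMeasure (if j = κ then P else noiseLaw n) := by
    intro κ j
    split_ifs <;> infer_instance
  have : IsProbabilityMeasure (∑ κ : Fin M, (M : ℝ≥0∞)⁻¹ •
      Measure.pi fun j : Fin M => if j = κ then P else noiseLaw n) := by
    constructor
    rw [Measure.finsetSum_apply]
    simp only [Measure.smul_apply, measure_univ, smul_eq_mul, mul_one]
    rw [Finset.sum_const, Finset.card_univ, Fintype.card_fin, nsmul_eq_mul]
    exact ENNReal.mul_inv_cancel (by simp [hM.ne']) (by simp)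
  exact Measure.isProbabilityMeasure_map measurable_flatten.aemeasurable

/-- The low-degree advantage in the hidden-sample problem. -/
lemma lowDegAdv_hidden_le {n M D : ℕ} {ρ lam : ℝ} (h₀ : 0 ≤ ρ) (h₁ : ρ ≤ 1) (hM : 0 < M)
    (h : ∀ m : ℕ, 0 < m → m ≤ D →
      4 * Real.exp 1 ^ 3 * (lam ^ 2 * m) ≤ 1 ∨ Real.exp 1 * (lam ^ 2 * n ^ 2) ≤ m) :
    lowDegAdv D (hiddenPlanted M (plantedLaw n lam ρ) (noiseLaw n)) (hiddenNull M (noiseLaw n)) ≤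
      ENNReal.ofReal √(1 + (M : ℝ)⁻¹ * (Real.exp (4 * (lam ^ 2 * (n * ρ ^ 2) ^ 2)) + 2)) := by
  refine lowDegAdv_le fun f hf => (sq_integral_hiddenPlanted_le lam h₀ h₁ hM f hf).trans ?_
  refine mul_le_mul_of_nonneg_left ?_ (integral_nonneg fun x => sq_nonneg _)
  gcongr
  exact sum_overlapMoment_le h₀ h₁ h

/-! ### Consequences of the scaling assumptions -/

namespace HardRegime

variable {n : ℕ → ℕ} {lam ρ : ℕ → ℝ}

lemma tendsto_log (h : HardRegime n lam ρ) : Tendsto (fun k => Real.log (n k)) atTop atTop :=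
  Real.tendsto_log_atTop.comp (tendsto_natCast_atTop_atTop.comp h.dim)

lemma eventually_rho_lower (h : HardRegime n lam ρ) :
    ∀ᶠ k in atTop, Real.log (n k) ^ 4 ≤ ρ k ^ 2 * n k := by
  filter_upwards [h.rho_lower.bound one_pos, h.rho_mem, h.dim.eventually_gt_atTop 0]
    with k hk hρ hn
  have hn' : (0 : ℝ) < n k := by exact_mod_cast hn
  have hs : 0 < √(n k : ℝ) := Real.sqrt_pos.2 hn'
  rw [Real.norm_of_nonneg (by positivity), Real.norm_of_nonneg hρ.1.le, one_mul,
    div_le_iff₀ hs] at hk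
  have := pow_le_pow_left₀ (by positivity) hk 2
  rw [mul_pow, Real.sq_sqrt hn'.le] at this
  calc Real.log (n k) ^ 4 = (Real.log (n k) ^ 2) ^ 2 := by ring
    _ ≤ _ := this

lemma eventually_rho_upper (h : HardRegime n lam ρ) {ε : ℝ} (hε : 0 < ε) :
    ∀ᶠ k in atTop, ρ k * Real.log (n k) ≤ ε := by
  filter_upwards [h.rho_upper.bound hε, h.rho_mem, h.tendsto_log.eventually_gt_atTop 0]
    with k hk hρ hl
  rwa [Real.norm_of_nonneg hρ.1.le, Real.norm_of_nonneg (by positivity), mul_one_div,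
    le_div_iff₀ hl] at hk

lemma eventually_snr (h : HardRegime n lam ρ) {ε : ℝ} (hε : 0 < ε) :
    ∀ᶠ k in atTop, lam k ^ 2 * ρ k ^ 2 * n k * Real.log (n k) ^ 2 ≤ ε := by
  filter_upwards [h.snr.bound hε, h.tendsto_log.eventually_gt_atTop 0] with k hk hl
  rwa [Real.norm_of_nonneg (by positivity), Real.norm_of_nonneg (by positivity), mul_one_div,
    le_div_iff₀ (by positivity)] at hk

end HardRegime

/-- The signal strength of the testing problem: splitting off a noise copy from a sample at this
strength leaves an instance of strength `lam`. -/
noncomputable def boostedLam (n : ℕ) (lam ρ : ℝ) : ℝ :=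
  √(2 * lam ^ 2 + Real.log n ^ 2 / (ρ * n) ^ 2)

lemma sq_boostedLam (n : ℕ) (lam ρ : ℝ) :
    boostedLam n lam ρ ^ 2 = 2 * lam ^ 2 + Real.log n ^ 2 / (ρ * n) ^ 2 :=
  Real.sq_sqrt (by positivity)

lemma boostedLam_pos (n : ℕ) {lam : ℝ} (hlam : 0 < lam) (ρ : ℝ) : 0 < boostedLam n lam ρ :=
  Real.sqrt_pos.2 (by positivity)

/-- Doubling `lam ^ 2` is harmless. After multiplication by `ρ ^ 2 n (log n) ^ 2` the added term
becomes `(log n) ^ 4 / n`. The lower bound on `ρ` makes this at most `ρ ^ 2`, and the upper bound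
sends that to zero. -/
lemma HardRegime.boosted {n : ℕ → ℕ} {lam ρ : ℕ → ℝ} (h : HardRegime n lam ρ) :
    HardRegime n (fun k => boostedLam (n k) (lam k) (ρ k)) ρ where
  dim := h.dim
  lam_pos := h.lam_pos.mono fun k hk => boostedLam_pos _ hk _
  rho_mem := h.rho_mem
  rho_lower := h.rho_lower
  rho_upper := h.rho_upper
  snr := by
    refine isLittleO_iff.2 fun ε hε => ?_
    have hε' : 0 < √(ε / 2) := Real.sqrt_pos.2 (by positivity)
    filter_upwards [h.eventually_snr (ε := ε / 4) (by positivity), h.eventually_rho_lower,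
      h.eventually_rho_upper hε', h.rho_mem, h.tendsto_log.eventually_ge_atTop 1,
      h.dim.eventually_gt_atTop 0] with k h1 h2 h3 hρ hl1 hn
    have hl : 0 < Real.log (n k) := by linarith
    have hn' : (0 : ℝ) < n k := by exact_mod_cast hn
    rw [Real.norm_of_nonneg (by positivity), Real.norm_of_nonneg (by positivity), mul_one_div,
      le_div_iff₀ (by positivity), sq_boostedLam]
    have h4 : (ρ k * Real.log (n k)) ^ 2 ≤ ε / 2 := by
      have := pow_le_pow_left₀ (mul_nonneg hρ.1.le hl.le) h3 2
      rwa [Real.sq_sqrt (by positivity)] at this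
    have h5 : Real.log (n k) ^ 2 / (ρ k * n k) ^ 2 * ρ k ^ 2 * n k * Real.log (n k) ^ 2 =
        Real.log (n k) ^ 4 / n k := by
      have := hρ.1.ne'
      field_simp
    have h6 : Real.log (n k) ^ 4 / n k ≤ ρ k ^ 2 := (div_le_iff₀ hn').2 h2
    have h7 : ρ k ^ 2 ≤ (ρ k * Real.log (n k)) ^ 2 :=
      pow_le_pow_left₀ hρ.1.le (le_mul_of_one_le_right hρ.1.le hl1) 2
    calc _ = 2 * (lam k ^ 2 * ρ k ^ 2 * n k * Real.log (n k) ^ 2) +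
          Real.log (n k) ^ 2 / (ρ k * n k) ^ 2 * ρ k ^ 2 * n k * Real.log (n k) ^ 2 := by ring
      _ ≤ ε := by rw [h5]; linarith

/-- Terms of degree up to `1 / (lam² ℓ⁴)` are negligible at the boosted signal strength. -/
lemma boosted_degree_dichotomy {N lam ρ ℓ m : ℝ} (hℓ : 100 ≤ ℓ) (hN : 0 < N) (hρ : 0 < ρ)
    (hlam : 0 < lam) (hρN : ℓ ^ 4 ≤ ρ ^ 2 * N) (hm : 0 < m)
    (hmle : m ≤ (lam ^ 2)⁻¹ * (ℓ ^ 4)⁻¹) :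
    4 * Real.exp 1 ^ 3 * ((2 * lam ^ 2 + ℓ ^ 2 / (ρ * N) ^ 2) * m) ≤ 1 ∨
      Real.exp 1 * ((2 * lam ^ 2 + ℓ ^ 2 / (ρ * N) ^ 2) * N ^ 2) ≤ m := by
  have hℓ0 : 0 < ℓ := by linarith
  have he : Real.exp 1 ≤ 3 := by linarith [Real.exp_one_lt_d9]
  have he3 : Real.exp 1 ^ 3 ≤ 21 := by
    calc Real.exp 1 ^ 3 ≤ 2.7182818286 ^ 3 :=
          pow_le_pow_left₀ (Real.exp_pos 1).le Real.exp_one_lt_d9.le 3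
      _ ≤ 21 := by norm_num
  have hlm : lam ^ 2 * m * ℓ ^ 4 ≤ 1 := by
    rw [← mul_inv, inv_eq_one_div, le_div_iff₀ (by positivity)] at hmle
    linarith
  have hℓ4 : (100 : ℝ) ^ 4 ≤ ℓ ^ 4 := pow_le_pow_left₀ (by norm_num) hℓ 4
  have hlm' : lam ^ 2 * m * 100 ^ 4 ≤ 1 :=
    (mul_le_mul_of_nonneg_left hℓ4 (by positivity)).trans hlm
  -- The left alternative needs a product of at most `1 / 84`, as `4 e³ ≤ 84`; each of the two
  -- summands of the boosted strength gets `1 / 168`. The `lam` part is always small, so only the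
  -- added term decides.
  by_cases hc : 168 * (ℓ ^ 2 * m) ≤ (ρ * N) ^ 2
  · left
    have h1 : ℓ ^ 2 / (ρ * N) ^ 2 * m ≤ 1 / 168 := by
      rw [div_mul_eq_mul_div, div_le_iff₀ (by positivity)]
      linarith
    have h2 : (2 * lam ^ 2 + ℓ ^ 2 / (ρ * N) ^ 2) * m ≤ 1 / 84 := by
      rw [add_mul]
      have : 2 * lam ^ 2 * m ≤ 1 / 168 := by nlinarith
      linarith
    have h3 : 0 ≤ (2 * lam ^ 2 + ℓ ^ 2 / (ρ * N) ^ 2) * m := by positivity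
    calc _ ≤ 4 * 21 * ((2 * lam ^ 2 + ℓ ^ 2 / (ρ * N) ^ 2) * m) := by gcongr
      _ ≤ 1 := by linarith
  · right
    push Not at hc
    -- Otherwise `m` exceeds a large multiple of `N`. Then `lam ^ 2 * N ^ 2 ≤ lam ^ 2 * m * m` is a
    -- tiny multiple of `m`, and `ℓ ^ 2 / ρ ^ 2 ≤ N`, so the trivial bound on the overlap is enough.
    have hmN : N * ℓ ^ 2 ≤ 168 * m := by
      have h1 : N * ℓ ^ 4 ≤ (ρ * N) ^ 2 := by nlinarith
      have h2 : (N * ℓ ^ 2) * ℓ ^ 2 ≤ (168 * m) * ℓ ^ 2 := by nlinarith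
      exact le_of_mul_le_mul_right h2 (by positivity)
    have hℓ2 : (100 : ℝ) ^ 2 ≤ ℓ ^ 2 := pow_le_pow_left₀ (by norm_num) hℓ 2
    have hN4 : N * 100 ^ 2 ≤ 168 * m :=
      (mul_le_mul_of_nonneg_left hℓ2 hN.le).trans hmN
    have hA : 12 * (lam ^ 2 * N ^ 2) ≤ m := by
      have h1 : N ^ 2 ≤ m ^ 2 := pow_le_pow_left₀ hN.le (by linarith) 2
      have h2 : lam ^ 2 * N ^ 2 ≤ lam ^ 2 * m ^ 2 := by gcongr
      have h3 : lam ^ 2 * m ^ 2 = lam ^ 2 * m * m := by ring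
      nlinarith
    have hB : ℓ ^ 2 / ρ ^ 2 ≤ N := by
      rw [div_le_iff₀ (by positivity)]
      nlinarith
    have hB' : ℓ ^ 2 / (ρ * N) ^ 2 * N ^ 2 = ℓ ^ 2 / ρ ^ 2 := by
      field_simp
    calc _ ≤ 3 * ((2 * lam ^ 2 + ℓ ^ 2 / (ρ * N) ^ 2) * N ^ 2) := by gcongr
      _ = 6 * (lam ^ 2 * N ^ 2) + 3 * (ℓ ^ 2 / ρ ^ 2) := by rw [add_mul, hB']; ring
      _ ≤ m := by nlinarith

/-! ### From weak recovery to weak detection -/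

lemma RProgram.RunsWithin.mono {p : RProgram} {d : ℕ} {b b' : ℝ} (h : p.RunsWithin d b)
    (hb : b ≤ b') : p.RunsWithin d b' :=
  ⟨h.1.trans hb, fun x ω => (h.2 x ω).imp fun _ ht => ⟨ht.1.trans hb, ht.2⟩⟩

/-- The exponent `4 lam² (n ρ²)²` governing the low-degree advantage. -/
noncomputable def advExponent (n : ℕ) (lam ρ : ℝ) : ℝ := 4 * (lam ^ 2 * (n * ρ ^ 2) ^ 2)

/-- The number of samples in the testing problem. -/
noncomputable def sampleCount (n : ℕ) (lam ρ : ℝ) : ℕ := ⌈n * Real.exp (advExponent n lam ρ)⌉₊ + 1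

/-- The rejection threshold of the test. -/
noncomputable def testThreshold (n M : ℕ) : ℝ := 4 * √(Real.log M + Real.log n)

section Parameters

variable {n : ℕ} {lam ρ : ℝ}

lemma advExponent_nonneg (n : ℕ) (lam ρ : ℝ) : 0 ≤ advExponent n lam ρ := by
  unfold advExponent
  positivity

lemma sampleCount_pos (n : ℕ) (lam ρ : ℝ) : 0 < sampleCount n lam ρ := Nat.succ_pos _

lemma le_sampleCount (n : ℕ) (lam ρ : ℝ) :
    n * Real.exp (advExponent n lam ρ) ≤ sampleCount n lam ρ := by
  rw [sampleCount]
  push_cast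
  linarith [Nat.le_ceil (n * Real.exp (advExponent n lam ρ))]

lemma sampleCount_le (hn : 0 < n) (lam ρ : ℝ) :
    (sampleCount n lam ρ : ℝ) ≤ 3 * n * Real.exp (advExponent n lam ρ) := by
  have hn' : (1 : ℝ) ≤ n := by exact_mod_cast hn
  have he := Real.one_le_exp (advExponent_nonneg n lam ρ)
  have h1 : 1 ≤ n * Real.exp (advExponent n lam ρ) := one_le_mul_of_one_le_of_one_le hn' he
  have h2 := Nat.ceil_lt_add_one (a := n * Real.exp (advExponent n lam ρ)) (by positivity)
  rw [sampleCount]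
  push_cast
  linarith

lemma log_sampleCount_le (hn : 0 < n) (lam ρ : ℝ) :
    Real.log (sampleCount n lam ρ) ≤ advExponent n lam ρ + Real.log n + 2 := by
  have hn' : (0 : ℝ) < n := by exact_mod_cast hn
  have hM : (0 : ℝ) < sampleCount n lam ρ := by exact_mod_cast sampleCount_pos n lam ρ
  refine (Real.log_le_log hM (sampleCount_le hn lam ρ)).trans ?_
  rw [Real.log_mul (by positivity) (Real.exp_ne_zero _), Real.log_mul (by norm_num) hn'.ne',
    Real.log_exp]
  have : Real.log 3 ≤ 3 - 1 := Real.log_le_sub_one_of_pos (by norm_num)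
  linarith

lemma advExponent_boostedLam (hρ : ρ ≠ 0) (hn : 0 < n) :
    advExponent n (boostedLam n lam ρ) ρ =
      8 * (lam ^ 2 * (n * ρ ^ 2) ^ 2) + 4 * (ρ * Real.log n) ^ 2 := by
  have hn' : (n : ℝ) ≠ 0 := by exact_mod_cast hn.ne'
  rw [advExponent, sq_boostedLam]
  field_simp
  ring

lemma sq_testThreshold {M : ℕ} (hn : 0 < n) (hM : 0 < M) :
    testThreshold n M ^ 2 / 8 = 2 * Real.log M + 2 * Real.log n := by
  have h1 : 0 ≤ Real.log M := Real.log_nonneg (by exact_mod_cast hM)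
  have h2 : 0 ≤ Real.log n := Real.log_nonneg (by exact_mod_cast hn)
  rw [testThreshold, mul_pow, Real.sq_sqrt (by positivity)]
  ring

/-- The threshold is small compared with the correlation produced by an informative sample. -/
lemma testThreshold_lt {c : ℝ} (hc : 0 < c) (hn : 0 < n) (hρ : 0 < ρ) (hlam : 0 < lam)
    (hℓ : 8 ≤ Real.log n)
    (h : 256 * (4 * ρ ^ 2 + 3 / Real.log n) < c ^ 2 / 8) :
    4 * testThreshold n (sampleCount n (boostedLam n lam ρ) ρ) <
      √(1 - (lam / boostedLam n lam ρ) ^ 2) * boostedLam n lam ρ * c * (ρ * n / 2) := by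
  have hn' : (0 : ℝ) < n := by exact_mod_cast hn
  set ℓ := Real.log n with hℓdef
  set L := boostedLam n lam ρ with hL
  have hLpos : 0 < L := boostedLam_pos n hlam ρ
  have hLsq : L ^ 2 = 2 * lam ^ 2 + ℓ ^ 2 / (ρ * n) ^ 2 := sq_boostedLam n lam ρ
  set M := sampleCount n L ρ with hM
  -- The summand `2 * lam ^ 2` of the boosted strength leaves at least half of the squared strength
  -- in the second clone.
  have ha : 1 / 2 ≤ 1 - (lam / L) ^ 2 := by
    have : (lam / L) ^ 2 ≤ 1 / 2 := by
      rw [div_pow, div_le_iff₀ (by positivity), hLsq]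
      have : 0 ≤ ℓ ^ 2 / (ρ * n) ^ 2 := by positivity
      linarith
    linarith
  have hlogM : Real.log M ≤ advExponent n L ρ + ℓ + 2 := log_sampleCount_le hn L ρ
  have hlogM0 : 0 ≤ Real.log M := Real.log_nonneg (by exact_mod_cast sampleCount_pos n L ρ)
  set S := L ^ 2 * (ρ * n) ^ 2 with hS
  -- This is what the second summand of the boosted strength is for: without it a very weak signal
  -- would not exceed the fluctuations of order `√ℓ`.
  have hSℓ : ℓ ^ 2 ≤ S := by
    have e : S = 2 * lam ^ 2 * (ρ * n) ^ 2 + ℓ ^ 2 := by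
      rw [hS, hLsq]
      field_simp
    rw [e]
    have : 0 ≤ 2 * lam ^ 2 * (ρ * n) ^ 2 := by positivity
    linarith
  have hadv : advExponent n L ρ = 4 * ρ ^ 2 * S := by
    rw [advExponent, hS]; ring
  -- The main part of `log M` is `4 ρ ^ 2 S` and the rest is at most `3 ℓ ≤ (3 / ℓ) S`, so both are
  -- small fractions of `S`.
  have hkey : 256 * (Real.log M + ℓ) < c ^ 2 / 8 * S := by
    have h1 : Real.log M + ℓ ≤ 4 * ρ ^ 2 * S + 3 * ℓ := by linarith
    have h2 : 3 * ℓ ≤ 3 / ℓ * S := by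
      rw [div_mul_eq_mul_div, le_div_iff₀ (by linarith)]
      nlinarith
    have hSpos : 0 < S := by positivity
    have h3 := mul_lt_mul_of_pos_right h hSpos
    nlinarith
  refine lt_of_pow_lt_pow_left₀ 2 (by positivity) ?_
  have e1 : (4 * testThreshold n M) ^ 2 = 256 * (Real.log M + ℓ) := by
    rw [testThreshold, ← mul_assoc, mul_pow, ← hℓdef,
      Real.sq_sqrt (by linarith)]
    norm_num
  have e2 : (√(1 - (lam / L) ^ 2) * L * c * (ρ * n / 2)) ^ 2 =
      (1 - (lam / L) ^ 2) * (c ^ 2 / 4 * S) := by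
    rw [mul_pow, mul_pow, mul_pow, Real.sq_sqrt (by linarith), hS]
    ring
  rw [e1, e2]
  refine hkey.trans_le ?_
  have : 0 ≤ c ^ 2 / 4 * S := by positivity
  nlinarith

/-- Testing error of the cloning test built from an estimator with correlation `c`. -/
lemma testError_cloneTest_le {A : RProgram} {t c : ℝ} (hA : A.RunsWithin (n * n) t) (hc : 0 < c)
    (hn : 0 < n) (hρ : 0 < ρ) (hρ1 : ρ ≤ 1) (hlam : 0 < lam) (hℓ : 8 ≤ Real.log n)
    (hρN : Real.log n ^ 4 ≤ ρ ^ 2 * n)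
    (h : 256 * (4 * ρ ^ 2 + 3 / Real.log n) < c ^ 2 / 8)
    (hcorr : c ≤ expectedCorr A n lam ρ) {M : ℕ}
    (hM : M = sampleCount n (boostedLam n lam ρ) ρ) :
    testError ((cloneTest n M (lam / boostedLam n lam ρ) (testThreshold n M)).program A)
        (hiddenPlanted M (plantedLaw n (boostedLam n lam ρ) ρ) (noiseLaw n))
        (hiddenNull M (noiseLaw n)) ≤ 1 - c / 2 + 12 / Real.log n := by
  have hn' : (0 : ℝ) < n := by exact_mod_cast hn
  set L := boostedLam n lam ρ with hL
  set ℓ := Real.log n with hℓdef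
  set τ := testThreshold n M with hτ
  have hℓ0 : 0 < ℓ := by linarith
  have hLpos : 0 < L := boostedLam_pos n hlam ρ
  have hMpos : 0 < M := by rw [hM]; exact sampleCount_pos _ _ _
  have hMR : (0 : ℝ) < M := by exact_mod_cast hMpos
  have hlogM0 : 0 ≤ Real.log M := Real.log_nonneg (by exact_mod_cast hMpos)
  have hτ0 : 0 ≤ τ := by rw [hτ, testThreshold]; positivity
  have ha0 : 0 < lam / L := by positivity
  have ha1 : lam / L ≤ 1 := by
    rw [div_le_one hLpos]
    refine le_of_sq_le_sq ?_ hLpos.le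
    rw [sq_boostedLam]
    have : 0 ≤ Real.log n ^ 2 / (ρ * n) ^ 2 := by positivity
    nlinarith [sq_nonneg lam]
  have hτ2 : -τ ^ 2 / 8 = -(2 * Real.log M + 2 * ℓ) := by
    rw [neg_div, hτ, sq_testThreshold hn hMpos]
  have hexp : ∀ x : ℝ, 0 < x → Real.exp (-x) ≤ 1 / x := fun x hx => by
    rw [Real.exp_neg, ← one_div]
    exact one_div_le_one_div_of_le hx (by linarith [Real.add_one_le_exp x])
  have hE1 : M * Real.exp (-τ ^ 2 / 8) ≤ 1 / ℓ := by
    nth_rewrite 1 [← Real.exp_log hMR]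
    rw [hτ2, ← Real.exp_add]
    refine le_trans (Real.exp_le_exp.2 ?_) (hexp ℓ hℓ0)
    linarith
  have hE2 : Real.exp (-τ ^ 2 / 8) ≤ 1 / ℓ := by
    rw [hτ2]
    refine le_trans (Real.exp_le_exp.2 ?_) (hexp ℓ hℓ0)
    linarith
  have hE3 : Real.exp (-(ρ * n / 10)) ≤ 10 / ℓ := by
    have h1 : ℓ ≤ ρ * n := by
      have h2 : ℓ ≤ ℓ ^ 4 := le_self_pow₀ (by linarith) (by norm_num)
      have h3 : ρ ^ 2 * n ≤ ρ * n := by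
        refine mul_le_mul_of_nonneg_right ?_ hn'.le
        nlinarith
      linarith
    refine (hexp _ (by positivity)).trans ?_
    rw [one_div_div]
    exact div_le_div_of_nonneg_left (by norm_num) hℓ0 h1
  have := isProbabilityMeasure_plantedLaw (n := n) (lam := L) hρ.le hρ1
  have hnull := null_error_le (n := n) (M := M) (a := lam / L) (τ := τ) hA ha0.le ha1 hτ0
  have hpl := planted_not_pass_le (n := n) (a := lam / L) (τ := τ) (lam := L) (ρ := ρ)
    (s := ρ * n / 2) (c := c) hA hρ.le hρ1 ha0 ha1 hτ0 hLpos hc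
    (by rwa [div_mul_cancel₀ _ hLpos.ne'])
    (by rw [hτ, hM]; exact testThreshold_lt hc hn hρ hlam hℓ h)
  have hplant := planted_error_le hMpos hA hpl
  have hsmall := signalLaw_small_le n hρ.le hρ1
  rw [testError]
  -- The three parts bound the union of false alarms, the noise of the second clone and an
  -- exceptionally small signal.
  have e : (12 : ℝ) / ℓ = 1 / ℓ + 1 / ℓ + 10 / ℓ := by ring
  rw [e]
  linarith

/-- Running time of the cloning test. -/
lemma runsWithin_cloneTest {A : RProgram} {t C δ E a τ lam' : ℝ} (hA : A.RunsWithin (n * n) t)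
    (hn : 0 < n) (hℓ : 0 < Real.log n) (hC : 0 < C) (hδ : 3 * (C * δ) = 1) (hE : 0 ≤ E)
    (ht : t ≤ Real.exp (δ * E)) (hX : advExponent n lam' ρ ≤ δ * E)
    (hlow : 6 + 3 * Real.log n + 1 / C ≤ δ * E) :
    ((cloneTest n (sampleCount n lam' ρ) a τ).program A).RunsWithin
      (sampleCount n lam' ρ * (n * n))
      (((sampleCount n lam' ρ * (n * n) : ℕ) : ℝ) ^
        ((⌊E⌋₊ : ℝ) / (C * Real.log ((sampleCount n lam' ρ * (n * n) : ℕ) : ℝ)))) := by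
  set M := sampleCount n lam' ρ with hM
  have hn1 : (1 : ℝ) ≤ n := by exact_mod_cast hn
  have hn' : (0 : ℝ) < n := by linarith
  have hM1 : (1 : ℝ) ≤ M := by exact_mod_cast sampleCount_pos n lam' ρ
  have hδ0 : 0 < δ := by
    by_contra hneg
    push Not at hneg
    nlinarith
  refine (CloneTest.runsWithin_program (K := cloneTest n M a τ) hA).mono ?_
  have hn2 : (1 : ℝ) < n := by
    by_contra hneg
    push Not at hneg
    exact absurd (Real.log_nonpos hn'.le hneg) (not_le.2 hℓ)
  have hd1 : (1 : ℝ) < ((M * (n * n) : ℕ) : ℝ) := by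
    push_cast
    nlinarith
  have hlogd : 0 < Real.log ((M * (n * n) : ℕ) : ℝ) := Real.log_pos hd1
  -- The time allowed by the heuristic is `exp(D / C)`, whatever the dimension, so a large number of
  -- samples does not change the budget.
  have hrhs : ((M * (n * n) : ℕ) : ℝ) ^ ((⌊E⌋₊ : ℝ) / (C * Real.log ((M * (n * n) : ℕ) : ℝ))) =
      Real.exp ((⌊E⌋₊ : ℝ) / C) := by
    rw [Real.rpow_def_of_pos (by linarith)]
    congr 1
    field_simp
  rw [hrhs]
  have hT1 : 1 ≤ Real.exp (δ * E) := Real.one_le_exp (by positivity)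
  have hbound : (M : ℝ) * (80 * ((n * n : ℕ) : ℝ) + 4 * t + 33) + 8 ≤
      375 * n ^ 3 * Real.exp (advExponent n lam' ρ) * Real.exp (δ * E) := by
    have hMle := sampleCount_le hn lam' ρ
    set T := Real.exp (δ * E) with hT
    have hnn : (1 : ℝ) ≤ n ^ 2 := one_le_pow₀ hn1
    have h1 : 80 * ((n * n : ℕ) : ℝ) + 4 * t + 41 ≤ 125 * (n ^ 2 * T) := by
      push_cast
      nlinarith
    have h2 : (M : ℝ) * (80 * ((n * n : ℕ) : ℝ) + 4 * t + 33) + 8 ≤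
        M * (80 * ((n * n : ℕ) : ℝ) + 4 * t + 41) := by nlinarith
    calc _ ≤ (M : ℝ) * (80 * ((n * n : ℕ) : ℝ) + 4 * t + 41) := h2
      _ ≤ M * (125 * (n ^ 2 * T)) := mul_le_mul_of_nonneg_left h1 (by positivity)
      _ ≤ 3 * n * Real.exp (advExponent n lam' ρ) * (125 * (n ^ 2 * T)) :=
          mul_le_mul_of_nonneg_right hMle (by positivity)
      _ = _ := by ring
  refine hbound.trans ?_
  have h375 : (375 : ℝ) ≤ Real.exp 6 := by
    have h := pow_le_pow_left₀ (by norm_num) Real.exp_one_gt_d9.le 6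
    rw [← Real.exp_nat_mul] at h
    norm_num at h
    exact le_trans (by norm_num) h
  have hn3 : (n : ℝ) ^ 3 = Real.exp (3 * Real.log n) := by
    rw [← Real.exp_log hn', Real.log_exp, ← Real.exp_nat_mul]
    norm_num
  calc 375 * (n : ℝ) ^ 3 * Real.exp (advExponent n lam' ρ) * Real.exp (δ * E)
      ≤ Real.exp 6 * Real.exp (3 * Real.log n) * Real.exp (advExponent n lam' ρ) *
          Real.exp (δ * E) := by rw [hn3]; gcongr
    _ = Real.exp (6 + 3 * Real.log n + advExponent n lam' ρ + δ * E) := by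
        rw [Real.exp_add, Real.exp_add, Real.exp_add]
    _ ≤ Real.exp ((⌊E⌋₊ : ℝ) / C) := by
        refine Real.exp_le_exp.2 ?_
        -- Rounding the degree costs `1 / C` in the exponent. The remaining `3 δ E` is shared
        -- equally by the estimator, the number of samples, and the polynomial factors together with
        -- this loss.
        have hfl : E - 1 ≤ ⌊E⌋₊ := by linarith [Nat.lt_floor_add_one E]
        have h1 : (E - 1) / C ≤ (⌊E⌋₊ : ℝ) / C := div_le_div_of_nonneg_right hfl hC.le
        have h2 : (E - 1) / C = 3 * (δ * E) - 1 / C := by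
          field_simp
          linear_combination (-E) * hδ
        linarith

end Parameters

/-! ### The lower bound on the running time -/

/-- The exponent `lam⁻² (log n)⁻⁴`. -/
noncomputable def hardExponent (n : ℕ) (lam : ℝ) : ℝ := (lam ^ 2)⁻¹ * (Real.log n ^ 4)⁻¹

lemma hardExponent_nonneg (n : ℕ) (lam : ℝ) : 0 ≤ hardExponent n lam := by
  unfold hardExponent
  positivity

namespace HardRegime

variable {n : ℕ → ℕ} {lam ρ : ℕ → ℝ}

/-- The lower bound `ρ ^ 2 n ≥ (log n) ^ 4` inserted into `lam ^ 2 ρ ^ 2 n (log n) ^ 2 ≤ 1` gives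
`lam ^ 2 (log n) ^ 6 ≤ 1`. Hence polynomial factors in `n` are negligible against
`exp(hardExponent)`. -/
lemma eventually_sq_log_le (h : HardRegime n lam ρ) :
    ∀ᶠ k in atTop, Real.log (n k) ^ 2 ≤ hardExponent (n k) (lam k) := by
  filter_upwards [h.eventually_snr one_pos, h.eventually_rho_lower, h.lam_pos,
    h.tendsto_log.eventually_gt_atTop 0] with k h1 h2 hlam hl
  rw [hardExponent, ← mul_inv, inv_eq_one_div, le_div_iff₀ (by positivity)]
  have h3 : lam k ^ 2 * Real.log (n k) ^ 2 * Real.log (n k) ^ 4 ≤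
      lam k ^ 2 * Real.log (n k) ^ 2 * (ρ k ^ 2 * n k) :=
    mul_le_mul_of_nonneg_left h2 (by positivity)
  linarith

lemma eventually_log_le (h : HardRegime n lam ρ) (K : ℝ) {δ : ℝ} (hδ : 0 < δ) :
    ∀ᶠ k in atTop, 6 + 3 * Real.log (n k) + K ≤ δ * hardExponent (n k) (lam k) := by
  filter_upwards [h.eventually_sq_log_le, h.tendsto_log.eventually_ge_atTop (4 / δ),
    h.tendsto_log.eventually_ge_atTop (6 + K)] with k h1 h2 h3
  have h0 : 0 < Real.log (n k) := lt_of_lt_of_le (by positivity) h2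
  have h4 : 4 ≤ δ * Real.log (n k) := by
    rw [div_le_iff₀ hδ] at h2
    linarith
  have h5 : δ * Real.log (n k) ^ 2 ≤ δ * hardExponent (n k) (lam k) :=
    mul_le_mul_of_nonneg_left h1 hδ.le
  nlinarith

/-- The number of samples is affordable because `lam ^ 2 (n ρ ^ 2) ^ 2` divided by the exponent
equals the square of `lam ^ 2 ρ ^ 2 n (log n) ^ 2`, which tends to zero. This is where the
signal-to-noise condition enters with its logarithms. -/
lemma eventually_advExponent_le (h : HardRegime n lam ρ) {δ : ℝ} (hδ : 0 < δ) :
    ∀ᶠ k in atTop, advExponent (n k) (boostedLam (n k) (lam k) (ρ k)) (ρ k) ≤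
      δ * hardExponent (n k) (lam k) := by
  have hδ' : 0 < √(δ / 16) := Real.sqrt_pos.2 (by positivity)
  filter_upwards [h.eventually_snr hδ', h.eventually_rho_upper one_pos, h.rho_mem, h.lam_pos,
    h.eventually_log_le 2 (half_pos hδ), h.tendsto_log.eventually_gt_atTop 0,
    h.dim.eventually_gt_atTop 0] with k h1 h2 hρ hlam h3 hl hn
  rw [advExponent_boostedLam hρ.1.ne' hn]
  have h4 : (ρ k * Real.log (n k)) ^ 2 ≤ 1 :=
    pow_le_one₀ (mul_nonneg hρ.1.le hl.le) h2
  have h5 : lam k ^ 2 * (n k * ρ k ^ 2) ^ 2 ≤ δ / 16 * hardExponent (n k) (lam k) := by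
    rw [hardExponent, ← mul_inv, ← div_eq_mul_inv, le_div_iff₀ (by positivity)]
    have := pow_le_pow_left₀ (by positivity) h1 2
    rw [Real.sq_sqrt (by positivity)] at this
    calc _ = (lam k ^ 2 * ρ k ^ 2 * n k * Real.log (n k) ^ 2) ^ 2 := by ring
      _ ≤ _ := this
  linarith

/-- The constant polynomial gives the lower bound one. For the upper bound, `M ≥ n exp(X)` with `X`
the advantage exponent, so the excess `(exp X + 2) / M` is at most `3 / n`. -/
lemma tendsto_lowDegAdv (h : HardRegime n lam ρ) :
    Tendsto (fun k => lowDegAdv ⌊hardExponent (n k) (lam k)⌋₊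
      (hiddenPlanted (sampleCount (n k) (boostedLam (n k) (lam k) (ρ k)) (ρ k))
        (plantedLaw (n k) (boostedLam (n k) (lam k) (ρ k)) (ρ k)) (noiseLaw (n k)))
      (hiddenNull (sampleCount (n k) (boostedLam (n k) (lam k) (ρ k)) (ρ k)) (noiseLaw (n k))))
      atTop (𝓝 1) := by
  have hlim : Tendsto (fun k => ENNReal.ofReal √(1 + 3 / (n k : ℝ))) atTop (𝓝 1) := by
    have h1 : Tendsto (fun k => 3 / (n k : ℝ)) atTop (𝓝 0) :=
      tendsto_const_nhds.div_atTop (tendsto_natCast_atTop_atTop.comp h.dim)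
    have h2 := ENNReal.tendsto_ofReal ((h1.const_add 1).sqrt)
    simpa using h2
  refine tendsto_of_tendsto_of_tendsto_of_le_of_le' tendsto_const_nhds hlim ?_ ?_
  · filter_upwards [h.rho_mem] with k hρ
    have := isProbabilityMeasure_plantedLaw (n := n k)
      (lam := boostedLam (n k) (lam k) (ρ k)) hρ.1.le hρ.2.le
    have := isProbabilityMeasure_hiddenPlanted (n := n k)
      (sampleCount_pos (n k) (boostedLam (n k) (lam k) (ρ k)) (ρ k))
      (plantedLaw (n k) (boostedLam (n k) (lam k) (ρ k)) (ρ k))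
    have := isProbabilityMeasure_hiddenNull (n := n k)
      (M := sampleCount (n k) (boostedLam (n k) (lam k) (ρ k)) (ρ k))
    exact one_le_lowDegAdv _ _ _
  · filter_upwards [h.rho_mem, h.lam_pos, h.eventually_rho_lower,
      h.tendsto_log.eventually_ge_atTop 100, h.dim.eventually_gt_atTop 0] with k hρ hlam h1 hl hn
    have hn' : (0 : ℝ) < n k := by exact_mod_cast hn
    set L := boostedLam (n k) (lam k) (ρ k) with hL
    refine (lowDegAdv_hidden_le hρ.1.le hρ.2.le (sampleCount_pos _ _ _) fun m hm hmD => ?_).trans ?_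
    · have hmR : (0 : ℝ) < m := by exact_mod_cast hm
      rw [sq_boostedLam]
      exact boosted_degree_dichotomy hl hn' hρ.1 hlam h1 hmR
        ((Nat.cast_le.2 hmD).trans (Nat.floor_le (hardExponent_nonneg _ _)))
    · refine ENNReal.ofReal_le_ofReal (Real.sqrt_le_sqrt ?_)
      have hM := le_sampleCount (n k) L (ρ k)
      have hX := Real.one_le_exp (advExponent_nonneg (n k) L (ρ k))
      have hMpos : (0 : ℝ) < sampleCount (n k) L (ρ k) := by exact_mod_cast sampleCount_pos _ _ _
      change 1 + _ * (Real.exp (advExponent (n k) L (ρ k)) + 2) ≤ _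
      rw [add_le_add_iff_left, inv_mul_eq_div, div_le_div_iff₀ hMpos hn']
      nlinarith

/-- Under the low-degree heuristic, weak recovery is impossible in time `exp (o(lam⁻² (log n)⁻⁴))`,
along any sequence of dimensions. -/
theorem not_fast_recovery (heuristic : HiddenSampleHeuristic) (h : HardRegime n lam ρ)
    {A : ℕ → RProgram} {t : ℕ → ℝ} (hA : ∀ k, (A k).RunsWithin (n k * n k) (t k)) {c : ℝ}
    (hc : 0 < c) (hcorr : ∀ᶠ k in atTop, c ≤ expectedCorr (A k) (n k) (lam k) (ρ k)) :
    ¬ ∀ δ : ℝ, 0 < δ → ∀ᶠ k in atTop, t k ≤ Real.exp (δ * hardExponent (n k) (lam k)) := by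
  intro ht
  obtain ⟨C, hC, hno⟩ := heuristic n
    (fun k => sampleCount (n k) (boostedLam (n k) (lam k) (ρ k)) (ρ k))
    (fun k => boostedLam (n k) (lam k) (ρ k)) ρ h.boosted (fun k => sampleCount_pos _ _ _)
    (fun k => ⌊hardExponent (n k) (lam k)⌋₊) h.tendsto_lowDegAdv
  refine hno (fun k => (cloneTest (n k) (sampleCount (n k) (boostedLam (n k) (lam k) (ρ k)) (ρ k))
      (lam k / boostedLam (n k) (lam k) (ρ k)) (testThreshold (n k)
        (sampleCount (n k) (boostedLam (n k) (lam k) (ρ k)) (ρ k)))).program (A k)) ?_ ?_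
  · have hδ : (0 : ℝ) < 1 / (3 * C) := by positivity
    filter_upwards [ht _ hδ, h.eventually_advExponent_le hδ, h.eventually_log_le (1 / C) hδ,
      h.tendsto_log.eventually_gt_atTop 0, h.dim.eventually_gt_atTop 0] with k h1 h2 h3 hl hn
    exact runsWithin_cloneTest (hA k) hn hl hC (by field_simp) (hardExponent_nonneg _ _) h1 h2 h3
  · refine ⟨c / 4, by positivity, ?_⟩
    -- With `ρ ^ 2 ≤ η` and `3 / log n < η` the quantity in `testThreshold_lt` is below `256 * 5 * η
    -- = 5 c ^ 2 / 64 < c ^ 2 / 8`.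
    set η : ℝ := c ^ 2 / 16384 with hη
    have hη0 : 0 < η := by positivity
    filter_upwards [hcorr, h.rho_mem, h.lam_pos, h.eventually_rho_lower,
      h.eventually_rho_upper (Real.sqrt_pos.2 hη0), h.tendsto_log.eventually_ge_atTop 8,
      h.tendsto_log.eventually_ge_atTop (48 / c), h.tendsto_log.eventually_gt_atTop (3 / η),
      h.dim.eventually_gt_atTop 0] with k hck hρ hlam h1 h2 hl h3 h4 hn
    have hl0 : 0 < Real.log (n k) := by linarith
    have h5 : ρ k ^ 2 ≤ η := by
      have : ρ k ≤ √η := (le_mul_of_one_le_right hρ.1.le (by linarith)).trans h2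
      have := pow_le_pow_left₀ hρ.1.le this 2
      rwa [Real.sq_sqrt hη0.le] at this
    have h6 : 3 / Real.log (n k) < η := by
      rw [div_lt_iff₀ hl0]
      rw [div_lt_iff₀ hη0] at h4
      linarith
    have h7 : 12 / Real.log (n k) ≤ c / 4 := by
      rw [div_le_iff₀ hl0]
      rw [div_le_iff₀ hc] at h3
      linarith
    have := testError_cloneTest_le (hA k) hc hn hρ.1 hρ.2.le hlam hl h1
      (by rw [hη] at h5 h6; nlinarith [sq_pos_of_pos hc]) hck rfl
    linarith

/-- An algorithm may be fast only along a sparse set of dimensions; the regime passes to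
subsequences so that this case is excluded too. -/
lemma comp {φ : ℕ → ℕ} (h : HardRegime (fun k => k) lam ρ) (hφ : Tendsto φ atTop atTop) :
    HardRegime φ (fun k => lam (φ k)) (fun k => ρ (φ k)) where
  dim := hφ
  lam_pos := hφ.eventually h.lam_pos
  rho_mem := hφ.eventually h.rho_mem
  rho_lower := h.rho_lower.comp_tendsto hφ
  rho_upper := h.rho_upper.comp_tendsto hφ
  snr := h.snr.comp_tendsto hφ

/-- The running time of weak recovery. -/
theorem exp_le_runningTime (heuristic : HiddenSampleHeuristic) (h : HardRegime (fun k => k) lam ρ)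
    {A : ℕ → RProgram} {t : ℕ → ℝ} (hA : ∀ k, (A k).RunsWithin (k * k) (t k))
    (hw : WeakRecovery A lam ρ) :
    ∃ c : ℝ, 0 < c ∧ ∀ᶠ k : ℕ in atTop, Real.exp (c * hardExponent k (lam k)) ≤ t k := by
  by_contra hno
  push Not at hno
  obtain ⟨c, hc, hcorr⟩ := hw
  -- Failure of the bound for every constant `1 / (j + 1)` yields, by a diagonal choice, a
  -- subsequence along which `t` is at most `exp(o(hardExponent))`.
  have hfreq : ∀ j : ℕ, ∃ᶠ k in atTop,
      t k < Real.exp (1 / ((j : ℝ) + 1) * hardExponent k (lam k)) := fun j =>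
    hno (1 / ((j : ℝ) + 1)) (by positivity)
  obtain ⟨φ, hφ, hlt⟩ := extraction_forall_of_frequently hfreq
  have hφ' := hφ.tendsto_atTop
  refine (h.comp hφ').not_fast_recovery heuristic (A := fun j => A (φ j)) (t := fun j => t (φ j))
    (fun j => hA (φ j)) hc (hφ'.eventually hcorr) fun δ hδ => ?_
  have hsmall : ∀ᶠ j : ℕ in atTop, 1 / ((j : ℝ) + 1) ≤ δ :=
    (tendsto_one_div_add_atTop_nhds_zero_nat.eventually_lt_const hδ).mono fun _ hj => hj.le
  filter_upwards [hsmall] with j hj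
  exact (hlt j).le.trans (Real.exp_le_exp.2
    (mul_le_mul_of_nonneg_right hj (hardExponent_nonneg _ _)))

end HardRegime

/-! ### Polynomial scaling -/

lemma tendsto_log_pow_mul_rpow (j : ℕ) {s : ℝ} (hs : s < 0) :
    Tendsto (fun n : ℕ => Real.log n ^ j * (n : ℝ) ^ s) atTop (𝓝 0) := by
  have h := (isLittleO_log_rpow_rpow_atTop (j : ℝ) (neg_pos.2 hs)).tendsto_div_nhds_zero
  refine (h.comp tendsto_natCast_atTop_atTop).congr fun n => ?_
  simp only [Function.comp_apply, Real.rpow_natCast]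
  rw [Real.rpow_neg (Nat.cast_nonneg n), div_inv_eq_mul]

lemma hardRegime_rpow {a b : ℝ} (hb : 0 < b) (hb' : b < 1 / 2)
    (hab : 1 < 2 * a + 2 * b) :
    HardRegime (fun n => n) (fun n => (n : ℝ) ^ (-a)) (fun n => (n : ℝ) ^ (-b)) where
  dim := tendsto_id
  lam_pos := (eventually_gt_atTop 0).mono fun n hn => Real.rpow_pos_of_pos (by exact_mod_cast hn) _
  rho_mem := (eventually_gt_atTop 1).mono fun n hn =>
    ⟨Real.rpow_pos_of_pos (by exact_mod_cast (zero_lt_one.trans hn)) _,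
      Real.rpow_lt_one_of_one_lt_of_neg (by exact_mod_cast hn) (neg_lt_zero.2 hb)⟩
  rho_lower := by
    refine (isLittleO_iff_tendsto' ?_).2 ?_
    · filter_upwards [eventually_gt_atTop 0] with n hn h0
      exact absurd h0 (Real.rpow_pos_of_pos (by exact_mod_cast hn) _).ne'
    · refine (tendsto_log_pow_mul_rpow 2 (s := b - 1 / 2) (by linarith)).congr' ?_
      filter_upwards [eventually_gt_atTop 0] with n hn
      have hn' : (0 : ℝ) < n := by exact_mod_cast hn
      rw [Real.sqrt_eq_rpow, Real.rpow_sub hn', Real.rpow_neg hn'.le, div_inv_eq_mul]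
      ring
  rho_upper := by
    refine (isLittleO_iff_tendsto' ?_).2 ?_
    · filter_upwards [eventually_gt_atTop 1] with n hn h0
      have : 0 < Real.log n := Real.log_pos (by exact_mod_cast hn)
      exact absurd h0 (by positivity)
    · refine (tendsto_log_pow_mul_rpow 1 (s := -b) (by linarith)).congr fun n => ?_
      rw [one_div, div_inv_eq_mul, pow_one, mul_comm]
  snr := by
    refine (isLittleO_iff_tendsto' ?_).2 ?_
    · filter_upwards [eventually_gt_atTop 1] with n hn h0
      have : 0 < Real.log n := Real.log_pos (by exact_mod_cast hn)
      exact absurd h0 (by positivity)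
    · refine (tendsto_log_pow_mul_rpow 2 (s := 1 - 2 * a - 2 * b) (by linarith)).congr' ?_
      filter_upwards [eventually_gt_atTop 0] with n hn
      have hn' : (0 : ℝ) < n := by exact_mod_cast hn
      have e : (n : ℝ) ^ (1 - 2 * a - 2 * b) = ((n : ℝ) ^ (-a)) ^ 2 * ((n : ℝ) ^ (-b)) ^ 2 * n := by
        rw [← Real.rpow_natCast, ← Real.rpow_natCast, ← Real.rpow_mul hn'.le,
          ← Real.rpow_mul hn'.le]
        nth_rewrite 4 [← Real.rpow_one (n : ℝ)]
        rw [← Real.rpow_add hn', ← Real.rpow_add hn']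
        congr 1
        push_cast
        ring
      rw [e, one_div, div_inv_eq_mul]
      ring

lemma exists_exponent_sequence (a : ℝ) {c : ℝ} (hc : 0 < c) :
    ∃ e : ℕ → ℝ, Tendsto e atTop (𝓝 0) ∧ ∀ᶠ n : ℕ in atTop,
      (n : ℝ) ^ (2 * a - e n) = c * hardExponent n ((n : ℝ) ^ (-a)) := by
  -- The sequence solves `n ^ (-e) = c (log n)⁻⁴`, absorbing the constant and the logarithms into
  -- the exponent.
  refine ⟨fun n => (4 * Real.log (Real.log n) - Real.log c) / Real.log n, ?_, ?_⟩
  · have hlog : Tendsto (fun n : ℕ => Real.log n) atTop atTop :=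
      Real.tendsto_log_atTop.comp tendsto_natCast_atTop_atTop
    have h1 : Tendsto (fun n : ℕ => Real.log (Real.log n) / Real.log n) atTop (𝓝 0) :=
      (Real.isLittleO_log_id_atTop.tendsto_div_nhds_zero).comp hlog
    have h2 : Tendsto (fun n : ℕ => Real.log c / Real.log n) atTop (𝓝 0) :=
      tendsto_const_nhds.div_atTop hlog
    have h3 := (h1.const_mul 4).sub h2
    simp only [mul_zero, sub_zero] at h3
    refine h3.congr fun n => ?_
    ring
  · filter_upwards [eventually_gt_atTop 1] with n hn
    have hn' : (0 : ℝ) < n := by exact_mod_cast zero_lt_one.trans hn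
    have hl : 0 < Real.log n := Real.log_pos (by exact_mod_cast hn)
    have e1 : (((n : ℝ) ^ (-a)) ^ 2)⁻¹ = Real.exp (2 * a * Real.log n) := by
      rw [Real.rpow_def_of_pos hn', ← Real.exp_nat_mul, ← Real.exp_neg]
      congr 1
      push_cast
      ring
    have e2 : (Real.log n ^ 4)⁻¹ = Real.exp (-(4 * Real.log (Real.log n))) := by
      rw [Real.exp_neg, ← Real.exp_log (pow_pos hl 4), Real.log_pow]
      norm_num
    rw [hardExponent, e1, e2, Real.rpow_def_of_pos hn']
    nth_rewrite 2 [← Real.exp_log hc]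
    rw [← Real.exp_add, ← Real.exp_add]
    congr 1
    field_simp
    ring

/-! ### Assembly of the general bound and its polynomial case -/

theorem mainTheorem2 (heuristic : HiddenSampleHeuristic) :
    (∀ lam ρ : ℕ → ℝ, HardRegime (fun n => n) lam ρ →
      ∀ (A : ℕ → RProgram) (t : ℕ → ℝ), (∀ n, (A n).RunsWithin (n * n) (t n)) →
        WeakRecovery A lam ρ →
          ∃ c : ℝ, 0 < c ∧ ∀ᶠ n : ℕ in atTop,
            Real.exp (c * ((lam n ^ 2)⁻¹ * (Real.log n ^ 4)⁻¹)) ≤ t n) ∧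
    (∀ a b : ℝ, 0 < a → 0 < b → b < 1 / 2 → 1 < 2 * a + 2 * b →
      ∀ (A : ℕ → RProgram) (t : ℕ → ℝ), (∀ n, (A n).RunsWithin (n * n) (t n)) →
        WeakRecovery A (fun n => (n : ℝ) ^ (-a)) (fun n => (n : ℝ) ^ (-b)) →
          ∃ e : ℕ → ℝ, Tendsto e atTop (𝓝 0) ∧ ∀ᶠ n : ℕ in atTop,
            Real.exp ((n : ℝ) ^ (2 * a - e n)) ≤ t n) := by
  refine ⟨fun lam ρ h A t hA hw => h.exp_le_runningTime heuristic hA hw, ?_⟩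
  intro a b _ hb hb' hab A t hA hw
  obtain ⟨c, hc, ht⟩ := (hardRegime_rpow hb hb' hab).exp_le_runningTime heuristic hA hw
  obtain ⟨e, he, heq⟩ := exists_exponent_sequence a hc
  refine ⟨e, he, ?_⟩
  filter_upwards [ht, heq] with n h1 h2
  rwa [h2]
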